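/- A *tight flute surface* is a hyperbolic surface obtained by gluing geodesic pairs of pants $P_0,P_1,P_2,\dots$ in succession, where $P_0$ has two cusps and one geodesic boundary curve $\alpha_1$, and $P_n$ ($n\ge 1$) has one cusp and two geodesic boundary curves $\alpha_n,\alpha_{n+1}$; $P_{n-1}$ and $P_n$ are glued along $\alpha_n$. The closed geodesics $\alpha_n$ are the *cuffs*, and $l_n>0$ denotes the length of $\alpha_n$. The surface need not be geodesically complete. A *marked* tight flute surface carries an identification, up to homotopy, with a fixed topological flute surface, taking cuffs to cuffs. The *twist* $t_n\in\mathbb R$ at $\alpha_n$ is the signed distance along a lift of $\alpha_n$ to the universal covering between the foot of the perpendicular coming from the adjacent lift of $\alpha_{n-1}$ (of a cusp of $P_0$, if $n=1$) through $P_{n-1}$ and the foot of the perpendicular coming from the adjacent lift of $\alpha_{n+1}$ through $P_n$, where the lifts are fixed by the marking. The lengths $(l_n)_{n\ge1}$ are *rapidly increasing* if they increase strictly to $\infty$ and $\sum_{i=1}^n l_i=o(l_{n+1})$ as $n\to\infty$. For marked surfaces $X,Y$ and a base surface $X_0$, the *length spectrum distance* is $$d_{ls}(X,Y)=\tfrac12\sup_{\gamma}\Bigl|\log\frac{l_X(\gamma)}{l_Y(\gamma)}\Bigr|,$$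 where $\gamma$ runs over the simple closed geodesics of $X_0$ and $l_X(\gamma)$ is the length of the closed geodesic of $X$ in the homotopy class corresponding to $\gamma$ under the markings; the *length spectrum Teichmüller space* $T_{ls}(X_0)$ consists of the marked surfaces $X$ with $d_{ls}(X,X_0)<\infty$. **Theorem.** Let $X_0$ be a geodesically complete tight flute surface with twists $(t_n)_{n\ge1}$ and rapidly increasing cuff lengths $(l_n)_{n\ge1}$. For $k\in\mathbb N$ let $X_k$ be a marked (not necessarily complete) tight flute surface with the same cuff lengths $(l_n)$ and with twists $t_{X_k}(\alpha_n)=t_n+O(l_n)$ uniformly in $k$, that is, there is a constant $C$ with $|t_{X_k}(\alpha_n)-t_n|\le C\,l_n$ for all $k$ and all $n\ge1$. If $\lim_{k\to\infty}t_{X_k}(\alpha_n)=t_n$ for each $n\ge1$, then every $X_k$ belongs to $T_{ls}(X_0)$ and $X_k$ converges to $X_0$ in the length spectrum metric, that is, $d_{ls}(X_k,X_0)\to0$ as $k\to\infty$. -/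

import Mathlib

open scoped UpperHalfPlane MatrixGroups

noncomputable section

/-- Translation length of an orientation preserving isometry of the hyperbolic plane:
the infimum of its displacement.  It is positive exactly for hyperbolic elements; a fixed point free
element of translation length zero is parabolic. -/
def transLength (g : SL(2, ℝ)) : ℝ := ⨅ z : ℍ, dist z (g • z)

/-- The points where the displacement attains the translation length.  This is the axis if `g` is
hyperbolic, and it is empty if `g` is parabolic. -/
def axisOf (g : SL(2, ℝ)) : Set ℍ := {z | dist z (g • z) = transLength g}

/-- Geodesic convexity: a set contains the geodesic segment between any two of its points. -/
def GeodConvex (R : Set ℍ) : Prop :=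
  ∀ x ∈ R, ∀ y ∈ R, ∀ z : ℍ, dist x z + dist z y = dist x y → z ∈ R

/-- The fundamental group of the flute surface is free on loops `c 0, c 1, c 2, …` around its
punctures.  `bdry n = c 0 * c 1 * ⋯ * c n`; for `n ≥ 1` it is the class of the `n`-th cuff,
the curve that separates the punctures `0, …, n` from the other ones, and `bdry 0` is the first
puncture. -/
def bdry : ℕ → FreeGroup ℕ
  | 0 => FreeGroup.of 0
  | n + 1 => bdry n * FreeGroup.of (n + 1)

/-- The fundamental group of the `n`-th pair of pants, whose three ends are `bdry n`,
`c (n + 1)` and `bdry (n + 1) = bdry n * c (n + 1)`. -/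
def pantsGroup (n : ℕ) : Subgroup (FreeGroup ℕ) :=
  Subgroup.closure {bdry n, FreeGroup.of (n + 1)}

/-- A marked tight flute surface, built by gluing tight geodesic pairs of pants
`P 0, P 1, P 2, …` in succession, given through its universal covering.

The surface is `D / Γ`, where `Γ = hol (FreeGroup ℕ)` acts freely and properly discontinuously on
the hyperbolic plane (only the action matters, so that the holonomy may be taken in `SL(2, ℝ)`
in place of `PSL(2, ℝ)`) and where `D` is the union of all translates of the closed convex regions
`region n`.  The marking is the identification `hol` of the fundamental group.
The region `region n` is the universal covering of the pair of pants `P n = region n / pantsGroup n`.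
Its boundary consists of the lifts of the cuffs `bdry n` and `bdry (n + 1)` (of `bdry 1` only
for `n = 0`, because `bdry 0` is a puncture); the remaining ends of `P n` are cusps.  Distinct
translates do not overlap, so that `P n` and `P (n + 1)` lie on the two sides of their
common cuff `bdry (n + 1)`. The surface is not required to be complete. -/
structure TightFlute where
  /-- the marked holonomy -/
  hol : FreeGroup ℕ →* SL(2, ℝ)
  free : ∀ g : FreeGroup ℕ, g ≠ 1 → ∀ z : ℍ, hol g • z ≠ z
  properlyDiscontinuous : ∀ K : Set ℍ, IsCompact K →
    {g : FreeGroup ℕ | (((fun z : ℍ => hol g • z) '' K) ∩ K).Nonempty}.Finite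
  /-- every puncture is a cusp -/
  cusp : ∀ n : ℕ, transLength (hol (FreeGroup.of n)) = 0
  /-- every cuff is a closed geodesic -/
  cuff : ∀ n : ℕ, 1 ≤ n → 0 < transLength (hol (bdry n))
  /-- the universal coverings of the pairs of pants -/
  region : ℕ → Set ℍ
  region_closed : ∀ n, IsClosed (region n)
  region_convex : ∀ n, GeodConvex (region n)
  region_interior : ∀ n, (interior (region n)).Nonempty
  region_invariant : ∀ n, ∀ g ∈ pantsGroup n, (fun z : ℍ => hol g • z) '' region n = region n
  /-- the boundary of a pair of pants consists of its two cuffs -/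
  region_frontier : ∀ n, frontier (region n) =
    ⋃ g ∈ pantsGroup n, (fun z : ℍ => hol g • z) ''
      (axisOf (hol (bdry n)) ∪ axisOf (hol (bdry (n + 1))))
  /-- the pairs of pants are embedded with disjoint interiors -/
  region_disjoint : ∀ (n m : ℕ) (g : FreeGroup ℕ),
    (((fun z : ℍ => hol g • z) '' region n) ∩ interior (region m)).Nonempty →
      n = m ∧ g ∈ pantsGroup n

namespace TightFlute

/-- The length on the surface of the closed geodesic in the class of `g`. -/
def length (X : TightFlute) (g : FreeGroup ℕ) : ℝ := transLength (X.hol g)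

/-- The length of the `n`-th cuff, `n ≥ 1`. -/
def cuffLength (X : TightFlute) (n : ℕ) : ℝ := X.length (bdry n)

/-- The universal covering `D` of the glued surface, as a subset of the hyperbolic plane. -/
def cover (X : TightFlute) : Set ℍ :=
  ⋃ (n : ℕ) (g : FreeGroup ℕ), (fun z : ℍ => X.hol g • z) '' X.region n

/-- Geodesic completeness: every geodesic of the glued surface can be extended infinitely far in
both directions within the surface. -/
def GeodesicallyComplete (X : TightFlute) : Prop :=
  ∀ γ : ℝ → ℍ, Isometry γ → γ 0 ∈ X.cover → ∀ s : ℝ, γ s ∈ X.cover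

/-- `γ` is a lift of the closed geodesic in the class of `g`: it is the axis of the hyperbolic element
`hol g`, parametrized by arc length in the direction of translation. -/
def IsLift (X : TightFlute) (g : FreeGroup ℕ) (γ : ℝ → ℍ) : Prop :=
  0 < X.length g ∧ Isometry γ ∧ ∀ s : ℝ, X.hol g • γ s = γ (s + X.length g)

/-- The class `g` is represented by a simple closed geodesic: the closed geodesic, a closed curve on
the surface of period `X.length g`, does not meet itself. -/
def IsSimpleClosedGeodesic (X : TightFlute) (g : FreeGroup ℕ) : Prop :=
  ∃ γ : ℝ → ℍ, X.IsLift g γ ∧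
    ∀ (h : FreeGroup ℕ) (s s' : ℝ), X.hol h • γ s = γ s' → ∃ m : ℤ, s' = s + m * X.length g

/-- `γ s` is the foot on the geodesic `γ` of the perpendicular to `γ` from the axis of `hol g` (from the
fixed point at infinity, if `hol g` is parabolic).  The displacement of a hyperbolic element
is a strictly increasing function of the distance from its axis, and that of a parabolic one
decreases strictly along the nested horodisks at its fixed point, so that in both cases
the foot is the point of `γ` where the displacement is smallest. -/
def IsFoot (X : TightFlute) (g : FreeGroup ℕ) (γ : ℝ → ℍ) (s : ℝ) : Prop :=
  ∀ s' : ℝ, dist (γ s) (X.hol g • γ s) ≤ dist (γ s') (X.hol g • γ s')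

/-- `t` is the twist parameter of the marked surface along the `n`-th cuff, `n ≥ 1`.
The cuff bounds `P (n - 1)` and `P n`.  On its lift, oriented by the class of the cuff, `t` is
the signed distance from the foot of the perpendicular that comes from `bdry (n - 1)` through
`P (n - 1)` to the foot of the perpendicular that comes from `bdry (n + 1)` through `P n`. -/
def HasTwist (X : TightFlute) (n : ℕ) (t : ℝ) : Prop :=
  ∃ γ : ℝ → ℍ, X.IsLift (bdry n) γ ∧ X.IsFoot (bdry (n - 1)) γ 0 ∧ X.IsFoot (bdry (n + 1)) γ t

/-- The length spectrum distance between two marked surfaces, a supremum over the simple closed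
geodesics of the base surface `X₀`. -/
def lsDist (X₀ X Y : TightFlute) : ENNReal :=
  ⨆ (g : FreeGroup ℕ) (_ : X₀.IsSimpleClosedGeodesic g),
    ENNReal.ofReal (1 / 2 * |Real.log (X.length g / Y.length g)|)

/-- The marked surface `X` belongs to the length spectrum Teichmüller space of `X₀`. -/
def InLengthSpectrumTeich (X₀ X : TightFlute) : Prop :=
  (∀ g : FreeGroup ℕ, X₀.IsSimpleClosedGeodesic g → 0 < X.length g) ∧ lsDist X₀ X X₀ < ⊤

end TightFlute

/-- A sequence `l 1, l 2, …` is rapidly increasing if it increases strictly to infinity and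
`l 1 + ⋯ + l n = o(l (n + 1))`.  The entry `l 0` is irrelevant. -/
def RapidlyIncreasing (l : ℕ → ℝ) : Prop :=
  (∀ n : ℕ, 1 ≤ n → l n < l (n + 1)) ∧ Filter.Tendsto l Filter.atTop Filter.atTop ∧
    (fun n : ℕ => ∑ i ∈ Finset.Icc 1 n, l i) =o[Filter.atTop] (fun n : ℕ => l (n + 1))

end

noncomputable section

/-! Two surfaces X and Y with equal cuff lengths are built from isometric pairs of pants. For each n
an isometry A n of the plane therefore intertwines the two holonomies on `pantsGroup n`
(`exists_intertwines`). On a lift of the common cuff of P n and P (n + 1), A n and A (n + 1) differ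
by a translation through the difference of the twists (`dist_intertwiners`).

A geodesic segment of X from x₀ to g x₀ crosses lifts of cuffs along a reduced path in the dual
tree. Carrying each piece to Y by the translated A n, and bridging each crossed cuff i by a jump of
size δ i = |t i - t' i|, gives a path from y₀ to g y₀. The jumps have to be paid for by length. A
path that rises from P 0 to P n and returns to P 0 makes two jumps at each of the cuffs 1, ..., n.
At its top it joins two different lifts of the cuff n within one lift of P n, and by ping-pong this
piece has length at least `pantsHeight` n, which is at least (l (n + 1) - l n) / 2
(`line_separation`, `half_sub_le_pantsHeight`). If 2 (δ 1 + ... + δ n) ≤ ε `pantsHeight` n for all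
n, every descent is prepaid by the turn above it, and displacements grow at most by the factor 1 + ε
(`displacement_le`). Applied to all powers of g, this bounds translation lengths by the same factor
(`length_le`). With X and Y exchanged, it gives |log| ≤ ε for every length ratio.

It remains to choose ε. Since δ i ≤ C l i and l 1 + ... + l n = o(l (n + 1)), the condition holds
for any given ε > 0 once n ≥ N, with N independent of k (`exists_sum_le`). The finitely many n < N
are handled by the convergence of each twist.

That the pants are determined by their lengths needs the sign of the product of the three boundary
traces; `trace_product_neg` derives it from the embedding of the convex region. -/

namespace Hyp

/-! ### The hyperboloid model and the displacement formula. -/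

/-- The point of the hyperboloid `αγ - β² = 1` in Minkowski space that represents `z`. -/
def vec (z : ℍ) : ℝ × ℝ × ℝ := ((z.re ^ 2 + z.im ^ 2) / z.im, z.re / z.im, 1 / z.im)

/-- The linear functional on Minkowski space whose kernel cuts out the axis of `g`. -/
def axisFun (g : SL(2, ℝ)) (v : ℝ × ℝ × ℝ) : ℝ :=
  g 1 0 * v.1 + (g 1 1 - g 0 0) * v.2.1 - g 0 1 * v.2.2

/-- The trace. -/
def tr (g : SL(2, ℝ)) : ℝ := g 0 0 + g 1 1

theorem det_eq (g : SL(2, ℝ)) : g 0 0 * g 1 1 - g 0 1 * g 1 0 = 1 := by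
  have := g.det_coe
  rwa [Matrix.det_fin_two] at this

theorem denom_pos (g : SL(2, ℝ)) (z : ℍ) :
    0 < (g 1 0 * z.re + g 1 1) ^ 2 + (g 1 0 * z.im) ^ 2 := by
  have hd := det_eq g
  have hy := z.im_pos
  by_cases h : g 1 0 = 0
  · have : g 1 1 ≠ 0 := by
      rintro h'
      simp [h, h'] at hd
    rw [h]
    have := sq_pos_of_ne_zero this
    nlinarith
  · have : 0 < (g 1 0 * z.im) ^ 2 := by positivity
    nlinarith [sq_nonneg (g 1 0 * z.re + g 1 1)]

theorem re_smul (g : SL(2, ℝ)) (z : ℍ) :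
    (g • z).re = (g 0 0 * g 1 0 * (z.re ^ 2 + z.im ^ 2) + (g 0 0 * g 1 1 + g 0 1 * g 1 0) * z.re
      + g 0 1 * g 1 1) / ((g 1 0 * z.re + g 1 1) ^ 2 + (g 1 0 * z.im) ^ 2) := by
  have h := congrArg Complex.re (UpperHalfPlane.coe_specialLinearGroup_apply g z)
  rw [UpperHalfPlane.coe_re] at h
  rw [h, Complex.div_re, ← add_div]
  simp only [Complex.normSq_apply, Complex.add_re, Complex.add_im, Complex.mul_re, Complex.mul_im,
    Complex.ofReal_re, Complex.ofReal_im, UpperHalfPlane.coe_re, UpperHalfPlane.coe_im,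
    Algebra.algebraMap_self, RingHom.id_apply]
  congr 1 <;> ring

theorem im_smul (g : SL(2, ℝ)) (z : ℍ) :
    (g • z).im = z.im / ((g 1 0 * z.re + g 1 1) ^ 2 + (g 1 0 * z.im) ^ 2) := by
  have h := congrArg Complex.im (UpperHalfPlane.coe_specialLinearGroup_apply g z)
  rw [UpperHalfPlane.coe_im] at h
  rw [h, Complex.div_im, ← sub_div]
  simp only [Complex.normSq_apply, Complex.add_re, Complex.add_im, Complex.mul_re, Complex.mul_im,
    Complex.ofReal_re, Complex.ofReal_im, UpperHalfPlane.coe_re, UpperHalfPlane.coe_im,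
    Algebra.algebraMap_self, RingHom.id_apply]
  congr 1
  · linear_combination z.im * det_eq g
  · ring

/-- Read as a symmetric 2 × 2 matrix S, the vector transforms by g S gᵀ, so the action is linear. -/
theorem vec_smul (g : SL(2, ℝ)) (z : ℍ) :
    vec (g • z) =
      (g 0 0 ^ 2 * (vec z).1 + 2 * g 0 0 * g 0 1 * (vec z).2.1 + g 0 1 ^ 2 * (vec z).2.2,
       g 0 0 * g 1 0 * (vec z).1 + (g 0 0 * g 1 1 + g 0 1 * g 1 0) * (vec z).2.1
        + g 0 1 * g 1 1 * (vec z).2.2,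
       g 1 0 ^ 2 * (vec z).1 + 2 * g 1 0 * g 1 1 * (vec z).2.1 + g 1 1 ^ 2 * (vec z).2.2) := by
  have hy := z.im_ne_zero
  have hd := (denom_pos g z).ne'
  have hdet := det_eq g
  ext
  · simp only [vec, re_smul, im_smul]
    generalize hD : (g 1 0 * z.re + g 1 1) ^ 2 + (g 1 0 * z.im) ^ 2 = D at hd
    field_simp
    rw [← hD]
    linear_combination (-z.im ^ 2 * (g 0 0 * g 1 1 - g 0 1 * g 1 0 + 1)) * hdet
  · simp only [vec, re_smul, im_smul]
    generalize (g 1 0 * z.re + g 1 1) ^ 2 + (g 1 0 * z.im) ^ 2 = D at hd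
    field_simp
  · simp only [vec, im_smul]
    field_simp
    ring

/-- The Minkowski form. -/
def mink (v w : ℝ × ℝ × ℝ) : ℝ := (v.1 * w.2.2 + w.1 * v.2.2 - 2 * v.2.1 * w.2.1) / 2

theorem mink_vec_self (z : ℍ) : mink (vec z) (vec z) = 1 := by
  have := z.im_ne_zero
  simp only [mink, vec]
  field_simp
  ring

theorem cosh_dist (z w : ℍ) : Real.cosh (dist z w) = mink (vec z) (vec w) := by
  have h1 := z.im_ne_zero
  have h2 := w.im_ne_zero
  rw [UpperHalfPlane.cosh_dist, Complex.dist_eq, Complex.sq_norm, Complex.normSq_apply]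
  simp only [Complex.sub_re, Complex.sub_im, UpperHalfPlane.coe_re, UpperHalfPlane.coe_im, mink, vec]
  field_simp
  ring

theorem vec_third_pos (z : ℍ) : 0 < (vec z).2.2 := by
  have := z.im_pos
  simp only [vec]
  positivity

theorem vec_injective {z w : ℍ} (h : vec z = vec w) : z = w := by
  have h1 := z.im_ne_zero
  have h2 := w.im_ne_zero
  have e3 : 1 / z.im = 1 / w.im := congrArg (fun v => v.2.2) h
  have e2 : z.re / z.im = w.re / w.im := congrArg (fun v => v.2.1) h
  have : z.im = w.im := by simpa using e3
  rw [this] at e2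
  exact UpperHalfPlane.ext_re_im (by field_simp at e2; exact e2) this

theorem vec_scale {z w : ℍ} {t : ℝ} (ht : 0 ≤ t) (h : vec z = t • vec w) : z = w := by
  have h1 := mink_vec_self z
  have : mink (t • vec w) (t • vec w) = t ^ 2 * mink (vec w) (vec w) := by
    simp only [mink, Prod.smul_fst, Prod.smul_snd, smul_eq_mul]; ring
  rw [h, this, mink_vec_self] at h1
  have : t = 1 := by nlinarith
  subst this
  exact vec_injective (by simpa using h)

/-- A timelike vector is a multiple of a point of the hyperboloid. -/
theorem exists_vec {α β γ : ℝ} (hγ : 0 < γ) (h : 0 < α * γ - β ^ 2) :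
    ∃ (z : ℍ) (r : ℝ), 0 < r ∧ (α, β, γ) = r • vec z := by
  obtain ⟨r, hr, hs⟩ : ∃ r : ℝ, 0 < r ∧ r ^ 2 = α * γ - β ^ 2 :=
    ⟨_, Real.sqrt_pos.2 h, Real.sq_sqrt h.le⟩
  refine ⟨⟨⟨β / γ, r / γ⟩, by positivity⟩, r, hr, ?_⟩
  simp only [vec, UpperHalfPlane.re, UpperHalfPlane.im, Prod.smul_mk, smul_eq_mul]
  ext
  · simp only
    field_simp
    linarith
  · simp only
    field_simp
  · simp only
    field_simp

/-- `p` is on the geodesic segment from `x` to `y`. -/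
def Between (x p y : ℍ) : Prop := ∃ s t : ℝ, 0 ≤ s ∧ 0 ≤ t ∧ vec p = s • vec x + t • vec y

theorem Between.dist_add {x p y : ℍ} (h : Between x p y) : dist x p + dist p y = dist x y := by
  obtain ⟨s, t, hs, ht, h⟩ := h
  set C := Real.cosh (dist x y) with hC
  have e0 := mink_vec_self x
  have e1 := mink_vec_self y
  have e2 := mink_vec_self p
  have e3 := cosh_dist x y
  have c1 := cosh_dist x p
  have c2 := cosh_dist p y
  rw [h] at e2 c1 c2
  simp only [mink, Prod.smul_fst, Prod.smul_snd, Prod.fst_add, Prod.snd_add, smul_eq_mul]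
    at e0 e1 e2 e3 c1 c2
  rw [← hC] at e3
  have k1 : Real.cosh (dist x p) = s + t * C := by rw [c1, e3]; linear_combination s * e0
  have k2 : Real.cosh (dist p y) = s * C + t := by rw [c2, e3]; linear_combination t * e1
  have k0 : s ^ 2 + 2 * s * t * C + t ^ 2 = 1 := by
    rw [e3]; linear_combination e2 - s ^ 2 * e0 - t ^ 2 * e1
  have hS : 0 ≤ Real.sinh (dist x y) := Real.sinh_nonneg_iff.2 dist_nonneg
  have s0 := Real.cosh_sq (dist x y)
  have s1 : Real.sinh (dist x p) = t * Real.sinh (dist x y) := by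
    have a1 := Real.cosh_sq (dist x p)
    have a2 : 0 ≤ Real.sinh (dist x p) := Real.sinh_nonneg_iff.2 dist_nonneg
    rw [← sq_eq_sq₀ a2 (by positivity)]
    rw [← hC] at s0
    linear_combination -a1 + t ^ 2 * s0 + (Real.cosh (dist x p) + s + t * C) * k1 + k0
  have s2 : Real.sinh (dist p y) = s * Real.sinh (dist x y) := by
    have a1 := Real.cosh_sq (dist p y)
    have a2 : 0 ≤ Real.sinh (dist p y) := Real.sinh_nonneg_iff.2 dist_nonneg
    rw [← sq_eq_sq₀ a2 (by positivity)]
    rw [← hC] at s0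
    linear_combination -a1 + s ^ 2 * s0 + (Real.cosh (dist p y) + s * C + t) * k2 + k0
  have key : Real.cosh (dist x p + dist p y) = Real.cosh (dist x y) := by
    rw [Real.cosh_add, k1, k2, s1, s2, ← hC]
    rw [← hC] at s0
    linear_combination C * k0 - s * t * s0
  have n1 : 0 ≤ dist x p + dist p y := by positivity
  have := Real.cosh_abs (dist x p + dist p y)
  exact Real.cosh_strictMonoOn.injOn n1 (Set.mem_Ici.2 dist_nonneg) key

/-- Nonnegative combinations of points of the hyperboloid are timelike. -/
theorem exists_vec_combination {x y : ℍ} {s t : ℝ} (hs : 0 ≤ s) (ht : 0 ≤ t) (hst : 0 < s + t) :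
    ∃ (p : ℍ) (r : ℝ), 0 < r ∧ s • vec x + t • vec y = r • vec p ∧ Between x p y := by
  have e0 := mink_vec_self x
  have e1 := mink_vec_self y
  have e3 := cosh_dist x y
  have hC := Real.one_le_cosh (dist x y)
  have g0 := vec_third_pos x
  have g1 := vec_third_pos y
  obtain ⟨p, r, hr, h⟩ := exists_vec (α := s * (vec x).1 + t * (vec y).1)
    (β := s * (vec x).2.1 + t * (vec y).2.1) (γ := s * (vec x).2.2 + t * (vec y).2.2)
    (by
      rcases hs.eq_or_lt with h | h
      · have : 0 < t := by linarith
        rw [← h]; simp; positivity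
      · positivity)
    (by
      simp only [mink] at e0 e1 e3
      have : (s * (vec x).1 + t * (vec y).1) * (s * (vec x).2.2 + t * (vec y).2.2)
        - (s * (vec x).2.1 + t * (vec y).2.1) ^ 2
        = s ^ 2 + t ^ 2 + 2 * s * t * Real.cosh (dist x y) := by
        rw [e3]; linear_combination s ^ 2 * e0 + t ^ 2 * e1
      rw [this]
      nlinarith [mul_nonneg hs ht])
  have h' : s • vec x + t • vec y = r • vec p := by
    rw [← h]; ext <;> simp
  refine ⟨p, r, hr, h', s / r, t / r, by positivity, by positivity, ?_⟩
  rw [← smul_right_injective _ hr.ne' |>.eq_iff]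
  simp only [smul_add, smul_smul]
  rw [mul_div_cancel₀ _ hr.ne', mul_div_cancel₀ _ hr.ne', h']

/-- The displacement of `g` in terms of the functional of its axis. -/
theorem two_cosh_displacement (g : SL(2, ℝ)) (z : ℍ) :
    2 * Real.cosh (dist z (g • z)) = tr g ^ 2 - 2 + axisFun g (vec z) ^ 2 := by
  have e := mink_vec_self z
  have hd := det_eq g
  rw [cosh_dist, vec_smul]
  simp only [mink, tr, axisFun] at *
  have e' : (vec z).1 * (vec z).2.2 = 1 + (vec z).2.1 ^ 2 := by linear_combination e
  linear_combination (g 0 0 ^ 2 + g 1 1 ^ 2 + 2 * g 0 1 * g 1 0) * e' - 2 * hd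

theorem axisFun_comb (g : SL(2, ℝ)) (s t : ℝ) (v w : ℝ × ℝ × ℝ) :
    axisFun g (s • v + t • w) = s * axisFun g v + t * axisFun g w := by
  simp [axisFun]; ring

/-- The displacement splits into a constant given by the trace and a square that vanishes exactly on
the axis. Translation lengths, axes and feet of perpendiculars are all read off from this identity.
-/
theorem four_cosh_sq (g : SL(2, ℝ)) (z : ℍ) :
    4 * Real.cosh (dist z (g • z) / 2) ^ 2 = tr g ^ 2 + axisFun g (vec z) ^ 2 := by
  have h := two_cosh_displacement g z
  have h2 := Real.cosh_two_mul (dist z (g • z) / 2)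
  have h3 := Real.cosh_sq (dist z (g • z) / 2)
  rw [mul_div_cancel₀ _ two_ne_zero] at h2
  linarith

theorem axisFun_mk (g : SL(2, ℝ)) (x y : ℝ) (hy : 0 < y) :
    axisFun g (vec ⟨⟨x, y⟩, hy⟩) =
      (g 1 0 * (x ^ 2 + y ^ 2) + (g 1 1 - g 0 0) * x - g 0 1) / y := by
  simp only [axisFun, vec, UpperHalfPlane.re, UpperHalfPlane.im]
  field_simp

theorem axisFun_center (g : SL(2, ℝ)) (hc : g 1 0 ≠ 0) (y : ℝ) (hy : 0 < y) :
    axisFun g (vec ⟨⟨(g 0 0 - g 1 1) / (2 * g 1 0), y⟩, hy⟩) =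
      (4 * g 1 0 ^ 2 * y ^ 2 - (tr g ^ 2 - 4)) / (4 * g 1 0 * y) := by
  rw [axisFun_mk]
  have hd := det_eq g
  simp only [tr]
  field_simp
  linear_combination 16 * hd

theorem exists_axisFun_eq_zero {g : SL(2, ℝ)} (h : 2 < |tr g|) : ∃ z : ℍ, axisFun g (vec z) = 0 := by
  have h4 : 0 < tr g ^ 2 - 4 := by nlinarith [sq_abs (tr g)]
  by_cases hc : g 1 0 = 0
  · have hd := det_eq g
    have hne : g 1 1 - g 0 0 ≠ 0 := by
      intro h0
      have : tr g ^ 2 - 4 = (g 1 1 - g 0 0) ^ 2 := by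
        simp only [tr]; rw [hc] at hd; linear_combination 4 * hd
      rw [this, h0] at h4
      norm_num at h4
    refine ⟨⟨⟨g 0 1 / (g 1 1 - g 0 0), 1⟩, one_pos⟩, ?_⟩
    rw [axisFun_mk, hc]
    field_simp
    ring
  · refine ⟨⟨⟨(g 0 0 - g 1 1) / (2 * g 1 0), √(tr g ^ 2 - 4) / (2 * |g 1 0|)⟩, ?_⟩, ?_⟩
    · have := Real.sqrt_pos.2 h4
      have := abs_pos.2 hc
      positivity
    · rw [axisFun_center _ hc, div_pow, mul_pow, sq_abs, Real.sq_sqrt h4.le]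
      field_simp
      ring

/-- A parabolic element has no axis, but the functional tends to zero along the vertical line that
ends at its fixed point. -/
theorem exists_axisFun_lt {g : SL(2, ℝ)} (h : 2 ≤ |tr g|) {ε : ℝ} (hε : 0 < ε) :
    ∃ z : ℍ, |axisFun g (vec z)| < ε := by
  rcases h.eq_or_lt with h | h
  · have h4 : tr g ^ 2 - 4 = 0 := by rw [← sq_abs, ← h]; norm_num
    by_cases hc : g 1 0 = 0
    · have hd := det_eq g
      have hne : g 1 1 - g 0 0 = 0 := by
        have : tr g ^ 2 - 4 = (g 1 1 - g 0 0) ^ 2 := by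
          simp only [tr]; rw [hc] at hd; linear_combination 4 * hd
        rw [this] at h4
        exact pow_eq_zero_iff two_ne_zero |>.1 h4
      have hp : 0 < (|g 0 1| + 1) / ε := by positivity
      refine ⟨⟨⟨0, (|g 0 1| + 1) / ε⟩, hp⟩, ?_⟩
      rw [axisFun_mk, hc, hne, abs_div, abs_of_pos hp, div_lt_iff₀ hp, mul_div_cancel₀ _ hε.ne']
      simp
    · have hc' := abs_pos.2 hc
      have hp : 0 < ε / (2 * |g 1 0|) := by positivity
      refine ⟨⟨⟨(g 0 0 - g 1 1) / (2 * g 1 0), ε / (2 * |g 1 0|)⟩, hp⟩, ?_⟩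
      rw [axisFun_center _ hc, h4]
      have : (4 * g 1 0 ^ 2 * (ε / (2 * |g 1 0|)) ^ 2 - 0) / (4 * g 1 0 * (ε / (2 * |g 1 0|)))
        = g 1 0 * (ε / (2 * |g 1 0|)) := by
        field_simp
        ring
      rw [this, abs_mul, abs_of_pos hp]
      field_simp
      norm_num
  · obtain ⟨z, hz⟩ := exists_axisFun_eq_zero h
    exact ⟨z, by rw [hz]; simpa⟩

theorem exists_fixed_point {g : SL(2, ℝ)} (h : |tr g| < 2) : ∃ z : ℍ, g • z = z := by
  have h4 : 0 < 4 - tr g ^ 2 := by nlinarith [sq_abs (tr g), abs_nonneg (tr g)]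
  have hd := det_eq g
  have hc : g 1 0 ≠ 0 := by
    intro hc
    have : tr g ^ 2 - 4 = (g 1 1 - g 0 0) ^ 2 := by
      simp only [tr]; rw [hc] at hd; linear_combination 4 * hd
    nlinarith [sq_nonneg (g 1 1 - g 0 0)]
  have hp : 0 < √(4 - tr g ^ 2) / (2 * |g 1 0|) := by
    have := Real.sqrt_pos.2 h4
    have := abs_pos.2 hc
    positivity
  refine ⟨⟨⟨(g 0 0 - g 1 1) / (2 * g 1 0), √(4 - tr g ^ 2) / (2 * |g 1 0|)⟩, hp⟩, ?_⟩
  have key := four_cosh_sq g ⟨⟨(g 0 0 - g 1 1) / (2 * g 1 0), √(4 - tr g ^ 2) / (2 * |g 1 0|)⟩, hp⟩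
  rw [axisFun_center _ hc, div_pow, mul_pow, mul_pow, div_pow, mul_pow, sq_abs,
    Real.sq_sqrt h4.le] at key
  set z : ℍ := ⟨⟨(g 0 0 - g 1 1) / (2 * g 1 0), √(4 - tr g ^ 2) / (2 * |g 1 0|)⟩, hp⟩
  have h1 : Real.cosh (dist z (g • z) / 2) ^ 2 = 1 := by
    field_simp at key
    have : Real.cosh (dist z (g • z) / 2) ^ 2 * (4 - tr g ^ 2) = 1 * (4 - tr g ^ 2) := by
      linarith
    exact mul_right_cancel₀ h4.ne' this
  have h2 := Real.cosh_sq (dist z (g • z) / 2)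
  have h3 : Real.sinh (dist z (g • z) / 2) = 0 := by
    have : Real.sinh (dist z (g • z) / 2) ^ 2 = 0 := by linarith
    exact pow_eq_zero_iff two_ne_zero |>.1 this
  have h5 : dist z (g • z) / 2 = 0 := Real.sinh_eq_zero.1 h3
  exact (dist_eq_zero.1 (by linarith : dist z (g • z) = 0)).symm

/-! ### Translation length and trace. -/

theorem bddBelow_displacement (g : SL(2, ℝ)) : BddBelow (Set.range fun z : ℍ => dist z (g • z)) :=
  ⟨0, by rintro _ ⟨z, rfl⟩; exact dist_nonneg⟩

theorem transLength_le (g : SL(2, ℝ)) (z : ℍ) : transLength g ≤ dist z (g • z) :=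
  ciInf_le (bddBelow_displacement g) z

theorem transLength_nonneg (g : SL(2, ℝ)) : 0 ≤ transLength g :=
  Real.iInf_nonneg fun _ => dist_nonneg

theorem transLength_eq {g : SL(2, ℝ)} {a : ℝ} (ha : 0 ≤ a) (h : |tr g| = 2 * Real.cosh a) :
    transLength g = 2 * a := by
  have htr : tr g ^ 2 = 4 * Real.cosh a ^ 2 := by rw [← sq_abs, h]; ring
  have hca := Real.one_le_cosh a
  refine le_antisymm ?_ (le_ciInf fun z => ?_)
  · refine le_of_forall_pos_le_add fun ε hε => ?_
    have hlt : Real.cosh a < Real.cosh (a + ε / 2) := by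
      rw [Real.cosh_lt_cosh, abs_of_nonneg ha, abs_of_nonneg (by positivity)]
      linarith
    have hδ : 0 < 4 * Real.cosh (a + ε / 2) ^ 2 - 4 * Real.cosh a ^ 2 := by nlinarith
    obtain ⟨z, hz⟩ := exists_axisFun_lt (g := g) (by rw [h]; linarith) (Real.sqrt_pos.2 hδ)
    refine (transLength_le g z).trans ?_
    have key := four_cosh_sq g z
    rw [Real.lt_sqrt (abs_nonneg _), sq_abs] at hz
    have : Real.cosh (dist z (g • z) / 2) ^ 2 < Real.cosh (a + ε / 2) ^ 2 := by linarith
    rw [sq_lt_sq₀ (Real.cosh_pos _).le (Real.cosh_pos _).le, Real.cosh_lt_cosh,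
      abs_of_nonneg (by positivity), abs_of_nonneg (by positivity)] at this
    linarith
  · have key := four_cosh_sq g z
    have : Real.cosh a ^ 2 ≤ Real.cosh (dist z (g • z) / 2) ^ 2 := by
      nlinarith [sq_nonneg (axisFun g (vec z))]
    rw [sq_le_sq₀ (Real.cosh_pos _).le (Real.cosh_pos _).le, Real.cosh_le_cosh,
      abs_of_nonneg ha, abs_of_nonneg (by positivity)] at this
    linarith

theorem exists_cosh_eq {x : ℝ} (hx : 1 ≤ x) : ∃ a : ℝ, 0 ≤ a ∧ Real.cosh a = x :=
  ⟨Real.arcosh x, Real.arcosh_nonneg hx, Real.cosh_arcosh hx⟩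

theorem abs_tr_eq {g : SL(2, ℝ)} (h : 2 ≤ |tr g|) :
    |tr g| = 2 * Real.cosh (transLength g / 2) := by
  obtain ⟨a, ha, h'⟩ := exists_cosh_eq (x := |tr g| / 2) (by linarith)
  rw [transLength_eq ha (by linarith), mul_div_cancel_left₀ _ two_ne_zero]
  linarith

theorem transLength_eq_zero_of_lt {g : SL(2, ℝ)} (h : |tr g| < 2) : transLength g = 0 := by
  obtain ⟨z, hz⟩ := exists_fixed_point h
  refine le_antisymm ((transLength_le g z).trans ?_) (transLength_nonneg g)
  rw [hz, dist_self]

theorem two_lt_abs_tr {g : SL(2, ℝ)} (h : 0 < transLength g) : 2 < |tr g| := by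
  have h2 : 2 ≤ |tr g| := by
    by_contra! h'
    exact h.ne' (transLength_eq_zero_of_lt h')
  rw [abs_tr_eq h2]
  have : 1 < Real.cosh (transLength g / 2) := Real.one_lt_cosh.2 (by positivity)
  linarith

theorem mem_axisOf_iff {g : SL(2, ℝ)} (h : 2 ≤ |tr g|) (z : ℍ) :
    z ∈ axisOf g ↔ axisFun g (vec z) = 0 := by
  have key := four_cosh_sq g z
  have h' := abs_tr_eq h
  rw [← sq_abs (tr g), h'] at key
  change dist z (g • z) = transLength g ↔ _
  constructor
  · intro hz
    rw [hz] at key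
    have : axisFun g (vec z) ^ 2 = 0 := by linarith
    exact pow_eq_zero_iff two_ne_zero |>.1 this
  · intro hz
    rw [hz] at key
    have : Real.cosh (dist z (g • z) / 2) ^ 2 = Real.cosh (transLength g / 2) ^ 2 := by linarith
    rw [sq_eq_sq₀ (Real.cosh_pos _).le (Real.cosh_pos _).le] at this
    have := Real.cosh_strictMonoOn.injOn (Set.mem_Ici.2 (by positivity))
      (Set.mem_Ici.2 (div_nonneg (transLength_nonneg g) zero_le_two)) this
    linarith

theorem tr_mul (g h : SL(2, ℝ)) :
    tr (g * h) = g 0 0 * h 0 0 + g 0 1 * h 1 0 + (g 1 0 * h 0 1 + g 1 1 * h 1 1) := by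
  simp [tr, Matrix.mul_apply, Fin.sum_univ_two]

theorem tr_mul_comm (g h : SL(2, ℝ)) : tr (g * h) = tr (h * g) := by
  rw [tr_mul, tr_mul]; ring

theorem tr_one : tr 1 = 2 := by simp [tr]; norm_num

theorem tr_inv (g : SL(2, ℝ)) : tr g⁻¹ = tr g := by
  simp [tr, Matrix.SpecialLinearGroup.coe_inv, Matrix.adjugate_fin_two]
  ring

theorem tr_pow_add_two (g : SL(2, ℝ)) (k : ℕ) :
    tr (g ^ (k + 2)) = tr g * tr (g ^ (k + 1)) - tr (g ^ k) := by
  have hd := det_eq g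
  rw [pow_succ, pow_succ, mul_assoc, tr_mul, tr_mul]
  simp only [tr, Matrix.SpecialLinearGroup.coe_mul, Matrix.mul_apply, Fin.sum_univ_two]
  linear_combination (-((g ^ k) 0 0 + (g ^ k) 1 1)) * hd

/-- The traces of powers satisfy the Chebyshev recursion. The sign s is carried along because the
lift to SL(2, ℝ) is arbitrary. -/
theorem tr_pow {g : SL(2, ℝ)} {s a : ℝ} (hs : s ^ 2 = 1) (h : tr g = s * (2 * Real.cosh a))
    (k : ℕ) : tr (g ^ k) = s ^ k * (2 * Real.cosh (k * a)) := by
  induction k using Nat.twoStepInduction with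
  | zero => simp [tr_one]
  | one => simpa using h
  | more k ih1 ih2 =>
    rw [tr_pow_add_two, ih1, ih2, h]
    have e1 : ((k + 2 : ℕ) : ℝ) * a = (k + 1 : ℕ) * a + a := by push_cast; ring
    have e2 : (k : ℝ) * a = (k + 1 : ℕ) * a - a := by push_cast; ring
    rw [e1, e2, Real.cosh_add, Real.cosh_sub]
    have : s ^ (k + 2) = s ^ k := by rw [pow_add, hs, mul_one]
    rw [this, pow_succ]
    linear_combination (4 * s ^ k * Real.cosh a * Real.cosh ((k + 1 : ℕ) * a)) * hs

theorem transLength_pow {g : SL(2, ℝ)} (h : 2 ≤ |tr g|) (k : ℕ) :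
    transLength (g ^ k) = k * transLength g := by
  have h' := abs_tr_eq h
  have hn := transLength_nonneg g
  have : transLength (g ^ k) = 2 * (k * (transLength g / 2)) := by
    refine transLength_eq (by positivity) ?_
    rcases abs_choice (tr g) with e | e
    · rw [tr_pow (s := 1) (by norm_num) (by rw [← h', e, one_mul]), one_pow, one_mul,
        abs_of_pos (mul_pos two_pos (Real.cosh_pos _))]
    · rw [tr_pow (s := -1) (by norm_num) (by rw [← h', e]; ring), abs_mul, abs_pow, abs_neg,
        abs_one, one_pow, one_mul, abs_of_pos (mul_pos two_pos (Real.cosh_pos _))]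
  rw [this]; ring

theorem dist_pow_smul_le (g : SL(2, ℝ)) (z : ℍ) (k : ℕ) :
    dist z (g ^ k • z) ≤ k * dist z (g • z) := by
  induction k with
  | zero => simp
  | succ k ih =>
    rw [pow_succ, mul_smul]
    have : dist (g ^ k • z) (g ^ k • g • z) = dist z (g • z) := dist_smul _ _ _
    push_cast
    linarith [dist_triangle z (g ^ k • z) (g ^ k • g • z)]

/-- Translation length is the exponential growth rate of orbits, so that it is controlled by
displacements of powers. -/
theorem transLength_le_mul {g h : SL(2, ℝ)} (hh : 2 ≤ |tr h|) {K : ℝ} (hK : 0 ≤ K) (x y : ℍ)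
    (H : ∀ k : ℕ, dist y (h ^ k • y) ≤ K * dist x (g ^ k • x)) :
    transLength h ≤ K * transLength g := by
  suffices ∀ w : ℍ, transLength h ≤ K * dist w (g • w) by
    rw [transLength, transLength, Real.mul_iInf_of_nonneg hK]
    exact le_ciInf this
  intro w
  -- Moving the base point from x to w costs 2 `dist x w` for every k at once, which is negligible
  -- against k as k grows.
  have key : ∀ k : ℕ, (k : ℝ) * (transLength h - K * dist w (g • w)) ≤ K * (2 * dist x w) := by
    intro k
    have h1 := transLength_le (h ^ k) y
    rw [transLength_pow hh] at h1
    have h2 := H k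
    have h3 := dist_triangle4 x w (g ^ k • w) (g ^ k • x)
    have h4 : dist (g ^ k • w) (g ^ k • x) = dist w x := dist_smul _ _ _
    have h5 := dist_pow_smul_le g w k
    have h6 : dist x (g ^ k • x) ≤ 2 * dist x w + k * dist w (g • w) := by
      rw [h4, dist_comm w x] at h3; linarith
    have h7 := mul_le_mul_of_nonneg_left h6 hK
    linarith
  by_contra! hlt
  obtain ⟨k, hk⟩ := exists_nat_gt (K * (2 * dist x w) / (transLength h - K * dist w (g • w)))
  rw [div_lt_iff₀ (by linarith)] at hk
  linarith [key k]

/-! ### Convex regions as cones, and the sides of a geodesic. -/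

/-- The cone over a subset of the hyperboloid. -/
def coneOver (R : Set ℍ) : Set (ℝ × ℝ × ℝ) := {v | ∃ t : ℝ, 0 < t ∧ ∃ z ∈ R, v = t • vec z}

theorem vec_mem_coneOver {R : Set ℍ} {z : ℍ} : vec z ∈ coneOver R ↔ z ∈ R := by
  constructor
  · rintro ⟨t, ht, w, hw, h⟩
    rwa [vec_scale ht.le h]
  · exact fun h => ⟨1, one_pos, z, h, by simp⟩

theorem smul_mem_coneOver {R : Set ℍ} {v : ℝ × ℝ × ℝ} {t : ℝ} (ht : 0 < t)
    (hv : v ∈ coneOver R) : t • v ∈ coneOver R := by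
  obtain ⟨s, hs, z, hz, rfl⟩ := hv
  exact ⟨t * s, by positivity, z, hz, by rw [smul_smul]⟩

theorem add_mem_coneOver {R : Set ℍ} (hR : GeodConvex R) {v w : ℝ × ℝ × ℝ}
    (hv : v ∈ coneOver R) (hw : w ∈ coneOver R) : v + w ∈ coneOver R := by
  obtain ⟨s, hs, x, hx, rfl⟩ := hv
  obtain ⟨t, ht, y, hy, rfl⟩ := hw
  obtain ⟨p, r, hr, h, hb⟩ := exists_vec_combination (x := x) (y := y) hs.le ht.le (by positivity)
  exact ⟨r, hr, p, hR x hx y hy p hb.dist_add, h⟩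

theorem convex_coneOver {R : Set ℍ} (hR : GeodConvex R) : Convex ℝ (coneOver R) := by
  intro v hv w hw a b ha hb hab
  rcases ha.eq_or_lt with rfl | ha
  · rw [zero_add] at hab
    simpa [hab] using hw
  rcases hb.eq_or_lt with rfl | hb
  · rw [add_zero] at hab
    simpa [hab] using hv
  exact add_mem_coneOver hR (smul_mem_coneOver ha hv) (smul_mem_coneOver hb hw)

theorem continuous_vec : Continuous vec := by
  have h := UpperHalfPlane.continuous_im
  have h' := UpperHalfPlane.continuous_re
  have h0 : ∀ z : ℍ, z.im ≠ 0 := fun z => z.im_ne_zero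
  unfold vec
  exact (((h'.pow 2).add (h.pow 2)).div h h0).prodMk ((h'.div h h0).prodMk (continuous_const.div h h0))

/-- The open cone of timelike vectors. -/
def timelike : Set (ℝ × ℝ × ℝ) := {v | 0 < v.2.2 ∧ 0 < v.1 * v.2.2 - v.2.1 ^ 2}

theorem isOpen_timelike : IsOpen timelike := by
  have h1 : IsOpen {v : ℝ × ℝ × ℝ | 0 < v.2.2} := isOpen_lt (by fun_prop) (by fun_prop)
  have h2 : IsOpen {v : ℝ × ℝ × ℝ | 0 < v.1 * v.2.2 - v.2.1 ^ 2} :=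
    isOpen_lt (by fun_prop) (by fun_prop)
  exact h1.inter h2

theorem vec_mem_timelike (z : ℍ) : vec z ∈ timelike := by
  refine ⟨vec_third_pos z, ?_⟩
  have := mink_vec_self z
  simp only [mink] at this
  linarith

theorem exists_vec_of_timelike {v : ℝ × ℝ × ℝ} (hv : v ∈ timelike) :
    ∃ (z : ℍ) (r : ℝ), 0 < r ∧ v = r • vec z := by
  obtain ⟨α, β, γ⟩ := v
  exact exists_vec hv.1 hv.2

/-- Projection of timelike vectors to the upper half plane. -/
def proj (v : ℝ × ℝ × ℝ) : ℂ := ⟨v.2.1 / v.2.2, √(v.1 * v.2.2 - v.2.1 ^ 2) / v.2.2⟩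

theorem proj_smul_vec {t : ℝ} (ht : 0 < t) (z : ℍ) : proj (t • vec z) = z := by
  have hy := z.im_pos
  have hm := mink_vec_self z
  simp only [mink] at hm
  have : (t • vec z).1 * (t • vec z).2.2 - (t • vec z).2.1 ^ 2 = t ^ 2 := by
    simp only [Prod.smul_fst, Prod.smul_snd, smul_eq_mul]
    linear_combination t ^ 2 * hm
  apply Complex.ext
  · simp only [proj, vec, Prod.smul_mk, smul_eq_mul, UpperHalfPlane.coe_re]
    field_simp
  · simp only [proj]
    rw [this, Real.sqrt_sq ht.le]
    simp only [vec, Prod.smul_mk, smul_eq_mul, UpperHalfPlane.coe_im]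
    field_simp

/-- The fibres of `proj` on the timelike cone are rays, so the cone is the preimage of U under a
continuous map. -/
theorem isOpen_coneOver {U : Set ℍ} (hU : IsOpen U) : IsOpen (coneOver U) := by
  have hc : ContinuousOn proj timelike := by
    have h1 : ContinuousOn (fun v : ℝ × ℝ × ℝ => v.2.1 / v.2.2) timelike :=
      ContinuousOn.div (by fun_prop) (by fun_prop) fun v hv => hv.1.ne'
    have h2 : ContinuousOn (fun v : ℝ × ℝ × ℝ => √(v.1 * v.2.2 - v.2.1 ^ 2) / v.2.2) timelike :=
      ContinuousOn.div (Continuous.continuousOn (by fun_prop)) (by fun_prop) fun v hv => hv.1.ne'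
    have h3 : proj = fun v => Complex.equivRealProdCLM.symm
        (v.2.1 / v.2.2, √(v.1 * v.2.2 - v.2.1 ^ 2) / v.2.2) := by
      funext v
      apply Complex.ext <;> simp [proj]
    rw [h3]
    exact Complex.equivRealProdCLM.symm.continuous.comp_continuousOn (h1.prodMk h2)
  have hO := hc.isOpen_inter_preimage isOpen_timelike
    (UpperHalfPlane.isOpenEmbedding_coe.isOpenMap U hU)
  convert hO using 1
  ext v
  constructor
  · rintro ⟨t, ht, z, hz, rfl⟩
    refine ⟨?_, z, hz, (proj_smul_vec ht z).symm⟩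
    have h := vec_mem_timelike z
    refine ⟨mul_pos ht h.1, ?_⟩
    have : (t • vec z).1 * (t • vec z).2.2 - (t • vec z).2.1 ^ 2
      = t ^ 2 * ((vec z).1 * (vec z).2.2 - (vec z).2.1 ^ 2) := by
      simp only [Prod.smul_fst, Prod.smul_snd, smul_eq_mul]; ring
    rw [this]
    exact mul_pos (by positivity) h.2
  · rintro ⟨hv, w, hw, h⟩
    obtain ⟨z, r, hr, rfl⟩ := exists_vec_of_timelike hv
    rw [proj_smul_vec hr, UpperHalfPlane.coe_inj] at h
    exact ⟨r, hr, z, h ▸ hw, rfl⟩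

theorem coneOver_mono {R S : Set ℍ} (h : R ⊆ S) : coneOver R ⊆ coneOver S := by
  rintro _ ⟨t, ht, z, hz, rfl⟩
  exact ⟨t, ht, z, h hz, rfl⟩

theorem vec_mem_interior_coneOver {R : Set ℍ} {z : ℍ} :
    vec z ∈ interior (coneOver R) ↔ z ∈ interior R := by
  constructor
  · intro h
    refine mem_interior.2 ⟨vec ⁻¹' interior (coneOver R), ?_,
      isOpen_interior.preimage continuous_vec, h⟩
    exact fun w hw => vec_mem_coneOver.1 (interior_subset (s := coneOver R) hw)
  · intro h
    refine mem_interior.2 ⟨coneOver (interior R), coneOver_mono interior_subset,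
      isOpen_coneOver isOpen_interior, vec_mem_coneOver.2 h⟩

theorem axisFun_add (g : SL(2, ℝ)) (v w : ℝ × ℝ × ℝ) :
    axisFun g (v + w) = axisFun g v + axisFun g w := by
  simpa using axisFun_comb g 1 1 v w

theorem axisFun_smul (g : SL(2, ℝ)) (t : ℝ) (v : ℝ × ℝ × ℝ) :
    axisFun g (t • v) = t * axisFun g v := by
  simpa using axisFun_comb g t 0 v v

/-- Every small displacement of a point of the axis within its plane is over the axis. -/
theorem exists_axis_vec {g : SL(2, ℝ)} {m : ℍ} (hm : axisFun g (vec m) = 0) {u : ℝ × ℝ × ℝ}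
    (hu : axisFun g u = 0) :
    ∃ ε : ℝ, 0 < ε ∧ ∀ t, |t| ≤ ε → vec m + t • u ∈ coneOver {z | axisFun g (vec z) = 0} := by
  have hc : Continuous fun t : ℝ => vec m + t • u := by fun_prop
  have hO := isOpen_timelike.preimage hc
  have h0 : (0 : ℝ) ∈ (fun t : ℝ => vec m + t • u) ⁻¹' timelike := by
    simpa using vec_mem_timelike m
  obtain ⟨ε, hε, hb⟩ := Metric.isOpen_iff.1 hO 0 h0
  refine ⟨ε / 2, by positivity, fun t ht => ?_⟩
  have : t ∈ Metric.ball (0 : ℝ) ε := by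
    rw [Metric.mem_ball, Real.dist_eq, sub_zero]; linarith
  obtain ⟨z, r, hr, h⟩ := exists_vec_of_timelike (hb this)
  refine ⟨r, hr, z, ?_, h⟩
  have h2 := congrArg (axisFun g) h
  rw [axisFun_add, axisFun_smul, axisFun_smul, hm, hu] at h2
  have : r * axisFun g (vec z) = 0 := by rw [← h2]; ring
  exact (mul_eq_zero.1 this).resolve_left hr.ne'

/-- A convex region lies on one side of a geodesic in its frontier. -/
theorem one_sided {R : Set ℍ} (hcl : IsClosed R) (hR : GeodConvex R) {g : SL(2, ℝ)} {m : ℍ}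
    (hm : axisFun g (vec m) = 0) (hfr : ∀ z, axisFun g (vec z) = 0 → z ∈ frontier R)
    {r : ℍ} (hr : r ∈ interior R) :
    axisFun g (vec r) ≠ 0 ∧ ∀ x ∈ R, 0 ≤ axisFun g (vec r) * axisFun g (vec x) := by
  have hsub : frontier R ⊆ R := hcl.frontier_subset
  have hFr : axisFun g (vec r) ≠ 0 := fun h => (hfr r h).2 hr
  refine ⟨hFr, ?_⟩
  set K := coneOver R with hK
  have hconv : Convex ℝ K := convex_coneOver hR
  have hrK : vec r ∈ interior K := vec_mem_interior_coneOver.2 hr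
  have hmK : vec m ∉ interior K := fun h => (hfr m hm).2 (vec_mem_interior_coneOver.1 h)
  obtain ⟨f, hf⟩ := geometric_hahn_banach_open_point hconv.interior isOpen_interior hmK
  have hle : ∀ a ∈ K, f a ≤ f (vec m) := by
    intro a ha
    have h1 : a ∈ closure (interior K) := by
      rw [hconv.closure_interior_eq_closure_of_nonempty_interior ⟨_, hrK⟩]
      exact subset_closure ha
    exact le_of_tendsto_of_tendsto
      (f.continuous.continuousWithinAt (s := interior K) (x := a)) tendsto_const_nhds
      (b := nhdsWithin a (interior K)) (hb := mem_closure_iff_nhdsWithin_neBot.1 h1)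
      (by filter_upwards [self_mem_nhdsWithin] with x hx using (hf x hx).le)
  have hneg : ∀ a ∈ K, f a ≤ 0 := by
    intro a ha
    by_contra! h
    obtain ⟨n, hn⟩ := exists_nat_gt (f (vec m) / f a)
    have hn' : 0 < n + (1 : ℝ) := by positivity
    have h2 := hle _ (smul_mem_coneOver hn' ha)
    rw [map_smul, smul_eq_mul] at h2
    rw [div_lt_iff₀ h] at hn
    nlinarith
  have hm0 : f (vec m) = 0 := by
    refine le_antisymm (hneg _ (vec_mem_coneOver.2 (hsub (hfr m hm)))) ?_
    have h2 := hle _ (smul_mem_coneOver (t := 1 / 2) (by norm_num)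
      (vec_mem_coneOver.2 (hsub (hfr m hm)) : vec m ∈ K))
    rw [map_smul, smul_eq_mul] at h2
    linarith
  have hker : ∀ u, axisFun g u = 0 → f u = 0 := by
    intro u hu
    obtain ⟨ε, hε, h⟩ := exists_axis_vec hm hu
    have hmem : coneOver {z | axisFun g (vec z) = 0} ⊆ K :=
      coneOver_mono fun z hz => hsub (hfr z hz)
    have h1 := hneg _ (hmem (h ε (abs_of_pos hε).le))
    have h2 := hneg _ (hmem (h (-ε) (by rw [abs_neg, abs_of_pos hε])))
    rw [map_add, map_smul, hm0, smul_eq_mul] at h1 h2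
    nlinarith
  intro x hx
  have hfx := hneg _ (vec_mem_coneOver.2 hx)
  have hfr' : f (vec r) < 0 := by simpa [hm0] using hf _ hrK
  have := hker (axisFun g (vec x) • vec r + (-axisFun g (vec r)) • vec x) (by
    rw [axisFun_comb]; ring)
  rw [map_add, map_smul, map_smul, smul_eq_mul, smul_eq_mul] at this
  have h3 : f (vec r) * (axisFun g (vec r) * axisFun g (vec x))
      = axisFun g (vec r) ^ 2 * f (vec x) := by linear_combination axisFun g (vec r) * this
  by_contra! h4
  have := mul_pos_of_neg_of_neg hfr' h4
  nlinarith [sq_nonneg (axisFun g (vec r))]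

/-- Two convex regions that do not overlap lie on opposite sides of a common geodesic. -/
theorem opposite_sides {R₁ R₂ : Set ℍ} (h₁ : GeodConvex R₁) (h₂ : GeodConvex R₂)
    (hd : ∀ z ∈ R₁, z ∉ interior R₂) {g : SL(2, ℝ)} {m : ℍ} (hm : axisFun g (vec m) = 0)
    (hL₁ : ∀ z, axisFun g (vec z) = 0 → z ∈ R₁) (hL₂ : ∀ z, axisFun g (vec z) = 0 → z ∈ R₂)
    {r₁ r₂ : ℍ} (hr₁ : r₁ ∈ R₁) (hr₂ : r₂ ∈ interior R₂) :
    axisFun g (vec r₁) * axisFun g (vec r₂) ≤ 0 := by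
  by_contra! hpos
  have hne : axisFun g (vec r₂) ≠ 0 := by rintro h; simp [h] at hpos
  set c := axisFun g (vec r₁) / axisFun g (vec r₂) with hc
  have hcpos : 0 < c := by
    rw [hc, div_eq_mul_inv, ← mul_pos_iff_of_pos_right (sq_pos_of_ne_zero hne)]
    have : axisFun g (vec r₁) * (axisFun g (vec r₂))⁻¹ * axisFun g (vec r₂) ^ 2
      = axisFun g (vec r₁) * axisFun g (vec r₂) := by field_simp
    rwa [this]
  -- The factor c puts r₁ - c r₂ in the plane of the axis. Then ε r₁ + m = ε c r₂ + s m' with m' on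
  -- the axis: the left side is over R₁, the right side over the interior of R₂.
  obtain ⟨ε, hε, hu⟩ := exists_axis_vec hm (u := vec r₁ + (-c) • vec r₂) (by
    rw [axisFun_add, axisFun_smul, hc]; field_simp; ring)
  obtain ⟨s, hs, m', hm', he⟩ := hu ε (abs_of_pos hε).le
  have hmem : (ε * c) • vec r₂ + s • vec m' ∈ interior (coneOver R₂) := by
    refine mem_interior.2 ⟨(fun v => v + s • vec m') '' coneOver (interior R₂), ?_, ?_, ?_⟩
    · rintro _ ⟨v, hv, rfl⟩
      exact add_mem_coneOver h₂ (coneOver_mono interior_subset hv)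
        (smul_mem_coneOver hs (vec_mem_coneOver.2 (hL₂ m' hm')))
    · exact (Homeomorph.addRight (s • vec m')).isOpenMap _ (isOpen_coneOver isOpen_interior)
    · exact ⟨_, smul_mem_coneOver (by positivity) (vec_mem_coneOver.2 hr₂), rfl⟩
  have heq : (ε * c) • vec r₂ + s • vec m' = ε • vec r₁ + (1 : ℝ) • vec m := by
    rw [← he]; module
  obtain ⟨q, ρ, hρ, hq, hb⟩ := exists_vec_combination (x := r₁) (y := m) hε.le zero_le_one
    (by positivity)
  have hqR : q ∈ R₁ := h₁ r₁ hr₁ m (hL₁ m hm) q hb.dist_add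
  refine hd q hqR (vec_mem_interior_coneOver.1 ?_)
  rw [heq, hq] at hmem
  refine mem_interior.2 ⟨(fun v => ρ • v) ⁻¹' interior (coneOver R₂), ?_,
    isOpen_interior.preimage (by fun_prop), hmem⟩
  intro v hv
  have h3 : ρ • v ∈ coneOver R₂ := interior_subset (s := coneOver R₂) hv
  have := smul_mem_coneOver (inv_pos.2 hρ) h3
  rwa [smul_smul, inv_mul_cancel₀ hρ.ne', one_smul] at this

/-- A function on the hyperbolic plane induced by a linear functional on Minkowski space. -/
def IsLinearFun (f : ℍ → ℝ) : Prop :=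
  ∀ (x p y : ℍ) (r s t : ℝ), r • vec p = s • vec x + t • vec y → r * f p = s * f x + t * f y

theorem isLinearFun_axisFun (c : ℝ) (g h : SL(2, ℝ)) :
    IsLinearFun fun z => c * axisFun g (vec (h • z)) := by
  intro x p y r s t hp
  have : r • vec (h • p) = s • vec (h • x) + t • vec (h • y) := by
    have e1 := congrArg Prod.fst hp
    have e2 := congrArg (fun v => v.2.1) hp
    have e3 := congrArg (fun v => v.2.2) hp
    simp only [Prod.smul_fst, Prod.smul_snd, Prod.fst_add, Prod.snd_add, smul_eq_mul] at e1 e2 e3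
    rw [vec_smul, vec_smul, vec_smul]
    ext
    · simp
      linear_combination h 0 0 ^ 2 * e1 + 2 * h 0 0 * h 0 1 * e2 + h 0 1 ^ 2 * e3
    · simp
      linear_combination h 0 0 * h 1 0 * e1 + (h 0 0 * h 1 1 + h 0 1 * h 1 0) * e2
        + h 0 1 * h 1 1 * e3
    · simp
      linear_combination h 1 0 ^ 2 * e1 + 2 * h 1 0 * h 1 1 * e2 + h 1 1 ^ 2 * e3
  have h2 := congrArg (axisFun g) this
  rw [axisFun_smul, axisFun_comb] at h2
  linear_combination c * h2

/-- A segment that ends on the two sides of a geodesic crosses it. -/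
theorem exists_crossing {f : ℍ → ℝ} (hf : IsLinearFun f) {x y : ℍ} (hx : f x ≤ 0) (hy : 0 ≤ f y) :
    ∃ (p : ℍ) (r s t : ℝ), 0 < r ∧ 0 ≤ s ∧ 0 ≤ t ∧ r • vec p = s • vec x + t • vec y ∧ f p = 0 ∧
      dist x p + dist p y = dist x y := by
  by_cases h : f x = 0 ∧ f y = 0
  · exact ⟨x, 1, 1, 0, one_pos, zero_le_one, le_rfl, by simp, h.1, by simp⟩
  have hpos : 0 < f y + -f x := by
    by_contra! h'
    exact h ⟨by linarith, by linarith⟩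
  obtain ⟨p, r, hr, he, hb⟩ := exists_vec_combination (x := x) (y := y) hy (neg_nonneg.2 hx) hpos
  refine ⟨p, r, f y, -f x, hr, hy, neg_nonneg.2 hx, he.symm, ?_, hb.dist_add⟩
  have := hf x p y r _ _ he.symm
  have h0 : r * f p = 0 := by rw [this]; ring
  exact (mul_eq_zero.1 h0).resolve_left hr.ne'

/-- Let two geodesics bound a convex region.  A point beyond the first one is not beyond the second
one. -/
theorem nonpos_of_nonpos {R : Set ℍ} {f f' : ℍ → ℝ} (hf : IsLinearFun f) (hf' : IsLinearFun f')
    (hR : ∀ z ∈ R, 0 ≤ f z) (hR' : ∀ z ∈ R, f' z ≤ 0) (hL : ∀ z, f z = 0 → z ∈ R)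
    (hL' : ∀ z, f' z = 0 → z ∈ R) (hne : ∃ x, f' x = 0 ∧ f x ≠ 0) {w : ℍ} (hw : f w ≤ 0) :
    f' w ≤ 0 := by
  obtain ⟨x, hx, hfx⟩ := hne
  by_contra! hpos
  -- On the segment from w to x, f' is positive except at x. The segment meets the first line at a
  -- point p of R, where f' is nonpositive; so p = x, although x is off the first line.
  obtain ⟨p, r, s, t, hr, hs, ht, he, hp, -⟩ := exists_crossing hf hw (hR x (hL' x hx))
  have h1 := hf' w p x r s t he
  have h2 := hR' p (hL p hp)
  rw [hx, mul_zero, add_zero] at h1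
  have hs0 : s = 0 := by
    rcases hs.eq_or_lt with h | h
    · exact h.symm
    · nlinarith [mul_pos h hpos]
  rw [hs0, zero_smul, zero_add] at he
  have : p = x := by
    refine vec_scale (t := r⁻¹ * t) (by positivity) ?_
    rw [mul_smul, ← he, smul_smul, inv_mul_cancel₀ hr.ne', one_smul]
  exact hfx (this ▸ hp)

/-! ### Changes of coordinates and normal forms of pairs of pants. -/

theorem abs_eq_one_of_sq {s : ℝ} (hs : s ^ 2 = 1) : |s| = 1 := by
  rcases (sq_eq_sq_iff_eq_or_eq_neg.1 (hs.trans (one_pow 2).symm)) with rfl | rfl <;> simp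

theorem sl_mul_apply (g h : SL(2, ℝ)) (i j : Fin 2) :
    (g * h) i j = g i 0 * h 0 j + g i 1 * h 1 j := by
  simp [Matrix.mul_apply, Fin.sum_univ_two]

theorem sl_inv_apply (g : SL(2, ℝ)) :
    g⁻¹ 0 0 = g 1 1 ∧ g⁻¹ 0 1 = -g 0 1 ∧ g⁻¹ 1 0 = -g 1 0 ∧ g⁻¹ 1 1 = g 0 0 := by
  simp [Matrix.SpecialLinearGroup.coe_inv, Matrix.adjugate_fin_two]

theorem sl_conj_apply (h g : SL(2, ℝ)) (i j : Fin 2) :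
    (h * g * h⁻¹) i j = (h i 0 * g 0 0 + h i 1 * g 1 0) * h⁻¹ 0 j
      + (h i 0 * g 0 1 + h i 1 * g 1 1) * h⁻¹ 1 j := by
  rw [sl_mul_apply, sl_mul_apply, sl_mul_apply]

theorem sl_ext {g h : SL(2, ℝ)} (e00 : g 0 0 = h 0 0) (e01 : g 0 1 = h 0 1) (e10 : g 1 0 = h 1 0)
    (e11 : g 1 1 = h 1 1) : g = h := by
  ext i j
  fin_cases i <;> fin_cases j <;> assumption

/-- The matrix with the given entries. -/
def mkSL (a b c d : ℝ) (h : a * d - b * c = 1) : SL(2, ℝ) :=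
  ⟨!![a, b; c, d], by rwa [Matrix.det_fin_two_of]⟩

section
variable (a b c d : ℝ) (h : a * d - b * c = 1)
@[simp] theorem mkSL_00 : mkSL a b c d h 0 0 = a := rfl
@[simp] theorem mkSL_01 : mkSL a b c d h 0 1 = b := rfl
@[simp] theorem mkSL_10 : mkSL a b c d h 1 0 = c := rfl
@[simp] theorem mkSL_11 : mkSL a b c d h 1 1 = d := rfl
end

/-- A change of coordinates of the hyperbolic plane, together with its effect on matrices. -/
structure Frame where
  /-- the change of coordinates -/
  toEquiv : ℍ ≃ᵢ ℍ
  /-- the conjugated matrices -/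
  conj : SL(2, ℝ) →* SL(2, ℝ)
  map_smul : ∀ g z, toEquiv (g • z) = conj g • toEquiv z
  tr_conj : ∀ g, tr (conj g) = tr g

namespace Frame

/-- Composition of changes of coordinates. -/
def comp (Φ Ψ : Frame) : Frame where
  toEquiv := Ψ.toEquiv.trans Φ.toEquiv
  conj := Φ.conj.comp Ψ.conj
  map_smul g z := by simp [Ψ.map_smul, Φ.map_smul]
  tr_conj g := by simp [Ψ.tr_conj, Φ.tr_conj]

/-- The change of coordinates by an isometry that preserves the orientation. -/
def inner (h : SL(2, ℝ)) : Frame where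
  toEquiv := IsometryEquiv.constSMul h
  conj := (MulAut.conj h).toMonoidHom
  map_smul g z := by simp [MulAut.conj_apply, mul_smul]
  tr_conj g := by
    change tr (h * g * h⁻¹) = tr g
    rw [tr_mul_comm, inv_mul_cancel_left]

/-- The reflection in the imaginary axis. -/
def reflect (z : ℍ) : ℍ := ⟨⟨-z.re, z.im⟩, z.im_pos⟩

theorem vec_reflect (z : ℍ) : vec (reflect z) = ((vec z).1, -(vec z).2.1, (vec z).2.2) := by
  simp only [vec]
  change (((-z.re) ^ 2 + z.im ^ 2) / z.im, -z.re / z.im, 1 / z.im) = _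
  rw [neg_sq, neg_div]

theorem reflect_reflect (z : ℍ) : reflect (reflect z) = z :=
  vec_injective (by rw [vec_reflect, vec_reflect]; simp)

theorem dist_reflect (z w : ℍ) : dist (reflect z) (reflect w) = dist z w := by
  have : Real.cosh (dist (reflect z) (reflect w)) = Real.cosh (dist z w) := by
    rw [cosh_dist, cosh_dist, vec_reflect, vec_reflect]
    simp [mink]
  exact Real.cosh_strictMonoOn.injOn (Set.mem_Ici.2 dist_nonneg) (Set.mem_Ici.2 dist_nonneg) this

/-- The change of coordinates by a reflection. -/
def mirror : Frame where
  toEquiv :=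
    { toFun := reflect
      invFun := reflect
      left_inv := reflect_reflect
      right_inv := reflect_reflect
      isometry_toFun := Isometry.of_dist_eq dist_reflect }
  conj :=
    { toFun := fun g => mkSL (g 0 0) (-g 0 1) (-g 1 0) (g 1 1) (by linarith [det_eq g])
      map_one' := by apply sl_ext <;> simp
      map_mul' := fun g h => by
        apply sl_ext <;> simp only [sl_mul_apply, mkSL_00, mkSL_01, mkSL_10, mkSL_11] <;> ring }
  map_smul g z := by
    change reflect (g • z)
      = mkSL (g 0 0) (-g 0 1) (-g 1 0) (g 1 1) (by linarith [det_eq g]) • reflect z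
    refine vec_injective ?_
    rw [vec_reflect, vec_smul, vec_smul, vec_reflect]
    ext <;> simp only [mkSL_00, mkSL_01, mkSL_10, mkSL_11] <;> ring
  tr_conj g := by simp [tr]

end Frame

/-- Matrices that agree up to sign act in the same way. -/
theorem smul_eq_smul_of_sign {g h : SL(2, ℝ)} {s : ℝ} (hs : s ^ 2 = 1) (e : ∀ i j, g i j = s * h i j)
    (z : ℍ) : g • z = h • z := by
  refine vec_injective ?_
  rw [vec_smul, vec_smul]
  simp only [e]
  ext
  · linear_combination (h 0 0 ^ 2 * (vec z).1 + 2 * h 0 0 * h 0 1 * (vec z).2.1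
      + h 0 1 ^ 2 * (vec z).2.2) * hs
  · linear_combination (h 0 0 * h 1 0 * (vec z).1 + (h 0 0 * h 1 1 + h 0 1 * h 1 0) * (vec z).2.1
        + h 0 1 * h 1 1 * (vec z).2.2) * hs
  · linear_combination (h 1 0 ^ 2 * (vec z).1 + 2 * h 1 0 * h 1 1 * (vec z).2.1
      + h 1 1 ^ 2 * (vec z).2.2) * hs

/-- Horizontal translation. -/
def translation (θ : ℝ) : SL(2, ℝ) := mkSL 1 θ 0 1 (by ring)

section
variable (θ : ℝ)
@[simp] theorem translation_00 : translation θ 0 0 = 1 := rfl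
@[simp] theorem translation_01 : translation θ 0 1 = θ := rfl
@[simp] theorem translation_10 : translation θ 1 0 = 0 := rfl
@[simp] theorem translation_11 : translation θ 1 1 = 1 := rfl
end

/-- Dilation. -/
def dilation (k : ℝ) (hk : k ≠ 0) : SL(2, ℝ) := mkSL k 0 0 k⁻¹ (by field_simp; ring)

section
variable (k : ℝ) (hk : k ≠ 0)
@[simp] theorem dilation_00 : dilation k hk 0 0 = k := rfl
@[simp] theorem dilation_01 : dilation k hk 0 1 = 0 := rfl
@[simp] theorem dilation_10 : dilation k hk 1 0 = 0 := rfl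
@[simp] theorem dilation_11 : dilation k hk 1 1 = k⁻¹ := rfl
end

theorem conj_translation (θ : ℝ) (g : SL(2, ℝ)) :
    ((Frame.inner (translation θ)).conj g) 0 0 = g 0 0 + θ * g 1 0 ∧
    ((Frame.inner (translation θ)).conj g) 0 1
      = g 0 1 + θ * g 1 1 - θ * (g 0 0 + θ * g 1 0) ∧
    ((Frame.inner (translation θ)).conj g) 1 0 = g 1 0 ∧
    ((Frame.inner (translation θ)).conj g) 1 1 = g 1 1 - θ * g 1 0 := by
  change (translation θ * g * (translation θ)⁻¹) 0 0 = _ ∧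
    (translation θ * g * (translation θ)⁻¹) 0 1 = _ ∧
    (translation θ * g * (translation θ)⁻¹) 1 0 = _ ∧
    (translation θ * g * (translation θ)⁻¹) 1 1 = _
  obtain ⟨i00, i01, i10, i11⟩ := sl_inv_apply (translation θ)
  simp only [sl_conj_apply, i00, i01, i10, i11, translation_00, translation_01, translation_10,
    translation_11]
  refine ⟨?_, ?_, ?_, ?_⟩ <;> ring

theorem conj_dilation (k : ℝ) (hk : k ≠ 0) (g : SL(2, ℝ)) :
    ((Frame.inner (dilation k hk)).conj g) 0 0 = g 0 0 ∧
    ((Frame.inner (dilation k hk)).conj g) 0 1 = k ^ 2 * g 0 1 ∧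
    ((Frame.inner (dilation k hk)).conj g) 1 0 = g 1 0 / k ^ 2 ∧
    ((Frame.inner (dilation k hk)).conj g) 1 1 = g 1 1 := by
  change (dilation k hk * g * (dilation k hk)⁻¹) 0 0 = _ ∧
    (dilation k hk * g * (dilation k hk)⁻¹) 0 1 = _ ∧
    (dilation k hk * g * (dilation k hk)⁻¹) 1 0 = _ ∧
    (dilation k hk * g * (dilation k hk)⁻¹) 1 1 = _
  obtain ⟨i00, i01, i10, i11⟩ := sl_inv_apply (dilation k hk)
  simp only [sl_conj_apply, i00, i01, i10, i11, dilation_00, dilation_01, dilation_10, dilation_11]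
  refine ⟨?_, ?_, ?_, ?_⟩ <;> field_simp <;> ring

theorem mirror_conj_apply (g : SL(2, ℝ)) :
    (Frame.mirror.conj g) 0 0 = g 0 0 ∧ (Frame.mirror.conj g) 0 1 = -g 0 1 ∧
    (Frame.mirror.conj g) 1 0 = -g 1 0 ∧ (Frame.mirror.conj g) 1 1 = g 1 1 :=
  ⟨rfl, rfl, rfl, rfl⟩

theorem exists_upper_triangular {g : SL(2, ℝ)} (h : 2 ≤ |tr g|) :
    ∃ Φ : Frame, (Φ.conj g) 1 0 = 0 := by
  by_cases hc : g 1 0 = 0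
  · refine ⟨Frame.inner 1, ?_⟩
    change (1 * g * 1⁻¹ : SL(2, ℝ)) 1 0 = 0
    simpa using hc
  · have h4 : 0 ≤ tr g ^ 2 - 4 := by nlinarith [sq_abs (tr g)]
    have hd := det_eq g
    obtain ⟨x, hx⟩ : ∃ x : ℝ, g 1 0 * x ^ 2 + (g 1 1 - g 0 0) * x - g 0 1 = 0 := by
      refine ⟨(g 0 0 - g 1 1 + √(tr g ^ 2 - 4)) / (2 * g 1 0), ?_⟩
      have hs := Real.sq_sqrt h4
      generalize √(tr g ^ 2 - 4) = w at hs
      simp only [tr] at hs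
      field_simp
      linear_combination hs + 4 * hd
    -- The map z ↦ -1 / (z - x) sends the real fixed point x to infinity.
    refine ⟨Frame.inner (mkSL 0 (-1) 1 (-x) (by ring)), ?_⟩
    change (mkSL 0 (-1) 1 (-x) _ * g * (mkSL 0 (-1) 1 (-x) _)⁻¹) 1 0 = 0
    obtain ⟨i00, i01, i10, i11⟩ := sl_inv_apply (mkSL 0 (-1) 1 (-x) (by ring))
    simp only [sl_conj_apply, i00, i10, mkSL_10, mkSL_11]
    linear_combination hx

/-- Normal form of parabolic elements. -/
theorem exists_parabolic_frame {c : SL(2, ℝ)} (hc : |tr c| = 2) (hfix : ∀ z : ℍ, c • z ≠ z) :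
    ∃ (Φ : Frame) (s : ℝ), s ^ 2 = 1 ∧ ∀ i j, (Φ.conj c) i j = s * translation 1 i j := by
  obtain ⟨Φ, h10⟩ := exists_upper_triangular (g := c) hc.ge
  have htr := Φ.tr_conj c
  have hfix' : ∀ z : ℍ, Φ.conj c • z ≠ z := by
    intro z h
    refine hfix (Φ.toEquiv.symm z) (Φ.toEquiv.injective ?_)
    rw [Φ.map_smul, IsometryEquiv.apply_symm_apply, h]
  set g := Φ.conj c with hg
  have hd := det_eq g
  rw [h10] at hd
  have h4 : tr g ^ 2 = 4 := by rw [htr, ← sq_abs, hc]; norm_num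
  simp only [tr] at h4
  have heq : g 0 0 = g 1 1 := by
    have : (g 0 0 - g 1 1) ^ 2 = 0 := by linear_combination h4 - 4 * hd
    linarith [pow_eq_zero_iff two_ne_zero |>.1 this]
  have hs : g 0 0 ^ 2 = 1 := by rw [← heq] at hd; linarith
  have hb : g 0 1 ≠ 0 := by
    intro hb
    have : ∀ i j, g i j = g 0 0 * (1 : SL(2, ℝ)) i j := by
      intro i j
      fin_cases i <;> fin_cases j <;> simp [hb, h10, heq]
    exact hfix' UpperHalfPlane.I (by rw [smul_eq_smul_of_sign hs this, one_smul])
  have hk : (√|g 0 1|)⁻¹ ≠ 0 := inv_ne_zero (Real.sqrt_ne_zero'.2 (abs_pos.2 hb))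
  obtain ⟨e00, e01, e10, e11⟩ := conj_dilation _ hk g
  set Ψ := (Frame.inner (dilation _ hk)) with hΨ
  rw [inv_pow, Real.sq_sqrt (abs_nonneg _)] at e01
  rw [h10, zero_div] at e10
  have hcase : (Ψ.conj g) 0 1 = g 0 0 ∨ (Ψ.conj g) 0 1 = -g 0 0 := by
    rw [e01, ← sq_eq_sq_iff_eq_or_eq_neg, hs, mul_pow, inv_pow, sq_abs, inv_mul_cancel₀]
    exact pow_ne_zero 2 hb
  rcases hcase with h | h
  · refine ⟨Ψ.comp Φ, g 0 0, hs, fun i j => ?_⟩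
    change (Ψ.conj g) i j = _
    fin_cases i <;> fin_cases j <;> simp [e00, h, e10, e11, heq]
  -- A translation to the left is turned into one to the right by the reflection.
  · refine ⟨Frame.mirror.comp (Ψ.comp Φ), g 0 0, hs, fun i j => ?_⟩
    change (Frame.mirror.conj (Ψ.conj g)) i j = _
    obtain ⟨m00, m01, m10, m11⟩ := mirror_conj_apply (Ψ.conj g)
    fin_cases i <;> fin_cases j <;> simp [m00, m01, m10, m11, e00, h, e10, e11, heq]

/-- Normal form of a pair of elements, one of which is parabolic. -/
theorem exists_pair_frame {a c : SL(2, ℝ)} (hc : |tr c| = 2) (hfix : ∀ z : ℍ, c • z ≠ z)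
    (hac : |tr (a * c)| ≠ |tr a|) :
    ∃ (Φ : Frame) (s : ℝ), s ^ 2 = 1 ∧ tr c = 2 * s ∧
      (∀ i j, (Φ.conj c) i j = s * translation 1 i j) ∧
      (Φ.conj a) 0 0 = tr a / 2 ∧ (Φ.conj a) 1 1 = tr a / 2 ∧
      (Φ.conj a) 1 0 = s * tr (a * c) - tr a ∧ s * tr (a * c) - tr a ≠ 0 := by
  obtain ⟨Φ, s, hs, h⟩ := exists_parabolic_frame hc hfix
  have htc : tr c = 2 * s := by
    rw [← Φ.tr_conj c, tr, h, h]
    simp; ring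
  have hr : (Φ.conj a) 1 0 = s * tr (a * c) - tr a := by
    rw [← Φ.tr_conj (a * c), ← Φ.tr_conj a, map_mul, tr_mul, h, h, h, h]
    simp only [tr, translation_00, translation_01, translation_10, translation_11]
    linear_combination (-(Φ.conj a) 0 0 - (Φ.conj a) 1 0 - (Φ.conj a) 1 1) * hs
  have hne : s * tr (a * c) - tr a ≠ 0 := by
    intro h0
    apply hac
    have : tr a = s * tr (a * c) := by linarith
    rw [this, abs_mul, abs_eq_one_of_sq hs, one_mul]
  set r := s * tr (a * c) - tr a with hrdef
  -- Horizontal translations commute with the parabolic element. This remaining freedom makes the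
  -- diagonal entries of a equal, so that its fixed points are symmetric about 0.
  set θ := ((Φ.conj a) 1 1 - (Φ.conj a) 0 0) / (2 * r) with hθ
  have htr := Φ.tr_conj a
  rw [tr] at htr
  obtain ⟨e00, e01, e10, e11⟩ := conj_translation θ (Φ.conj a)
  obtain ⟨f00, f01, f10, f11⟩ := conj_translation θ (Φ.conj c)
  refine ⟨(Frame.inner (translation θ)).comp Φ, s, hs, htc, ?_, ?_, ?_, ?_, hne⟩
  · intro i j
    change ((Frame.inner (translation θ)).conj (Φ.conj c)) i j = _
    fin_cases i <;> fin_cases j <;> simp [f00, f01, f10, f11, h]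
  · change ((Frame.inner (translation θ)).conj (Φ.conj a)) 0 0 = _
    rw [e00, hr, ← htr, hθ]
    field_simp
    ring
  · change ((Frame.inner (translation θ)).conj (Φ.conj a)) 1 1 = _
    rw [e11, hr, ← htr, hθ]
    field_simp
    ring
  · change ((Frame.inner (translation θ)).conj (Φ.conj a)) 1 0 = _
    rw [e10, hr]

/-- Normal form of hyperbolic elements. -/
theorem exists_hyperbolic_frame {g : SL(2, ℝ)} (h : 0 < transLength g) :
    ∃ (Φ : Frame) (s : ℝ), s ^ 2 = 1 ∧
      ∀ i j, (Φ.conj g) i j = s * dilation (Real.exp (transLength g / 2)) (Real.exp_ne_zero _) i j := by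
  have h2 := two_lt_abs_tr h
  have habs := abs_tr_eq h2.le
  obtain ⟨Φ, h10⟩ := exists_upper_triangular h2.le
  have htr := Φ.tr_conj g
  have hd := det_eq (Φ.conj g)
  rw [h10] at hd
  have hne : (Φ.conj g) 0 0 - (Φ.conj g) 1 1 ≠ 0 := by
    intro h0
    have : tr g ^ 2 = 4 := by
      rw [← htr, tr]; linear_combination ((Φ.conj g) 0 0 - (Φ.conj g) 1 1) * h0 + 4 * hd
    nlinarith [sq_abs (tr g)]
  set θ := (Φ.conj g) 0 1 / ((Φ.conj g) 0 0 - (Φ.conj g) 1 1) with hθ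
  obtain ⟨e00, e01, e10, e11⟩ := conj_translation θ (Φ.conj g)
  set Ψ := (Frame.inner (translation θ)).comp Φ with hΨ
  set k := Ψ.conj g with hk
  change k 0 0 = _ at e00
  change k 0 1 = _ at e01
  change k 1 0 = _ at e10
  change k 1 1 = _ at e11
  have e01' : k 0 1 = 0 := by
    rw [e01, h10, hθ]; field_simp; ring
  rw [h10] at e10
  have hdk := det_eq k
  rw [e10, e01'] at hdk
  have htrk : tr k = tr g := Ψ.tr_conj g
  obtain ⟨s, hs, hst⟩ : ∃ s : ℝ, s ^ 2 = 1 ∧ tr g = s * (2 * Real.cosh (transLength g / 2)) := by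
    rcases abs_choice (tr g) with e | e
    · exact ⟨1, by norm_num, by rw [← habs, e, one_mul]⟩
    · exact ⟨-1, by norm_num, by rw [← habs, e]; ring⟩
  have hexp : Real.exp (transLength g / 2) * Real.exp (-(transLength g / 2)) = 1 := by
    rw [← Real.exp_add]; simp
  have hk11 : s * k 1 1 = 2 * Real.cosh (transLength g / 2) - s * k 0 0 := by
    rw [← htrk, tr] at hst
    linear_combination s * hst + 2 * Real.cosh (transLength g / 2) * hs
  have hcases : (s * k 0 0 - Real.exp (transLength g / 2))
      * (s * k 0 0 - Real.exp (-(transLength g / 2))) = 0 := by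
    rw [Real.cosh_eq] at hk11
    linear_combination hexp - hdk + s * k 0 0 * hk11 - (k 0 0 * k 1 1) * hs
  have hinv : (Real.exp (transLength g / 2))⁻¹ = Real.exp (-(transLength g / 2)) :=
    (Real.exp_neg _).symm
  have hmul : ∀ x y : ℝ, s * x = y → x = s * y := fun x y e => by
    linear_combination s * e - x * hs
  rw [Real.cosh_eq] at hk11
  rcases mul_eq_zero.1 hcases with e | e
  · refine ⟨Ψ, s, hs, fun i j => ?_⟩
    have q0 := hmul (k 0 0) _ (sub_eq_zero.1 e)
    have q1 := hmul (k 1 1) (Real.exp (-(transLength g / 2))) (by rw [hk11]; linarith)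
    change k i j = _
    fin_cases i <;> fin_cases j <;> simp [e10, e01', hinv, q0, q1]
  · have q0 := hmul (k 0 0) _ (sub_eq_zero.1 e)
    have q1 := hmul (k 1 1) (Real.exp (transLength g / 2)) (by rw [hk11]; linarith)
    refine ⟨(Frame.inner (mkSL 0 (-1) 1 0 (by ring))).comp Ψ, s, hs, fun i j => ?_⟩
    change (mkSL 0 (-1) 1 0 _ * k * (mkSL 0 (-1) 1 0 _)⁻¹) i j = _
    obtain ⟨i00, i01, i10, i11⟩ := sl_inv_apply (mkSL 0 (-1) 1 0 (by ring))
    rw [sl_conj_apply]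
    fin_cases i <;> fin_cases j <;> simp [i00, i01, i10, i11, e10, e01', hinv, q0, q1]

/-- The half length `A` cuff of the pair of pants with cuffs of half lengths `A`, `B` and one cusp, in
the coordinates in which the cusp is generated by the unit translation. -/
def pantsMat (A B : ℝ) : SL(2, ℝ) :=
  mkSL (Real.cosh A) (-(Real.sinh A ^ 2 / (2 * (Real.cosh A + Real.cosh B))))
    (-(2 * (Real.cosh A + Real.cosh B))) (Real.cosh A) (by
      have h1 := Real.cosh_pos A
      have h2 := Real.cosh_pos B
      have := Real.cosh_sq A
      field_simp
      linarith)

theorem exists_sign {x y : ℝ} (h : |x| = y) : ∃ s : ℝ, s ^ 2 = 1 ∧ x = s * y := by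
  rcases abs_choice x with e | e
  · exact ⟨1, by norm_num, by rw [← h, e, one_mul]⟩
  · exact ⟨-1, by norm_num, by rw [← h, e]; ring⟩

/-- A pair of pants with one cusp is determined by the lengths of its cuffs. -/
theorem exists_pants_frame {a c : SL(2, ℝ)} {A B : ℝ} (ha : |tr a| = 2 * Real.cosh A)
    (hc : |tr c| = 2) (hfix : ∀ z : ℍ, c • z ≠ z) (he : |tr (a * c)| = 2 * Real.cosh B)
    (hAB : Real.cosh A ≠ Real.cosh B) (hneg : tr a * tr c * tr (a * c) < 0) :
    ∃ Φ : Frame, (∀ z, Φ.toEquiv (c • z) = translation 1 • Φ.toEquiv z) ∧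
      ∀ z, Φ.toEquiv (a • z) = pantsMat A B • Φ.toEquiv z := by
  obtain ⟨Φ, s, hs, htc, hT, h00, h11, h10, hne⟩ := exists_pair_frame (a := a) hc hfix
    (by rw [ha, he]; intro h; exact hAB (by linarith))
  obtain ⟨σ, hσ, hta⟩ := exists_sign ha
  have hA := Real.cosh_pos A
  have hB := Real.cosh_pos B
  -- The negative trace product makes the lower left entry a sum of hyperbolic cosines; the opposite
  -- sign would give their difference and another group.
  have hte : s * tr (a * c) = -σ * (2 * Real.cosh B) := by
    obtain ⟨κ, hκ, hk⟩ := exists_sign he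
    have hprod : σ * s * κ < 0 := by
      rw [hta, htc, hk] at hneg
      by_contra! h
      have : 0 ≤ (σ * s * κ) * (8 * Real.cosh A * Real.cosh B) := by positivity
      linarith
    have h1 : (σ * s * κ) ^ 2 = 1 := by rw [mul_pow, mul_pow, hσ, hs, hκ]; norm_num
    have h2 : σ * s * κ = -1 := by nlinarith
    rw [hk]
    linear_combination σ * (2 * Real.cosh B) * h2 - s * κ * (2 * Real.cosh B) * hσ
  have e10 : (Φ.conj a) 1 0 = σ * pantsMat A B 1 0 := by
    rw [h10, hte, hta]
    simp only [pantsMat, mkSL_10]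
    ring
  have e00 : (Φ.conj a) 0 0 = σ * pantsMat A B 0 0 := by
    rw [h00, hta]
    simp only [pantsMat, mkSL_00]
    ring
  have e11 : (Φ.conj a) 1 1 = σ * pantsMat A B 1 1 := by
    rw [h11, hta]
    simp only [pantsMat, mkSL_11]
    ring
  have hd := det_eq (Φ.conj a)
  have hd' := det_eq (pantsMat A B)
  have e01 : (Φ.conj a) 0 1 = σ * pantsMat A B 0 1 := by
    rw [← h10] at hne
    have : ((Φ.conj a) 0 1 - σ * pantsMat A B 0 1) * (Φ.conj a) 1 0 = 0 := by
      rw [e00, e11] at hd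
      rw [e10] at hd ⊢
      linear_combination -hd + σ ^ 2 * hd' + hσ
    linarith [(mul_eq_zero.1 this).resolve_right hne]
  refine ⟨Φ, fun z => ?_, fun z => ?_⟩
  · rw [Φ.map_smul]
    exact smul_eq_smul_of_sign hs hT _
  · rw [Φ.map_smul]
    refine smul_eq_smul_of_sign hσ (fun i j => ?_) _
    fin_cases i <;> fin_cases j <;> assumption

theorem Frame.axisFun_sq (Φ : Frame) (g : SL(2, ℝ)) (z : ℍ) :
    axisFun (Φ.conj g) (vec (Φ.toEquiv z)) ^ 2 = axisFun g (vec z) ^ 2 := by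
  have h1 := four_cosh_sq g z
  have h2 := four_cosh_sq (Φ.conj g) (Φ.toEquiv z)
  rw [← Φ.map_smul, Φ.toEquiv.dist_eq, Φ.tr_conj] at h2
  linarith

theorem Frame.axisFun_eq_zero (Φ : Frame) (g : SL(2, ℝ)) (z : ℍ) :
    axisFun (Φ.conj g) (vec (Φ.toEquiv z)) = 0 ↔ axisFun g (vec z) = 0 := by
  rw [← pow_eq_zero_iff two_ne_zero, Φ.axisFun_sq, pow_eq_zero_iff two_ne_zero]

theorem GeodConvex.image {R : Set ℍ} (hR : GeodConvex R) (ν : ℍ ≃ᵢ ℍ) : GeodConvex (ν '' R) := by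
  rintro _ ⟨x, hx, rfl⟩ _ ⟨y, hy, rfl⟩ z hz
  refine ⟨ν.symm z, hR x hx y hy _ ?_, by simp⟩
  rw [← ν.dist_eq x, ← ν.dist_eq _ y, ← ν.dist_eq x y, ν.apply_symm_apply, hz]

theorem translation_axisFun (E : SL(2, ℝ)) (w : ℍ) :
    axisFun E (vec (translation 1 • w)) = axisFun E (vec w)
      + E 1 0 * (2 * (vec w).2.1 + (vec w).2.2) + (E 1 1 - E 0 0) * (vec w).2.2 := by
  rw [vec_smul]
  simp only [axisFun, translation_00, translation_01, translation_10, translation_11]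
  ring

theorem mul_nonneg_of_mem_image (Φ : Frame) {R : Set ℍ} (hcl : IsClosed R) (hR : GeodConvex R)
    {r₀ : ℍ} (hr₀ : r₀ ∈ interior R) {g : SL(2, ℝ)} (hg : 2 < |tr g|)
    (hfr : ∀ z, axisFun g (vec z) = 0 → z ∈ frontier R) {q₁ q₂ : ℍ}
    (hq₁ : q₁ ∈ Φ.toEquiv '' R) (hq₂ : q₂ ∈ Φ.toEquiv '' R) :
    0 ≤ axisFun (Φ.conj g) (vec q₁) * axisFun (Φ.conj g) (vec q₂) := by
  have hint : Φ.toEquiv r₀ ∈ interior (Φ.toEquiv '' R) := by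
    have := Φ.toEquiv.toHomeomorph.image_interior R
    change Φ.toEquiv '' interior R = interior (Φ.toEquiv '' R) at this
    rw [← this]
    exact ⟨_, hr₀, rfl⟩
  have hfr' : ∀ z, axisFun (Φ.conj g) (vec z) = 0 → z ∈ frontier (Φ.toEquiv '' R) := by
    intro z hz
    have := Φ.toEquiv.toHomeomorph.image_frontier R
    change Φ.toEquiv '' frontier R = frontier (Φ.toEquiv '' R) at this
    rw [← this]
    refine ⟨Φ.toEquiv.symm z, hfr _ ?_, by simp⟩
    rw [← Φ.axisFun_eq_zero, IsometryEquiv.apply_symm_apply]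
    exact hz
  obtain ⟨m, hm⟩ := exists_axisFun_eq_zero (g := Φ.conj g) (by rwa [Φ.tr_conj])
  obtain ⟨hF, hside⟩ := one_sided (Φ.toEquiv.toHomeomorph.isClosedMap R hcl)
    (GeodConvex.image hR Φ.toEquiv) hm hfr' hint
  have h1 := hside q₁ hq₁
  have h2 := hside q₂ hq₂
  have hF2 := sq_pos_of_ne_zero hF
  refine nonneg_of_mul_nonneg_right (a := axisFun (Φ.conj g) (vec (Φ.toEquiv r₀)) ^ 2) ?_ hF2
  have := mul_nonneg h1 h2
  linarith

/-- A geodesic half circle of diameter greater than one crosses its unit translate. -/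
theorem exists_axis_points {E : SL(2, ℝ)} {s p r : ℝ} (hs : s ^ 2 = 1) (hr : r ≠ 0)
    (E00 : E 0 0 = s * p) (E01 : E 0 1 = s * (p + (p ^ 2 - 1) / r)) (E10 : E 1 0 = s * r)
    (E11 : E 1 1 = s * (r + p)) (hrad : 1 / 4 < ((r / 2 + p) ^ 2 - 1) / r ^ 2) :
    ∃ w₁ w₂ : ℍ, axisFun E (vec w₁) = 0 ∧ axisFun E (vec w₂) = 0 ∧
      axisFun E (vec (translation 1 • w₁)) * axisFun E (vec (translation 1 • w₂)) < 0 := by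
  have hr2pos : 0 < r ^ 2 := by positivity
  -- The axis is the half circle with centre -1/2 whose squared radius is the quantity in `hrad`.
  -- Its points with abscissa -1/2 ± ρ go to 1/2 ± ρ at the same height; as ρ > 1/2, one lands
  -- outside the half circle and the other inside.
  obtain ⟨ρ, hρ1, hρ2⟩ : ∃ ρ : ℝ, 1 / 2 < ρ ∧ ρ ^ 2 < ((r / 2 + p) ^ 2 - 1) / r ^ 2 := by
    refine ⟨√((1 / 4 + ((r / 2 + p) ^ 2 - 1) / r ^ 2) / 2), ?_, ?_⟩
    · rw [Real.lt_sqrt (by norm_num)]; linarith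
    · rw [Real.sq_sqrt (by linarith)]; linarith
  obtain ⟨y, hypos, hysq⟩ : ∃ y : ℝ, 0 < y ∧ y ^ 2 = ((r / 2 + p) ^ 2 - 1) / r ^ 2 - ρ ^ 2 :=
    ⟨_, Real.sqrt_pos.2 (by linarith), Real.sq_sqrt (by linarith)⟩
  have hpt : ∀ ε : ℝ, ε ^ 2 = 1 → ∃ w : ℍ, axisFun E (vec w) = 0 ∧
      axisFun E (vec (translation 1 • w)) = s * r * (1 + 2 * ε * ρ) / y := by
    intro ε hε
    have hFw : axisFun E (vec ⟨⟨-(1 / 2) + ε * ρ, y⟩, hypos⟩) = 0 := by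
      rw [axisFun_mk, E00, E01, E10, E11, div_eq_zero_iff]
      left
      have : (-(1 / 2) + ε * ρ) ^ 2 + y ^ 2 + (-(1 / 2) + ε * ρ)
          = ((r / 2 + p) ^ 2 - 1) / r ^ 2 - 1 / 4 := by
        rw [hysq]; linear_combination ρ ^ 2 * hε
      have h2 : s * r * ((-(1 / 2) + ε * ρ) ^ 2 + y ^ 2)
          + (s * (r + p) - s * p) * (-(1 / 2) + ε * ρ) - s * (p + (p ^ 2 - 1) / r)
          = s * r * (((r / 2 + p) ^ 2 - 1) / r ^ 2 - 1 / 4) - s * (p + (p ^ 2 - 1) / r) := by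
        rw [← this]; ring
      rw [h2]
      field_simp
      ring
    refine ⟨_, hFw, ?_⟩
    rw [translation_axisFun, hFw, E00, E10, E11]
    change 0 + s * r * (2 * ((-(1 / 2) + ε * ρ) / y) + 1 / y) + (s * (r + p) - s * p) * (1 / y) = _
    field_simp
    ring
  obtain ⟨w₁, hw₁, e₁⟩ := hpt 1 (by norm_num)
  obtain ⟨w₂, hw₂, e₂⟩ := hpt (-1) (by norm_num)
  refine ⟨w₁, w₂, hw₁, hw₂, ?_⟩
  rw [e₁, e₂]
  have h2 : s * r * (1 + 2 * 1 * ρ) / y * (s * r * (1 + 2 * -1 * ρ) / y)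
      = -(r ^ 2 * (4 * ρ ^ 2 - 1) / y ^ 2) := by
    have : s * r * (1 + 2 * 1 * ρ) / y * (s * r * (1 + 2 * -1 * ρ) / y)
      = s ^ 2 * (r ^ 2 * ((1 + 2 * ρ) * (1 - 2 * ρ))) / y ^ 2 := by ring
    rw [this, hs]
    ring
  rw [h2, neg_lt_zero]
  exact div_pos (mul_pos hr2pos (by nlinarith)) (pow_pos hypos 2)

/-- The sign of the product of the boundary traces of an embedded pair of pants. -/
theorem trace_product_neg {R : Set ℍ} (hcl : IsClosed R) (hR : GeodConvex R) {r₀ : ℍ}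
    (hr₀ : r₀ ∈ interior R) {a c : SL(2, ℝ)} {A B : ℝ} (hA : 0 ≤ A) (hAB : A < B)
    (ha : |tr a| = 2 * Real.cosh A) (hc : |tr c| = 2) (hfix : ∀ z : ℍ, c • z ≠ z)
    (he : |tr (a * c)| = 2 * Real.cosh B)
    (hfr : ∀ z, axisFun (a * c) (vec z) = 0 → z ∈ frontier R)
    (hcR : ∀ z, axisFun (a * c) (vec z) = 0 → c • z ∈ R) : tr a * tr c * tr (a * c) < 0 := by
  have hch : Real.cosh A < Real.cosh B := by
    rwa [Real.cosh_lt_cosh, abs_of_nonneg hA, abs_of_nonneg (hA.trans hAB.le)]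
  have h1A := Real.one_le_cosh A
  obtain ⟨Φ, s, hs, htc, hT, h00, h11, h10, hne⟩ := exists_pair_frame (a := a) hc hfix
    (by rw [ha, he]; intro h; linarith)
  obtain ⟨σ, hσ, hta⟩ := exists_sign ha
  -- With the other sign, the axis of a c is a half circle of radius greater than 1/2, which its
  -- translate by c crosses. That translate is in the region, and the region lies on one side of the
  -- axis.
  by_contra! hnn
  have hte : s * tr (a * c) = σ * (2 * Real.cosh B) := by
    obtain ⟨κ, hκ, hk⟩ := exists_sign he
    have h1 : (σ * s * κ) ^ 2 = 1 := by rw [mul_pow, mul_pow, hσ, hs, hκ]; norm_num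
    have h2 : σ * s * κ = 1 := by
      rw [hta, htc, hk] at hnn
      by_contra h
      have h3 : σ * s * κ = -1 :=
        (sq_eq_sq_iff_eq_or_eq_neg.1 (h1.trans (one_pow 2).symm)).resolve_left h
      have : (σ * s * κ) * (8 * Real.cosh A * Real.cosh B) < 0 := by
        rw [h3]; nlinarith
      linarith
    rw [hk]
    linear_combination σ * (2 * Real.cosh B) * h2 - s * κ * (2 * Real.cosh B) * hσ
  set r := s * tr (a * c) - tr a with hr
  set p := tr a / 2 with hp
  have hrp : r = σ * (2 * (Real.cosh B - Real.cosh A)) := by rw [hr, hte, hta]; ring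
  have hr2 : r ^ 2 = 4 * (Real.cosh B - Real.cosh A) ^ 2 := by
    rw [hrp]; linear_combination (2 * (Real.cosh B - Real.cosh A)) ^ 2 * hσ
  have hr2pos : 0 < r ^ 2 := by positivity
  have hd := det_eq (Φ.conj a)
  have e01 : (Φ.conj a) 0 1 = (p ^ 2 - 1) / r := by
    rw [h00, h11, h10] at hd
    rw [eq_div_iff hne]
    linear_combination -hd
  set E := Φ.conj (a * c) with hE
  have hEm : E = Φ.conj a * Φ.conj c := map_mul _ _ _
  have E00 : E 0 0 = s * p := by rw [hEm, sl_mul_apply, hT, hT, h00]; simp; ring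
  have E01 : E 0 1 = s * (p + (p ^ 2 - 1) / r) := by
    rw [hEm, sl_mul_apply, hT, hT, h00, e01]; simp; ring
  have E10 : E 1 0 = s * r := by rw [hEm, sl_mul_apply, hT, hT, h10]; simp; ring
  have E11 : E 1 1 = s * (r + p) := by rw [hEm, sl_mul_apply, hT, hT, h10, h11]; simp; ring
  have hrad : 1 / 4 < ((r / 2 + p) ^ 2 - 1) / r ^ 2 := by
    have : r / 2 + p = σ * Real.cosh B := by rw [hp, hrp, hta]; ring
    rw [lt_div_iff₀ hr2pos, this, mul_pow, hσ, hr2]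
    nlinarith
  obtain ⟨w₁, w₂, hw₁, hw₂, hlt⟩ := exists_axis_points hs hne E00 E01 E10 E11 hrad
  have key : ∀ w, axisFun E (vec w) = 0 → translation 1 • w ∈ Φ.toEquiv '' R := by
    intro w hw
    refine ⟨c • Φ.toEquiv.symm w, hcR _ ?_, ?_⟩
    · rw [← Φ.axisFun_eq_zero, IsometryEquiv.apply_symm_apply]
      exact hw
    · rw [Φ.map_smul, IsometryEquiv.apply_symm_apply]
      exact smul_eq_smul_of_sign hs hT _
  have h1 := mul_nonneg_of_mem_image Φ hcl hR hr₀ (by rw [he]; linarith) hfr (key w₁ hw₁)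
    (key w₂ hw₂)
  rw [← hE] at h1
  linarith

/-! ### Lifts of closed geodesics and feet of perpendiculars. -/

/-- Coordinates along the axis of a hyperbolic element. -/
theorem exists_axis_coordinates {g : SL(2, ℝ)} (h : 0 < transLength g) :
    ∃ Φ : Frame, (∀ z, axisFun g (vec z) = 0 ↔ (Φ.toEquiv z).re = 0) ∧
      ∀ γ : ℝ → ℍ, Isometry γ → (∀ s, g • γ s = γ (s + transLength g)) →
        ∃ θ : ℝ, ∀ s, (Φ.toEquiv (γ s)).im = Real.exp (θ + s) := by
  obtain ⟨Φ, s, hs, hΦ⟩ := exists_hyperbolic_frame h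
  have h2 := two_lt_abs_tr h
  set l := transLength g with hl
  have hs0 : s ≠ 0 := by rintro rfl; norm_num at hs
  have hne : (Real.exp (l / 2))⁻¹ - Real.exp (l / 2) ≠ 0 := by
    rw [← Real.exp_neg]
    have : Real.exp (-(l / 2)) < Real.exp (l / 2) := Real.exp_lt_exp.2 (by linarith)
    linarith
  have hax : ∀ z, axisFun g (vec z) = 0 ↔ (Φ.toEquiv z).re = 0 := by
    intro z
    rw [← Φ.axisFun_eq_zero]
    simp only [axisFun, hΦ, dilation_00, dilation_01, dilation_10, dilation_11, vec]
    have : (s * 0 * (((Φ.toEquiv z).re ^ 2 + (Φ.toEquiv z).im ^ 2) / (Φ.toEquiv z).im)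
      + (s * (Real.exp (l / 2))⁻¹ - s * Real.exp (l / 2)) * ((Φ.toEquiv z).re / (Φ.toEquiv z).im)
      - s * 0 * (1 / (Φ.toEquiv z).im))
      = s * ((Real.exp (l / 2))⁻¹ - Real.exp (l / 2)) * (Φ.toEquiv z).re / (Φ.toEquiv z).im := by ring
    rw [this, div_eq_zero_iff, mul_eq_zero, mul_eq_zero]
    simp [hs0, hne, (Φ.toEquiv z).im_ne_zero]
  refine ⟨Φ, hax, fun γ hγ hg => ?_⟩
  have hre : ∀ t, (Φ.toEquiv (γ t)).re = 0 := by
    intro t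
    rw [← hax, ← mem_axisOf_iff h2.le]
    change dist (γ t) (g • γ t) = transLength g
    rw [hg, hγ.dist_eq, Real.dist_eq, ← hl, abs_sub_comm, add_sub_cancel_left, abs_of_pos h]
  set θ : ℝ → ℝ := fun t => Real.log (Φ.toEquiv (γ t)).im with hθ
  have hdist : ∀ t u, |θ t - θ u| = |t - u| := by
    intro t u
    have := UpperHalfPlane.dist_of_re_eq ((hre t).trans (hre u).symm)
    rw [Φ.toEquiv.dist_eq, hγ.dist_eq, Real.dist_eq, Real.dist_eq] at this
    exact this.symm
  have hshift : θ (0 + l) = θ 0 + l := by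
    have him : (Φ.toEquiv (γ (0 + l))).im = Real.exp l * (Φ.toEquiv (γ 0)).im := by
      rw [← hg, Φ.map_smul, smul_eq_smul_of_sign hs hΦ, im_smul]
      simp only [dilation_10, dilation_11]
      have : Real.exp l = Real.exp (l / 2) ^ 2 := by rw [← Real.exp_nat_mul]; congr 1; push_cast; ring
      rw [this]
      field_simp
      ring
    simp only [hθ, him]
    rw [Real.log_mul (Real.exp_ne_zero _) (Φ.toEquiv (γ 0)).im_ne_zero, Real.log_exp, add_comm]
  refine ⟨θ 0, fun t => ?_⟩
  -- The distances from two points, γ 0 and its image under g, determine the position on the line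
  -- together with its direction.
  have h1 := hdist t 0
  have h3 := hdist t (0 + l)
  rw [hshift] at h3
  have e1 : (θ t - θ 0) ^ 2 = t ^ 2 := by rw [← sq_abs, h1, sq_abs, sub_zero]
  have e3 : (θ t - (θ 0 + l)) ^ 2 = (t - (0 + l)) ^ 2 := by rw [← sq_abs, h3, sq_abs]
  have : l * (θ t - θ 0 - t) = 0 := by linear_combination (e1 - e3) / 2
  have : θ t = θ 0 + t := by linarith [(mul_eq_zero.1 this).resolve_left h.ne']
  rw [← this, Real.exp_log (UpperHalfPlane.im_pos _)]

/-- The function is strictly convex in log w. Comparing both minima with the value at the geometric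
mean of u and v gives a sum of two squares that is at most zero. -/
theorem eq_of_isMin_sq {b c u v : ℝ} (hu : 0 < u) (hv : 0 < v) (hbc : ¬(b = 0 ∧ c = 0))
    (h1 : ∀ w, 0 < w → (c * u - b / u) ^ 2 ≤ (c * w - b / w) ^ 2)
    (h2 : ∀ w, 0 < w → (c * v - b / v) ^ 2 ≤ (c * w - b / w) ^ 2) : u = v := by
  by_contra hne
  obtain ⟨m, hm, hm2⟩ : ∃ m : ℝ, 0 < m ∧ m ^ 2 = u * v :=
    ⟨√(u * v), Real.sqrt_pos.2 (by positivity), Real.sq_sqrt (by positivity)⟩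
  have k1 := h1 m hm
  have k2 := h2 m hm
  have exp : ∀ w, 0 < w → (c * w - b / w) ^ 2 = c ^ 2 * w ^ 2 + b ^ 2 * (1 / w) ^ 2 - 2 * b * c := by
    intro w hw; field_simp; ring
  rw [exp u hu, exp m hm] at k1
  rw [exp v hv, exp m hm] at k2
  have hm3 : (1 / m) ^ 2 = 1 / u * (1 / v) := by
    rw [div_pow, hm2]; field_simp
  rw [hm3, hm2] at k1 k2
  have key : c ^ 2 * (u - v) ^ 2 + b ^ 2 * (1 / u - 1 / v) ^ 2 ≤ 0 := by linarith
  have n1 : 0 < (u - v) ^ 2 := by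
    have := sub_ne_zero.2 hne
    positivity
  have n2 : 0 < (1 / u - 1 / v) ^ 2 := by
    have : 1 / u - 1 / v ≠ 0 := by
      intro h
      apply hne
      have := sub_eq_zero.1 h
      simpa using this
    positivity
  apply hbc
  constructor
  · by_contra hb
    have : 0 < b ^ 2 := by positivity
    have := mul_pos this n2
    nlinarith [mul_nonneg (sq_nonneg c) n1.le]
  · by_contra hc
    have : 0 < c ^ 2 := by positivity
    have := mul_pos this n1
    nlinarith [mul_nonneg (sq_nonneg b) n2.le]

/-- A lift of a closed geodesic is determined by the foot of a perpendicular. -/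
theorem lift_unique {g g' : SL(2, ℝ)} (h : 0 < transLength g)
    (hg' : ∀ z, axisFun g (vec z) = 0 → axisFun g (vec (g' • z)) ≠ 0) {γ₁ γ₂ : ℝ → ℍ}
    (i₁ : Isometry γ₁) (i₂ : Isometry γ₂) (t₁ : ∀ s, g • γ₁ s = γ₁ (s + transLength g))
    (t₂ : ∀ s, g • γ₂ s = γ₂ (s + transLength g)) {s₁ s₂ : ℝ}
    (f₁ : ∀ s, dist (γ₁ s₁) (g' • γ₁ s₁) ≤ dist (γ₁ s) (g' • γ₁ s))
    (f₂ : ∀ s, dist (γ₂ s₂) (g' • γ₂ s₂) ≤ dist (γ₂ s) (g' • γ₂ s)) (s : ℝ) :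
    γ₂ (s₂ + s) = γ₁ (s₁ + s) := by
  obtain ⟨Φ, hax, hlift⟩ := exists_axis_coordinates h
  have h2 := two_lt_abs_tr h
  have haxis : ∀ γ : ℝ → ℍ, Isometry γ → (∀ s, g • γ s = γ (s + transLength g)) →
      ∀ t, axisFun g (vec (γ t)) = 0 := by
    intro γ hγ hg t
    rw [← mem_axisOf_iff h2.le]
    change dist (γ t) (g • γ t) = transLength g
    rw [hg, hγ.dist_eq, Real.dist_eq, abs_sub_comm, add_sub_cancel_left, abs_of_pos h]
  set k := Φ.conj g' with hk
  have hval : ∀ z : ℍ, axisFun g (vec z) = 0 → axisFun g' (vec z) ^ 2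
      = (k 1 0 * (Φ.toEquiv z).im - k 0 1 / (Φ.toEquiv z).im) ^ 2 := by
    intro z hz
    rw [← Φ.axisFun_sq]
    congr 1
    simp only [axisFun, vec, (hax z).1 hz]
    have := (Φ.toEquiv z).im_ne_zero
    field_simp
    ring
  -- A diagonal matrix would preserve the axis and have constant displacement along it, so that
  -- every point would be a foot.
  have hbc : ¬(k 0 1 = 0 ∧ k 1 0 = 0) := by
    rintro ⟨hb, hc⟩
    refine hg' (γ₁ 0) (haxis _ i₁ t₁ 0) ?_
    rw [hax, Φ.map_smul, re_smul, ← hk, hb, hc, (hax _).1 (haxis _ i₁ t₁ 0)]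
    simp
  have hmin : ∀ γ : ℝ → ℍ, Isometry γ → (∀ s, g • γ s = γ (s + transLength g)) → ∀ s₀,
      (∀ s, dist (γ s₀) (g' • γ s₀) ≤ dist (γ s) (g' • γ s)) → ∀ w, 0 < w →
      (k 1 0 * (Φ.toEquiv (γ s₀)).im - k 0 1 / (Φ.toEquiv (γ s₀)).im) ^ 2
        ≤ (k 1 0 * w - k 0 1 / w) ^ 2 := by
    intro γ hγ hg s₀ hf w hw
    obtain ⟨θ, hθ⟩ := hlift γ hγ hg
    have e := hθ (Real.log w - θ)
    rw [add_sub_cancel, Real.exp_log hw] at e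
    rw [← hval _ (haxis γ hγ hg s₀)]
    have e2 := hval _ (haxis γ hγ hg (Real.log w - θ))
    rw [e] at e2
    rw [← e2]
    have d1 := two_cosh_displacement g' (γ s₀)
    have d2 := two_cosh_displacement g' (γ (Real.log w - θ))
    have : Real.cosh (dist (γ s₀) (g' • γ s₀))
        ≤ Real.cosh (dist (γ (Real.log w - θ)) (g' • γ (Real.log w - θ))) := by
      rw [Real.cosh_le_cosh, abs_of_nonneg dist_nonneg, abs_of_nonneg dist_nonneg]
      exact hf _
    linarith
  have him := eq_of_isMin_sq (UpperHalfPlane.im_pos _) (UpperHalfPlane.im_pos _) hbc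
    (hmin γ₁ i₁ t₁ s₁ f₁) (hmin γ₂ i₂ t₂ s₂ f₂)
  obtain ⟨θ₁, hθ₁⟩ := hlift γ₁ i₁ t₁
  obtain ⟨θ₂, hθ₂⟩ := hlift γ₂ i₂ t₂
  rw [hθ₁, hθ₂, Real.exp_eq_exp] at him
  refine Φ.toEquiv.injective (UpperHalfPlane.ext_re_im ?_ ?_)
  · rw [(hax _).1 (haxis _ i₁ t₁ _), (hax _).1 (haxis _ i₂ t₂ _)]
  · rw [hθ₁, hθ₂, Real.exp_eq_exp]
    linarith

/-! ### Ping-pong -/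

/-- The translation by `θ` along the half circle of radius `R` about the origin. -/
def circleFlow (R θ : ℝ) (hR : R ≠ 0) : SL(2, ℝ) :=
  mkSL (Real.cosh θ) (-(R * Real.sinh θ)) (-(Real.sinh θ / R)) (Real.cosh θ) (by
    have := Real.cosh_sq θ
    field_simp
    linarith)

theorem circleFlow_add (R θ φ : ℝ) (hR : R ≠ 0) :
    circleFlow R (θ + φ) hR = circleFlow R θ hR * circleFlow R φ hR := by
  apply sl_ext <;> simp only [sl_mul_apply, circleFlow, mkSL_00, mkSL_01, mkSL_10, mkSL_11,
    Real.cosh_add, Real.sinh_add] <;> field_simp <;> ring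

theorem circleFlow_zpow (R θ : ℝ) (hR : R ≠ 0) (j : ℤ) :
    circleFlow R θ hR ^ j = circleFlow R (j * θ) hR := by
  let f : Multiplicative ℝ →* SL(2, ℝ) :=
    { toFun := fun x => circleFlow R x.toAdd hR
      map_one' := by apply sl_ext <;> simp [circleFlow]
      map_mul' := fun x y => circleFlow_add R _ _ hR }
  have := map_zpow f (Multiplicative.ofAdd θ) j
  rw [← ofAdd_zsmul] at this
  change circleFlow R (j • θ) hR = circleFlow R θ hR ^ j at this
  rw [← this, zsmul_eq_mul]

theorem translation_add (θ φ : ℝ) : translation (θ + φ) = translation θ * translation φ := by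
  apply sl_ext <;> simp [sl_mul_apply, add_comm]

theorem translation_zpow (θ : ℝ) (j : ℤ) : translation θ ^ j = translation (j * θ) := by
  let f : Multiplicative ℝ →* SL(2, ℝ) :=
    { toFun := fun x => translation x.toAdd
      map_one' := by apply sl_ext <;> simp
      map_mul' := fun x y => translation_add _ _ }
  have := map_zpow f (Multiplicative.ofAdd θ) j
  rw [← ofAdd_zsmul] at this
  change translation (j • θ) = translation θ ^ j at this
  rw [← this, zsmul_eq_mul]

/-- The square of the Euclidean norm. -/
def nsq (z : ℍ) : ℝ := z.re ^ 2 + z.im ^ 2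

theorem nsq_pos (z : ℍ) : 0 < nsq z := by
  have := z.im_pos
  unfold nsq
  positivity

theorem nsq_smul (g : SL(2, ℝ)) (z : ℍ) :
    nsq (g • z) = (g 0 0 ^ 2 * nsq z + 2 * g 0 0 * g 0 1 * z.re + g 0 1 ^ 2)
      / (g 1 0 ^ 2 * nsq z + 2 * g 1 0 * g 1 1 * z.re + g 1 1 ^ 2) := by
  have h := vec_smul g z
  have hy := z.im_ne_zero
  have hy' := (g • z).im_ne_zero
  have e1 := congrArg Prod.fst h
  have e3 := congrArg (fun v => v.2.2) h
  simp only [vec] at e1 e3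
  change nsq (g • z) / (g • z).im = g 0 0 ^ 2 * (nsq z / z.im) + _ + _ at e1
  change 1 / (g • z).im = g 1 0 ^ 2 * (nsq z / z.im) + _ + _ at e3
  have q1 : nsq (g • z) / (g • z).im
      = (g 0 0 ^ 2 * nsq z + 2 * g 0 0 * g 0 1 * z.re + g 0 1 ^ 2) / z.im := by
    rw [e1]; ring
  have q3 : 1 / (g • z).im
      = (g 1 0 ^ 2 * nsq z + 2 * g 1 0 * g 1 1 * z.re + g 1 1 ^ 2) / z.im := by
    rw [e3]; ring
  have : nsq (g • z) = (nsq (g • z) / (g • z).im) / (1 / (g • z).im) := by field_simp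
  rw [this, q1, q3, div_div_div_cancel_right₀ hy]

theorem abs_re_le (z : ℍ) : |z.re| ≤ √(nsq z) :=
  Real.abs_le_sqrt (by unfold nsq; nlinarith [sq_nonneg z.im])

/-- The circle |z| = 1/2 divides the two players of the ping-pong: the half disc that it bounds does
not overlap its translates by nonzero integers. -/
theorem le_nsq_translation {z : ℍ} (hz : nsq z ≤ 1 / 4) {k : ℤ} (hk : k ≠ 0) :
    1 / 4 ≤ nsq (translation k • z) := by
  rw [nsq_smul]
  simp only [translation_00, translation_01, translation_10, translation_11]
  have hk' : (1 : ℝ) ≤ |(k : ℝ)| := by exact_mod_cast Int.one_le_abs hk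
  have h1 := abs_re_le z
  have h2 := Real.sq_sqrt (nsq_pos z).le
  have h0 := Real.sqrt_nonneg (nsq z)
  have h3 : √(nsq z) ≤ 1 / 2 := by
    rw [Real.sqrt_le_left (by norm_num)]; linarith
  generalize √(nsq z) = ρ at *
  have h4 : -(|(k : ℝ)| * ρ) ≤ k * z.re := by
    have := neg_abs_le ((k : ℝ) * z.re)
    rw [abs_mul] at this
    nlinarith [mul_le_mul_of_nonneg_left h1 (abs_nonneg (k : ℝ))]
  have h5 : (1 / 2) ^ 2 ≤ (|(k : ℝ)| - ρ) ^ 2 := pow_le_pow_left₀ (by norm_num) (by linarith) 2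
  have h6 := sq_abs (k : ℝ)
  norm_num
  nlinarith

/-- The expression factors into two terms that are linear in ρ and increasing, so only ρ = 1/2 has
to be checked. There the first factor is half the difference of the two sides of `h`. -/
theorem circleFlow_factor {q ch sh ρ : ℝ} (hq : 0 < q) (hq1 : q < 1) (hsh : 0 ≤ sh) (hch : 0 ≤ ch)
    (h : 2 * q * ch ≤ (1 + q ^ 2) * sh) (hρ : 1 / 2 ≤ ρ) :
    0 ≤ ρ ^ 2 * (sh ^ 2 - q ^ 2 * ch ^ 2) + q ^ 2 * (ch ^ 2 - q ^ 2 * sh ^ 2) / 4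
      - ρ * q * ch * sh * (1 - q ^ 2) := by
  have hq2 : q ^ 2 ≤ 1 := by nlinarith
  have h1 : q * ch ≤ sh := by nlinarith [mul_nonneg (sub_nonneg.2 hq2) hsh]
  have e : ρ ^ 2 * (sh ^ 2 - q ^ 2 * ch ^ 2) + q ^ 2 * (ch ^ 2 - q ^ 2 * sh ^ 2) / 4
      - ρ * q * ch * sh * (1 - q ^ 2)
      = (ρ * (sh - q * ch) - q / 2 * (ch - q * sh)) * (ρ * (sh + q * ch) - q / 2 * (ch + q * sh)) := by
    ring
  rw [e]
  refine mul_nonneg ?_ ?_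
  · nlinarith [mul_le_mul_of_nonneg_right hρ (sub_nonneg.2 h1)]
  · have : 0 ≤ sh + q * ch := by positivity
    nlinarith [mul_le_mul_of_nonneg_right hρ this, mul_nonneg (sub_nonneg.2 hq2) hsh]

/-- The projection of |z| ≥ 1/2 to the geodesic |z| = R has half length s with tanh s = 2q / (1 +
q²), q = 2R. The hypothesis `h` says |θ| ≥ s: the translation, of length 2|θ|, moves this shadow off
itself. -/
theorem nsq_circleFlow_le {R θ : ℝ} (hR : 0 < R) (hR1 : 2 * R < 1)
    (h : 2 * (2 * R) * Real.cosh θ ≤ (1 + (2 * R) ^ 2) * |Real.sinh θ|) {z : ℍ}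
    (hz : 1 / 4 ≤ nsq z) : nsq (circleFlow R θ hR.ne' • z) ≤ 1 / 4 := by
  have hden := denom_pos (circleFlow R θ hR.ne') z
  rw [nsq_smul]
  have hden' : 0 < circleFlow R θ hR.ne' 1 0 ^ 2 * nsq z
      + 2 * circleFlow R θ hR.ne' 1 0 * circleFlow R θ hR.ne' 1 1 * z.re
      + circleFlow R θ hR.ne' 1 1 ^ 2 := by
    unfold nsq
    linarith
  rw [div_le_iff₀ hden']
  simp only [circleFlow, mkSL_00, mkSL_01, mkSL_10, mkSL_11]
  have h2 := Real.sq_sqrt (nsq_pos z).le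
  have h3 : 1 / 2 ≤ √(nsq z) := by
    rw [Real.le_sqrt (by norm_num) (nsq_pos z).le]; linarith
  have h1 := abs_re_le z
  have key := circleFlow_factor (q := 2 * R) (by positivity) hR1 (abs_nonneg (Real.sinh θ))
    (Real.cosh_pos θ).le h h3
  rw [sq_abs, h2] at key
  have hx : z.re * Real.sinh θ ≤ √(nsq z) * |Real.sinh θ| := by
    refine (le_abs_self _).trans ?_
    rw [abs_mul]
    exact mul_le_mul_of_nonneg_right h1 (abs_nonneg _)
  have hc := Real.cosh_pos θ
  have h4 : 0 ≤ 2 * R * Real.cosh θ * (1 - (2 * R) ^ 2) := by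
    have : 0 ≤ 1 - (2 * R) ^ 2 := by nlinarith
    positivity
  have h5 := mul_le_mul_of_nonneg_left hx h4
  have hfin : 0 ≤ nsq z * (Real.sinh θ ^ 2 - (2 * R) ^ 2 * Real.cosh θ ^ 2)
      + (2 * R) ^ 2 * (Real.cosh θ ^ 2 - (2 * R) ^ 2 * Real.sinh θ ^ 2) / 4
      - 2 * R * Real.cosh θ * (1 - (2 * R) ^ 2) * (z.re * Real.sinh θ) := by linarith
  have e : 1 / 4 * ((-(Real.sinh θ / R)) ^ 2 * nsq z
      + 2 * -(Real.sinh θ / R) * Real.cosh θ * z.re + Real.cosh θ ^ 2)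
      - (Real.cosh θ ^ 2 * nsq z + 2 * Real.cosh θ * -(R * Real.sinh θ) * z.re
      + (-(R * Real.sinh θ)) ^ 2)
      = (nsq z * (Real.sinh θ ^ 2 - (2 * R) ^ 2 * Real.cosh θ ^ 2)
      + (2 * R) ^ 2 * (Real.cosh θ ^ 2 - (2 * R) ^ 2 * Real.sinh θ ^ 2) / 4
      - 2 * R * Real.cosh θ * (1 - (2 * R) ^ 2) * (z.re * Real.sinh θ)) / (2 * R) ^ 2 := by
    field_simp
    ring
  have := div_nonneg hfin (sq_nonneg (2 * R))
  linarith

theorem nsq_circleFlow_eq {R θ : ℝ} (hR : R ≠ 0) {z : ℍ} (hz : nsq z = R ^ 2) :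
    nsq (circleFlow R θ hR • z) = R ^ 2 := by
  have hden := denom_pos (circleFlow R θ hR) z
  rw [nsq_smul]
  have hden' : 0 < circleFlow R θ hR 1 0 ^ 2 * nsq z
      + 2 * circleFlow R θ hR 1 0 * circleFlow R θ hR 1 1 * z.re
      + circleFlow R θ hR 1 1 ^ 2 := by
    unfold nsq
    linarith
  rw [div_eq_iff hden'.ne', hz]
  simp only [circleFlow, mkSL_00, mkSL_01, mkSL_10, mkSL_11]
  field_simp
  ring

/-- The Euclidean norm grows at most exponentially with the hyperbolic distance. -/
theorem log_le_dist {z w : ℍ} {p q : ℝ} (hp : 0 < p) (hpq : p ≤ q) (hz : nsq z = p ^ 2)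
    (hw : q ^ 2 ≤ nsq w) : Real.log (q / p) ≤ dist z w := by
  obtain ⟨q', hq', hw'⟩ : ∃ q' : ℝ, 0 < q' ∧ nsq w = q' ^ 2 :=
    ⟨_, Real.sqrt_pos.2 (nsq_pos w), (Real.sq_sqrt (nsq_pos w).le).symm⟩
  have hqq : q ≤ q' := by
    rw [hw'] at hw
    exact (pow_le_pow_iff_left₀ (hp.le.trans hpq) hq'.le two_ne_zero).1 hw
  have hmono : q / p ≤ q' / p := by gcongr
  have hqpos : 0 < q := hp.trans_le hpq
  rw [Real.log_le_iff_le_exp (by positivity)]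
  refine hmono.trans ?_
  have hzi := z.im_pos
  have hwi := w.im_pos
  -- Cauchy–Schwarz: for given norms, points on a common ray from 0 are the closest. The bound on
  -- the distance follows since x + 1/x increases for x ≥ 1.
  have hcosh : q' / p + p / q' ≤ 2 * Real.cosh (dist z w) := by
    rw [cosh_dist]
    simp only [mink, vec]
    change _ ≤ 2 * ((nsq z / z.im * (1 / w.im) + nsq w / w.im * (1 / z.im)
      - 2 * (z.re / z.im) * (w.re / w.im)) / 2)
    have e : 2 * ((nsq z / z.im * (1 / w.im) + nsq w / w.im * (1 / z.im)
      - 2 * (z.re / z.im) * (w.re / w.im)) / 2) = (nsq z + nsq w - 2 * z.re * w.re) / (z.im * w.im) := by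
      field_simp
    rw [e, hz, hw']
    have e2 : q' / p + p / q' = (p ^ 2 + q' ^ 2) / (p * q') := by field_simp; ring
    rw [e2, div_le_div_iff₀ (by positivity) (by positivity)]
    have hz2 : z.re ^ 2 + z.im ^ 2 = p ^ 2 := hz
    have hw2 : w.re ^ 2 + w.im ^ 2 = q' ^ 2 := hw'
    have hcs : z.re * w.re + z.im * w.im ≤ p * q' := by
      apply le_of_sq_le_sq _ (by positivity)
      rw [mul_pow, ← hz2, ← hw2]
      nlinarith [sq_nonneg (z.re * w.im - z.im * w.re)]
    have hcs2 : z.im * w.im ≤ p * q' := by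
      apply le_of_sq_le_sq _ (by positivity)
      rw [mul_pow, mul_pow, ← hz2, ← hw2]
      nlinarith [sq_nonneg (z.re * w.im), sq_nonneg (z.re * w.re), sq_nonneg (z.im * w.re)]
    have h1 : 2 * (p * q') * (p * q' - z.im * w.im) ≤ (p ^ 2 + q' ^ 2) * (p * q' - z.im * w.im) := by
      refine mul_le_mul_of_nonneg_right ?_ (sub_nonneg.2 hcs2)
      nlinarith [sq_nonneg (p - q')]
    have h2 : 2 * (p * q') * (z.re * w.re) ≤ 2 * (p * q') * (p * q' - z.im * w.im) := by
      refine mul_le_mul_of_nonneg_left (by linarith) (by positivity)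
    linarith
  have hexp := Real.exp_pos (dist z w)
  have hexp1 : 1 ≤ Real.exp (dist z w) := Real.one_le_exp dist_nonneg
  rw [Real.cosh_eq, Real.exp_neg] at hcosh
  have h1 : 1 ≤ q' / p := by rw [le_div_iff₀ hp]; linarith
  have e3 : p / q' = (q' / p)⁻¹ := by rw [inv_div]
  rw [e3] at hcosh
  generalize q' / p = t at *
  generalize Real.exp (dist z w) = e at *
  by_contra! hlt
  have ht : 0 < t := by linarith
  have : t + t⁻¹ - (e + e⁻¹) = (t - e) * (t * e - 1) / (t * e) := by field_simp; ring
  have h2 : 0 < (t - e) * (t * e - 1) / (t * e) := by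
    refine div_pos (mul_pos (by linarith) ?_) (by positivity)
    nlinarith
  linarith

/-- Alternating words in the powers of `κ` and `α` that begin with a power of `κ`. -/
inductive AltWord {G : Type*} [Group G] (α κ : G) : G → Prop
  | base (k j : ℤ) (hk : k ≠ 0) : AltWord α κ (κ ^ k * α ^ j)
  | step (k j : ℤ) (hk : k ≠ 0) (hj : j ≠ 0) (v : G) (hv : AltWord α κ v) :
      AltWord α κ (κ ^ k * (α ^ j * v))

/-- A leading power of α preserves the axis of α and can be moved to the other of two points whose
distance is measured; only the alternating word v matters. -/
theorem exists_altWord {G : Type*} [Group G] {α κ u : G} (hu : u ∈ Subgroup.closure {α, κ}) :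
    u ∈ Subgroup.zpowers α ∨ ∃ (j : ℤ) (v : G), AltWord α κ v ∧ u = α ^ j * v := by
  have hα : ∀ (i : ℤ) (u : G),
      (u ∈ Subgroup.zpowers α ∨ ∃ (j : ℤ) (v : G), AltWord α κ v ∧ u = α ^ j * v) →
      (α ^ i * u ∈ Subgroup.zpowers α ∨
        ∃ (j : ℤ) (v : G), AltWord α κ v ∧ α ^ i * u = α ^ j * v) := by
    rintro i u (h | ⟨j, v, hv, rfl⟩)
    · exact Or.inl (mul_mem (Subgroup.zpow_mem_zpowers α i) h)
    · exact Or.inr ⟨i + j, v, hv, by rw [zpow_add, mul_assoc]⟩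
  have hκ : ∀ (i : ℤ), i ≠ 0 → ∀ (u : G),
      (u ∈ Subgroup.zpowers α ∨ ∃ (j : ℤ) (v : G), AltWord α κ v ∧ u = α ^ j * v) →
      (κ ^ i * u ∈ Subgroup.zpowers α ∨
        ∃ (j : ℤ) (v : G), AltWord α κ v ∧ κ ^ i * u = α ^ j * v) := by
    rintro i hi u (h | ⟨j, v, hv, rfl⟩)
    · obtain ⟨j, rfl⟩ := Subgroup.mem_zpowers_iff.1 h
      exact Or.inr ⟨0, _, AltWord.base i j hi, by simp⟩
    · by_cases hj : j = 0
      · subst hj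
        rw [zpow_zero, one_mul]
        cases hv with
        | base k j hk =>
          by_cases h0 : i + k = 0
          · rw [← mul_assoc, ← zpow_add, h0, zpow_zero, one_mul]
            exact Or.inl (Subgroup.zpow_mem_zpowers α j)
          · exact Or.inr ⟨0, _, AltWord.base (i + k) j h0, by rw [zpow_add]; group⟩
        | step k j hk hj v hv =>
          by_cases h0 : i + k = 0
          · rw [← mul_assoc, ← zpow_add, h0, zpow_zero, one_mul]
            exact Or.inr ⟨j, v, hv, rfl⟩
          · exact Or.inr ⟨0, _, AltWord.step (i + k) j h0 hj v hv, by rw [zpow_add]; group⟩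
      · exact Or.inr ⟨0, _, AltWord.step i j hi hj v hv, by simp⟩
  induction hu using Subgroup.closure_induction_left with
  | one => exact Or.inl (one_mem _)
  | mul_left x hx y hy ih =>
    rcases hx with rfl | rfl
    · simpa using hα 1 y ih
    · simpa using hκ 1 one_ne_zero y ih
  | inv_mul_cancel x hx y hy ih =>
    rcases hx with rfl | rfl
    · simpa using hα (-1) y ih
    · simpa using hκ (-1) (by norm_num) y ih

/-- The radius of the half circle that covers a cuff. -/
def cuffRadius (A B : ℝ) : ℝ := Real.sinh A / (2 * (Real.cosh A + Real.cosh B))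

theorem cuffRadius_pos {A : ℝ} (B : ℝ) (hA : 0 < A) : 0 < cuffRadius A B := by
  have := Real.sinh_pos_iff.2 hA
  have := Real.cosh_pos A
  have := Real.cosh_pos B
  unfold cuffRadius
  positivity

theorem two_cuffRadius_lt_one (A B : ℝ) : 2 * cuffRadius A B < 1 := by
  have h1 := Real.cosh_pos A
  have h2 := Real.cosh_pos B
  have h3 := Real.sinh_lt_cosh A
  unfold cuffRadius
  rw [mul_div_assoc', mul_div_mul_left _ _ two_ne_zero, div_lt_one (by positivity)]
  linarith

theorem pantsMat_eq_circleFlow {A : ℝ} (B : ℝ) (hA : 0 < A) :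
    pantsMat A B = circleFlow (cuffRadius A B) A (cuffRadius_pos B hA).ne' := by
  have h0 := Real.sinh_pos_iff.2 hA
  have h1 := Real.cosh_pos A
  have h2 := Real.cosh_pos B
  apply sl_ext <;> simp only [pantsMat, circleFlow, mkSL_00, mkSL_01, mkSL_10, mkSL_11]
  · unfold cuffRadius
    ring
  · unfold cuffRadius
    field_simp

/-- For j = 1 the difference of the sides is a nonnegative multiple of cosh² B - 1, hence zero
exactly if the other cuff degenerates to a cusp. Larger |j| only helps, as tanh increases. -/
theorem cuff_shadow {A B : ℝ} (hA : 0 < A) {j : ℤ} (hj : j ≠ 0) :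
    2 * (2 * cuffRadius A B) * Real.cosh (j * A)
      ≤ (1 + (2 * cuffRadius A B) ^ 2) * |Real.sinh (j * A)| := by
  have h0 := Real.sinh_pos_iff.2 hA
  have h1 := Real.cosh_pos A
  have h2 := Real.one_le_cosh B
  have hj' : (1 : ℝ) ≤ |(j : ℝ)| := by exact_mod_cast Int.one_le_abs hj
  rw [Real.abs_sinh, ← Real.cosh_abs, abs_mul, abs_of_pos hA]
  set θ := |(j : ℝ)| * A
  have hθ : A ≤ θ := by nlinarith
  have h3 : Real.sinh A * Real.cosh θ ≤ Real.sinh θ * Real.cosh A := by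
    have := Real.sinh_nonneg_iff.2 (sub_nonneg.2 hθ)
    rw [Real.sinh_sub] at this
    linarith
  have hq : 2 * cuffRadius A B = Real.sinh A / (Real.cosh A + Real.cosh B) := by
    unfold cuffRadius; field_simp
  rw [hq]
  have hS : 0 < Real.cosh A + Real.cosh B := by linarith
  have h4 : 2 * (Real.sinh A / (Real.cosh A + Real.cosh B)) * Real.cosh A
      ≤ (1 + (Real.sinh A / (Real.cosh A + Real.cosh B)) ^ 2) * Real.sinh A := by
    have hs := Real.cosh_sq A
    have e : (1 + (Real.sinh A / (Real.cosh A + Real.cosh B)) ^ 2) * Real.sinh A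
        - 2 * (Real.sinh A / (Real.cosh A + Real.cosh B)) * Real.cosh A
        = Real.sinh A * (Real.cosh B ^ 2 - 1) / (Real.cosh A + Real.cosh B) ^ 2 := by
      field_simp
      linear_combination -hs
    have : 0 ≤ Real.sinh A * (Real.cosh B ^ 2 - 1) / (Real.cosh A + Real.cosh B) ^ 2 := by
      refine div_nonneg (mul_nonneg h0.le ?_) (sq_nonneg _)
      nlinarith
    linarith
  generalize Real.sinh A / (Real.cosh A + Real.cosh B) = q at *
  have hcθ := Real.cosh_pos θ
  have h5 := mul_le_mul_of_nonneg_right h4 hcθ.le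
  have h6 := mul_le_mul_of_nonneg_left h3 (by positivity : 0 ≤ 1 + q ^ 2)
  refine le_of_mul_le_mul_right ?_ h1
  linarith

theorem map_zpow_smul {G : Type*} [Group G] (ρ : G →* SL(2, ℝ)) (ν : ℍ ≃ᵢ ℍ) {α : G} {M : SL(2, ℝ)}
    (h : ∀ z, ν (ρ α • z) = M • ν z) (j : ℤ) (z : ℍ) : ν (ρ (α ^ j) • z) = M ^ j • ν z := by
  induction j using Int.induction_on generalizing z with
  | zero => simp
  | succ i ih => rw [zpow_add_one, zpow_add_one, map_mul, mul_smul, mul_smul, ih, h]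
  | pred i ih =>
    rw [zpow_sub_one, zpow_sub_one, map_mul, mul_smul, mul_smul, ih]
    congr 1
    rw [eq_inv_smul_iff, ← h, ← mul_smul, ← map_mul, mul_inv_cancel, map_one, one_smul]

/-- Distinct lifts of a cuff are far apart in the universal covering of a pair of pants, if the
other cuff is long. -/
theorem line_separation {G : Type*} [Group G] (ρ : G →* SL(2, ℝ)) {α κ : G} {A B : ℝ} (hA : 0 < A)
    (ν : ℍ ≃ᵢ ℍ) (hα : ∀ z, ν (ρ α • z) = pantsMat A B • ν z)
    (hκ : ∀ z, ν (ρ κ • z) = translation 1 • ν z) (htr : |tr (ρ α)| = 2 * Real.cosh A) {u : G}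
    (hu : u ∈ Subgroup.closure {α, κ}) (hu' : u ∉ Subgroup.zpowers α) {x y : ℍ}
    (hx : axisFun (ρ α) (vec x) = 0) (hy : axisFun (ρ α) (vec y) = 0) :
    Real.log ((Real.cosh A + Real.cosh B) / Real.sinh A) ≤ dist x (ρ u • y) := by
  have hR := cuffRadius_pos B hA
  have hR1 := two_cuffRadius_lt_one A B
  rw [pantsMat_eq_circleFlow B hA] at hα
  have zα : ∀ (j : ℤ) z, ν (ρ (α ^ j) • z) = circleFlow (cuffRadius A B) (j * A) hR.ne' • ν z := by
    intro j z
    rw [map_zpow_smul ρ ν hα, circleFlow_zpow]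
  have zκ : ∀ (j : ℤ) z, ν (ρ (κ ^ j) • z) = translation j • ν z := by
    intro j z
    rw [map_zpow_smul ρ ν hκ, translation_zpow, mul_one]
  have hline : ∀ z, axisFun (ρ α) (vec z) = 0 → nsq (ν z) = cuffRadius A B ^ 2 := by
    intro z hz
    have h1 := four_cosh_sq (ρ α) z
    have h2 := four_cosh_sq (circleFlow (cuffRadius A B) A hR.ne') (ν z)
    rw [← hα, ν.dist_eq, h1, hz] at h2
    have h3 : tr (circleFlow (cuffRadius A B) A hR.ne') ^ 2 = tr (ρ α) ^ 2 := by
      rw [← sq_abs (tr (ρ α)), htr]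
      simp only [tr, circleFlow, mkSL_00, mkSL_11]
      ring
    have h4 : axisFun (circleFlow (cuffRadius A B) A hR.ne') (vec (ν z)) = 0 := by
      have : axisFun (circleFlow (cuffRadius A B) A hR.ne') (vec (ν z)) ^ 2 = 0 := by linarith
      exact pow_eq_zero_iff two_ne_zero |>.1 this
    simp only [axisFun, circleFlow, mkSL_00, mkSL_01, mkSL_10, mkSL_11, vec] at h4
    have h0 := (Real.sinh_pos_iff.2 hA).ne'
    have hy := (ν z).im_ne_zero
    field_simp at h4
    unfold nsq
    have h5 : Real.sinh A * ((ν z).re ^ 2 + (ν z).im ^ 2 - cuffRadius A B ^ 2) = 0 := by linarith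
    linarith [(mul_eq_zero.1 h5).resolve_left h0]
  -- Ping-pong: nonzero powers of α map the outside of |z| = 1/2 inside, and nonzero powers of κ map
  -- the inside outside. The axis of α itself starts inside.
  have hword : ∀ v, AltWord α κ v → ∀ z, axisFun (ρ α) (vec z) = 0 → 1 / 4 ≤ nsq (ν (ρ v • z)) := by
    intro v hv z hz
    induction hv with
    | base k j hk =>
      rw [map_mul, mul_smul, zκ, zα]
      refine le_nsq_translation ?_ hk
      rw [nsq_circleFlow_eq _ (hline z hz)]
      nlinarith
    | step k j hk hj v hv ih =>
      rw [map_mul, mul_smul, zκ, map_mul, mul_smul, zα]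
      exact le_nsq_translation (nsq_circleFlow_le hR hR1 (cuff_shadow hA hj) ih) hk
  obtain h | ⟨j, v, hv, rfl⟩ := exists_altWord hu
  · exact absurd h hu'
  have e : dist x (ρ (α ^ j * v) • y) = dist (ν (ρ (α ^ (-j)) • x)) (ν (ρ v • y)) := by
    rw [ν.dist_eq, map_mul, mul_smul, ← dist_smul (ρ (α ^ (-j))) x, ← mul_smul (ρ (α ^ (-j))),
      ← map_mul, ← zpow_add, neg_add_cancel, zpow_zero, map_one, one_smul]
  have hR2 : (Real.cosh A + Real.cosh B) / Real.sinh A = 1 / 2 / cuffRadius A B := by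
    unfold cuffRadius
    have := Real.sinh_pos_iff.2 hA
    have := Real.cosh_pos A
    have := Real.cosh_pos B
    field_simp
  rw [e, hR2]
  refine log_le_dist hR (by linarith) ?_ ?_
  · rw [zα, nsq_circleFlow_eq _ (hline x hx)]
  · have := hword v hv y hy
    linarith

/-! ### Cuffs in the free group. -/

/-- The exponent of the `i`-th generator. -/
def exponent (i : ℕ) : FreeGroup ℕ →* Multiplicative ℤ :=
  FreeGroup.lift fun j => if j = i then Multiplicative.ofAdd 1 else 1

lemma exponent_of (i j : ℕ) :
    exponent i (FreeGroup.of j) = if j = i then Multiplicative.ofAdd 1 else 1 := by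
  simp [exponent]

lemma exponent_bdry (i n : ℕ) :
    exponent i (bdry n) = if i ≤ n then Multiplicative.ofAdd 1 else 1 := by
  induction n with
  | zero =>
    simp only [bdry, exponent_of, Nat.le_zero_eq, eq_comm]
  | succ n ih =>
    simp only [bdry, map_mul, ih, exponent_of]
    by_cases h : i ≤ n
    · rw [if_pos h, if_neg (by omega), if_pos (by omega), mul_one]
    · by_cases h' : n + 1 = i
      · rw [if_neg h, if_pos h', if_pos (by omega), one_mul]
      · rw [if_neg h, if_neg h', if_neg (by omega), one_mul]

lemma ofAdd_one_ne_one : (Multiplicative.ofAdd (1 : ℤ)) ≠ 1 := by decide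

lemma bdry_ne_one (n : ℕ) : bdry n ≠ 1 := by
  intro h
  have := exponent_bdry 0 n
  rw [h, map_one, if_pos (Nat.zero_le n)] at this
  exact ofAdd_one_ne_one this.symm

lemma of_ne_one' (n : ℕ) : (FreeGroup.of n : FreeGroup ℕ) ≠ 1 := by
  intro h
  have := exponent_of n n
  rw [h, map_one, if_pos rfl] at this
  exact ofAdd_one_ne_one this.symm

lemma exponent_conj (i : ℕ) (p g : FreeGroup ℕ) : exponent i (p * g * p⁻¹) = exponent i g := by
  rw [map_mul, map_mul, map_inv, mul_right_comm, mul_inv_cancel, one_mul]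

/-- The generator n + 1 has exponent one in the conjugate and zero in every power of `bdry n`. -/
lemma conj_bdry_succ_notMem (p : FreeGroup ℕ) (n : ℕ) :
    p * bdry (n + 1) * p⁻¹ ∉ Subgroup.zpowers (bdry n) := by
  rintro ⟨k, hk⟩
  have := congrArg (exponent (n + 1)) hk
  simp only [map_zpow, exponent_conj, exponent_bdry] at this
  rw [if_neg (by omega), if_pos le_rfl, one_zpow] at this
  exact ofAdd_one_ne_one this.symm

/-- In powers of `bdry (n + 1)` the generators 0 and n + 1 have equal exponents; in `bdry n` they
have not. -/
lemma conj_bdry_notMem (p : FreeGroup ℕ) (n : ℕ) :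
    p * bdry n * p⁻¹ ∉ Subgroup.zpowers (bdry (n + 1)) := by
  rintro ⟨k, hk⟩
  have h0 := congrArg (exponent 0) hk
  have h1 := congrArg (exponent (n + 1)) hk
  simp only [map_zpow, exponent_conj, exponent_bdry] at h0 h1
  rw [if_pos (by omega), if_pos (by omega)] at h0
  rw [if_pos le_rfl, if_neg (by omega)] at h1
  rw [h1] at h0
  exact ofAdd_one_ne_one h0.symm

lemma bdry_mem (n : ℕ) : bdry n ∈ pantsGroup n := Subgroup.subset_closure (by simp)

lemma of_mem (n : ℕ) : FreeGroup.of (n + 1) ∈ pantsGroup n := Subgroup.subset_closure (by simp)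

lemma bdry_succ_mem (n : ℕ) : bdry (n + 1) ∈ pantsGroup n := mul_mem (bdry_mem n) (of_mem n)

/-- These generators exchange the roles of the two cuffs, as `bdry (n + 1)` times the inverse of the
cusp is `bdry n`. Normal form and ping-pong thus apply to the upper cuff as well. -/
lemma pantsGroup_eq (n : ℕ) :
    pantsGroup n = Subgroup.closure {bdry (n + 1), (FreeGroup.of (n + 1))⁻¹} := by
  apply le_antisymm
  · rw [pantsGroup, Subgroup.closure_le]
    have h1 : bdry (n + 1) ∈ Subgroup.closure {bdry (n + 1), (FreeGroup.of (n + 1))⁻¹} :=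
      Subgroup.subset_closure (by simp)
    have h2 : (FreeGroup.of (n + 1))⁻¹ ∈
        Subgroup.closure {bdry (n + 1), (FreeGroup.of (n + 1))⁻¹} :=
      Subgroup.subset_closure (by simp)
    rintro x (rfl | rfl)
    · have := mul_mem h1 h2
      rwa [bdry, mul_inv_cancel_right] at this
    · exact inv_mem_iff.1 h2
  · rw [Subgroup.closure_le]
    rintro x (rfl | rfl)
    · exact bdry_succ_mem n
    · exact inv_mem (of_mem n)

/-! ### Geometry of the pairs of pants of a surface. -/

section Surface

variable (X : TightFlute)

/-- Half the length of the `n`-th cuff. -/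
def halfLen (n : ℕ) : ℝ := X.cuffLength n / 2

lemma halfLen_nonneg (n : ℕ) : 0 ≤ halfLen X n := by
  have := transLength_nonneg (X.hol (bdry n))
  unfold halfLen TightFlute.cuffLength TightFlute.length
  linarith

lemma halfLen_pos {n : ℕ} (h : 1 ≤ n) : 0 < halfLen X n := by
  have := X.cuff n h
  unfold halfLen TightFlute.cuffLength TightFlute.length
  linarith

/-- The puncture `bdry 0` counts as a cuff of length zero, so that P 0 needs no separate normal
form. -/
lemma halfLen_zero : halfLen X 0 = 0 := by
  have := X.cusp 0
  unfold halfLen TightFlute.cuffLength TightFlute.length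
  rw [bdry, this, zero_div]

lemma two_le_abs_tr {g : FreeGroup ℕ} (h : g ≠ 1) : 2 ≤ |tr (X.hol g)| := by
  by_contra hc
  obtain ⟨z, hz⟩ := exists_fixed_point (not_le.1 hc)
  exact X.free g h z hz

lemma abs_tr_bdry (n : ℕ) : |tr (X.hol (bdry n))| = 2 * Real.cosh (halfLen X n) :=
  abs_tr_eq (two_le_abs_tr X (bdry_ne_one n))

lemma abs_tr_of (n : ℕ) : |tr (X.hol (FreeGroup.of n))| = 2 := by
  have := abs_tr_eq (two_le_abs_tr X (of_ne_one' n))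
  rw [X.cusp n] at this
  simpa using this

/-- The `n`-th cuff as a linear form. -/
def cuffFun (n : ℕ) (z : ℍ) : ℝ := axisFun (X.hol (bdry n)) (vec z)

lemma two_lt_abs_tr_bdry {n : ℕ} (h : 1 ≤ n) : 2 < |tr (X.hol (bdry n))| :=
  two_lt_abs_tr (X.cuff n h)

lemma mem_axisOf_bdry {n : ℕ} (z : ℍ) : z ∈ axisOf (X.hol (bdry n)) ↔ cuffFun X n z = 0 :=
  mem_axisOf_iff (two_le_abs_tr X (bdry_ne_one n)) z

lemma smul_mem_region {n : ℕ} {p : FreeGroup ℕ} (hp : p ∈ pantsGroup n) {z : ℍ}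
    (hz : z ∈ X.region n) : X.hol p • z ∈ X.region n := by
  rw [← X.region_invariant n p hp]
  exact ⟨z, hz, rfl⟩

lemma frontier_subset_region (n : ℕ) : frontier (X.region n) ⊆ X.region n :=
  (X.region_closed n).frontier_subset

lemma smul_mem_frontier {n m : ℕ} (hm : m = n ∨ m = n + 1) {p : FreeGroup ℕ}
    (hp : p ∈ pantsGroup n) {z : ℍ} (hz : cuffFun X m z = 0) :
    X.hol p • z ∈ frontier (X.region n) := by
  rw [X.region_frontier n]
  refine Set.mem_biUnion hp ⟨z, ?_, rfl⟩
  rw [← mem_axisOf_bdry] at hz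
  rcases hm with rfl | rfl
  · exact Or.inl hz
  · exact Or.inr hz

lemma mem_frontier {n m : ℕ} (hm : m = n ∨ m = n + 1) {z : ℍ} (hz : cuffFun X m z = 0) :
    z ∈ frontier (X.region n) := by
  simpa using smul_mem_frontier X hm (one_mem (pantsGroup n)) hz

lemma smul_mem_region_of_cuff {n m : ℕ} (hm : m = n ∨ m = n + 1) {p : FreeGroup ℕ}
    (hp : p ∈ pantsGroup n) {z : ℍ} (hz : cuffFun X m z = 0) : X.hol p • z ∈ X.region n :=
  frontier_subset_region X n (smul_mem_frontier X hm hp hz)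

lemma exists_cuffFun_eq_zero {n : ℕ} (h : 1 ≤ n) : ∃ z, cuffFun X n z = 0 :=
  exists_axisFun_eq_zero (two_lt_abs_tr_bdry X h)

lemma trace_neg {n : ℕ} (h : halfLen X n < halfLen X (n + 1)) :
    tr (X.hol (bdry n)) * tr (X.hol (FreeGroup.of (n + 1))) * tr (X.hol (bdry (n + 1))) < 0 := by
  obtain ⟨r₀, hr₀⟩ := X.region_interior n
  have e : X.hol (bdry n) * X.hol (FreeGroup.of (n + 1)) = X.hol (bdry (n + 1)) := by
    rw [← map_mul, bdry]
  have := trace_product_neg (X.region_closed n) (X.region_convex n) hr₀ (halfLen_nonneg X n) h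
    (abs_tr_bdry X n) (abs_tr_of X (n + 1)) (X.free _ (of_ne_one' _))
    (by rw [e]; exact abs_tr_bdry X (n + 1))
    (fun z hz => mem_frontier X (Or.inr rfl) (by rw [e] at hz; exact hz))
    (fun z hz => smul_mem_region_of_cuff X (Or.inr rfl) (of_mem n) (by rw [e] at hz; exact hz))
  rwa [e] at this

lemma cosh_halfLen_ne {n : ℕ} (h : halfLen X n < halfLen X (n + 1)) :
    Real.cosh (halfLen X n) ≠ Real.cosh (halfLen X (n + 1)) := by
  apply ne_of_lt
  rw [Real.cosh_lt_cosh, abs_of_nonneg (halfLen_nonneg X _), abs_of_nonneg (halfLen_nonneg X _)]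
  exact h

lemma exists_frame {n : ℕ} (h : halfLen X n < halfLen X (n + 1)) :
    ∃ Φ : Frame, (∀ z, Φ.toEquiv (X.hol (FreeGroup.of (n + 1)) • z) =
        translation 1 • Φ.toEquiv z) ∧
      ∀ z, Φ.toEquiv (X.hol (bdry n) • z) =
        pantsMat (halfLen X n) (halfLen X (n + 1)) • Φ.toEquiv z := by
  have e : X.hol (bdry n) * X.hol (FreeGroup.of (n + 1)) = X.hol (bdry (n + 1)) := by
    rw [← map_mul, bdry]
  exact exists_pants_frame (abs_tr_bdry X n) (abs_tr_of X _) (X.free _ (of_ne_one' _))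
    (by rw [e]; exact abs_tr_bdry X (n + 1)) (cosh_halfLen_ne X h)
    (by rw [e]; exact trace_neg X h)

lemma exists_frame_swap {n : ℕ} (h : halfLen X n < halfLen X (n + 1)) :
    ∃ Φ : Frame, (∀ z, Φ.toEquiv (X.hol (FreeGroup.of (n + 1))⁻¹ • z) =
        translation 1 • Φ.toEquiv z) ∧
      ∀ z, Φ.toEquiv (X.hol (bdry (n + 1)) • z) =
        pantsMat (halfLen X (n + 1)) (halfLen X n) • Φ.toEquiv z := by
  have e : X.hol (bdry (n + 1)) * X.hol (FreeGroup.of (n + 1))⁻¹ = X.hol (bdry n) := by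
    rw [← map_mul, bdry, mul_inv_cancel_right]
  have e' : tr (X.hol (FreeGroup.of (n + 1))⁻¹) = tr (X.hol (FreeGroup.of (n + 1))) := by
    rw [map_inv, tr_inv]
  refine exists_pants_frame (abs_tr_bdry X _) (by rw [e']; exact abs_tr_of X _)
    (X.free _ (inv_ne_one.2 (of_ne_one' _)))
    (by rw [e]; exact abs_tr_bdry X n) (cosh_halfLen_ne X h).symm ?_
  rw [e, e']
  have := trace_neg X h
  nlinarith [this]

/-- Lower bound for the distance of two lifts of the `n`-th cuff through the `n`-th pair of
pants. -/
def pantsHeight (n : ℕ) : ℝ :=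
  Real.log ((Real.cosh (halfLen X n) + Real.cosh (halfLen X (n + 1))) / Real.sinh (halfLen X n))

lemma log_pos_of {A B : ℝ} (hA : 0 < A) :
    0 < Real.log ((Real.cosh A + Real.cosh B) / Real.sinh A) := by
  apply Real.log_pos
  rw [one_lt_div (Real.sinh_pos_iff.2 hA)]
  have := Real.sinh_lt_cosh A
  have := Real.cosh_pos B
  linarith

lemma pantsHeight_pos {n : ℕ} (hn : 1 ≤ n) : 0 < pantsHeight X n := log_pos_of (halfLen_pos X hn)

lemma pantsHeight_le_dist {n : ℕ} (hn : 1 ≤ n) (h : halfLen X n < halfLen X (n + 1))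
    {u : FreeGroup ℕ} (hu : u ∈ pantsGroup n) (hu' : u ∉ Subgroup.zpowers (bdry n)) {x y : ℍ}
    (hx : cuffFun X n x = 0) (hy : cuffFun X n y = 0) : pantsHeight X n ≤ dist x (X.hol u • y) := by
  obtain ⟨Φ, h1, h2⟩ := exists_frame X h
  exact line_separation X.hol (halfLen_pos X hn) Φ.toEquiv h2 h1 (abs_tr_bdry X n) hu hu' hx hy

/-- Only turns at the top of a path have to be long, so for the upper cuff mere positivity is
enough. -/
lemma dist_pos_of_notMem_zpowers_succ {n : ℕ} (h : halfLen X n < halfLen X (n + 1))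
    {u : FreeGroup ℕ} (hu : u ∈ pantsGroup n) (hu' : u ∉ Subgroup.zpowers (bdry (n + 1))) {x y : ℍ}
    (hx : cuffFun X (n + 1) x = 0) (hy : cuffFun X (n + 1) y = 0) : 0 < dist x (X.hol u • y) := by
  obtain ⟨Φ, h1, h2⟩ := exists_frame_swap X h
  rw [pantsGroup_eq] at hu
  exact (log_pos_of (halfLen_pos X (Nat.succ_pos n))).trans_le
    (line_separation X.hol (halfLen_pos X (Nat.succ_pos n)) Φ.toEquiv h2 h1
      (abs_tr_bdry X _) hu hu' hx hy)

/-- No element of the group of a pair of pants, except for powers of a cuff, maps a point of the lift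
of the cuff to this lift. -/
lemma cuffFun_smul_ne {n m : ℕ} (hm : m = n ∨ m = n + 1) (hm1 : 1 ≤ m)
    (h : halfLen X n < halfLen X (n + 1)) {u : FreeGroup ℕ} (hu : u ∈ pantsGroup n)
    (hu' : u ∉ Subgroup.zpowers (bdry m)) {x : ℍ} (hx : cuffFun X m x = 0) :
    cuffFun X m (X.hol u • x) ≠ 0 := by
  intro hc
  rcases hm with rfl | rfl
  · have := pantsHeight_le_dist X hm1 h hu hu' hc hx
    rw [dist_self] at this
    exact absurd (pantsHeight_pos X hm1) (not_lt.2 this)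
  · have := dist_pos_of_notMem_zpowers_succ X h hu hu' hc hx
    rw [dist_self] at this
    exact lt_irrefl _ this

lemma mul_smul' (g h : FreeGroup ℕ) (z : ℍ) : X.hol (g * h) • z = X.hol g • X.hol h • z := by
  rw [map_mul, mul_smul]

lemma inv_smul_smul' (g : FreeGroup ℕ) (z : ℍ) : X.hol g⁻¹ • X.hol g • z = z := by
  rw [map_inv, inv_smul_smul]

lemma smul_inv_smul' (g : FreeGroup ℕ) (z : ℍ) : X.hol g • X.hol g⁻¹ • z = z := by
  rw [map_inv, smul_inv_smul]

lemma cuffFun_bdry_smul (n : ℕ) {x : ℍ} (hx : cuffFun X n x = 0) :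
    cuffFun X n (X.hol (bdry n) • x) = 0 := by
  have h1 := four_cosh_sq (X.hol (bdry n)) x
  have h2 := four_cosh_sq (X.hol (bdry n)) (X.hol (bdry n) • x)
  rw [dist_smul, h1] at h2
  unfold cuffFun at hx ⊢
  rw [hx] at h2
  exact pow_eq_zero_iff two_ne_zero |>.1 (by linarith)

/-- Distinct boundary lines of a pair of pants. -/
lemma exists_cuffFun_ne {n m m' : ℕ} (hm : m = n ∨ m = n + 1) (hm1 : 1 ≤ m)
    (hm' : m' = n ∨ m' = n + 1) (hm1' : 1 ≤ m')
    (h : halfLen X n < halfLen X (n + 1)) {p : FreeGroup ℕ} (hp : p ∈ pantsGroup n)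
    (hp' : m = m' → p ∉ Subgroup.zpowers (bdry m)) :
    ∃ x, cuffFun X m' x = 0 ∧ cuffFun X m (X.hol p • x) ≠ 0 := by
  obtain ⟨x, hx⟩ := exists_cuffFun_eq_zero X hm1'
  by_cases e : m = m'
  · subst e
    exact ⟨x, hx, cuffFun_smul_ne X hm hm1 h hp (hp' rfl) hx⟩
  by_cases hc : cuffFun X m (X.hol p • x) = 0
  · refine ⟨X.hol (bdry m') • x, cuffFun_bdry_smul X m' hx, ?_⟩
    have hb : bdry m' ∈ pantsGroup n := by
      rcases hm' with rfl | rfl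
      exacts [bdry_mem _, bdry_succ_mem _]
    have := cuffFun_smul_ne X hm hm1 h (u := p * bdry m' * p⁻¹)
      (mul_mem (mul_mem hp hb) (inv_mem hp)) ?_ hc
    · rwa [mul_smul', mul_smul', inv_smul_smul'] at this
    · rcases hm with rfl | rfl <;> rcases hm' with rfl | rfl
      · exact absurd rfl e
      · exact conj_bdry_succ_notMem _ _
      · exact conj_bdry_notMem _ _
      · exact absurd rfl e
  · exact ⟨x, hx, hc⟩

end Surface

theorem exists_lift_eq {g : SL(2, ℝ)} (h : 0 < transLength g) {γ : ℝ → ℍ} (i : Isometry γ)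
    (t : ∀ s, g • γ s = γ (s + transLength g)) {z : ℍ} (hz : axisFun g (vec z) = 0) :
    ∃ s, γ s = z := by
  obtain ⟨Φ, hax, hlift⟩ := exists_axis_coordinates h
  obtain ⟨θ, hθ⟩ := hlift γ i t
  refine ⟨Real.log (Φ.toEquiv z).im - θ, ?_⟩
  apply Φ.toEquiv.injective
  apply UpperHalfPlane.ext
  apply Complex.ext
  · have h1 := (hax z).1 hz
    refine Eq.trans ?_ h1.symm
    apply (hax _).1
    rw [← mem_axisOf_iff (two_lt_abs_tr h).le]
    change dist _ _ = transLength g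
    rw [t, i.dist_eq, Real.dist_eq, abs_sub_comm, add_sub_cancel_left, abs_of_pos h]
  · have := hθ (Real.log (Φ.toEquiv z).im - θ)
    rw [add_sub_cancel, Real.exp_log (Φ.toEquiv z).im_pos] at this
    exact this

section Surface

variable (X : TightFlute)

/-- The sign orients the cuff upwards, from P n to P (n + 1): each convex region is on one side of
the line, and regions that do not overlap are on opposite sides. -/
theorem exists_side (n : ℕ) : ∃ σ : ℝ, σ ≠ 0 ∧
    (∀ z ∈ X.region (n + 1), 0 ≤ σ * cuffFun X (n + 1) z) ∧
      ∀ z ∈ X.region n, σ * cuffFun X (n + 1) z ≤ 0 := by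
  obtain ⟨r, hr⟩ := X.region_interior (n + 1)
  obtain ⟨m, hm⟩ := exists_cuffFun_eq_zero X (Nat.succ_pos n)
  have h1 := one_sided (X.region_closed (n + 1)) (X.region_convex (n + 1)) hm
    (fun z hz => mem_frontier X (Or.inl rfl) hz) hr
  refine ⟨cuffFun X (n + 1) r, h1.1, h1.2, fun z hz => ?_⟩
  have h2 := opposite_sides (X.region_convex n) (X.region_convex (n + 1)) (fun z hz hz' => ?_) hm
    (fun z hz => frontier_subset_region X n (mem_frontier X (Or.inr rfl) hz))
    (fun z hz => frontier_subset_region X (n + 1) (mem_frontier X (Or.inl rfl) hz)) hz hr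
  · rw [mul_comm]
    exact h2
  · have := X.region_disjoint n (n + 1) 1 ⟨z, ⟨z, hz, by simp⟩, hz'⟩
    omega

/-! ### Intertwining isometries and their mismatch at a cuff. -/

variable {X} {Y : TightFlute}

/-- `A` intertwines the actions on the universal coverings of the `n`-th pairs of pants. -/
def Intertwines (X Y : TightFlute) (n : ℕ) (A : ℍ ≃ᵢ ℍ) : Prop :=
  ∀ g ∈ pantsGroup n, ∀ z, A (X.hol g • z) = Y.hol g • A z

/-- Both groups have the same normal form, and A is the quotient of the two coordinate changes. It
may reverse the orientation of the plane; this is harmless, since only distances and the directions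
of the cuffs enter below. -/
theorem exists_intertwines (hXY : ∀ n, halfLen X n = halfLen Y n) {n : ℕ}
    (h : halfLen X n < halfLen X (n + 1)) : ∃ A, Intertwines X Y n A := by
  obtain ⟨Φ, h1, h2⟩ := exists_frame X h
  obtain ⟨Ψ, h3, h4⟩ := exists_frame Y (by rwa [← hXY, ← hXY])
  refine ⟨Φ.toEquiv.trans Ψ.toEquiv.symm, fun g hg => ?_⟩
  rw [pantsGroup] at hg
  induction hg using Subgroup.closure_induction with
  | mem x hx =>
    intro z
    apply Ψ.toEquiv.injective
    rcases hx with rfl | rfl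
    · rw [h4]
      simp only [IsometryEquiv.trans_apply, IsometryEquiv.apply_symm_apply]
      rw [h2, hXY, hXY]
    · rw [h3]
      simp only [IsometryEquiv.trans_apply, IsometryEquiv.apply_symm_apply]
      rw [h1]
  | one => intro z; simp
  | mul x y _ _ hx hy =>
    intro z
    rw [mul_smul', hx, hy, mul_smul']
  | inv x _ hx =>
    intro z
    have := hx (X.hol x⁻¹ • z)
    rw [smul_inv_smul'] at this
    rw [this, inv_smul_smul']

theorem lift_comp {m : ℕ} {A : ℍ ≃ᵢ ℍ} (hXY : ∀ n, halfLen X n = halfLen Y n)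
    {g : FreeGroup ℕ} (hg : g ∈ pantsGroup m) (hb : ∃ k, g = bdry k)
    (hA : Intertwines X Y m A) {γ : ℝ → ℍ} (hγ : X.IsLift g γ) :
    Isometry (A ∘ γ) ∧ ∀ s, Y.hol g • (A ∘ γ) s = (A ∘ γ) (s + transLength (Y.hol g)) := by
  refine ⟨A.isometry.comp hγ.2.1, fun s => ?_⟩
  obtain ⟨k, rfl⟩ := hb
  have e : transLength (X.hol (bdry k)) = transLength (Y.hol (bdry k)) := by
    have := hXY k
    unfold halfLen TightFlute.cuffLength TightFlute.length at this
    linarith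
  rw [← e, Function.comp_apply, Function.comp_apply, ← hA _ hg, hγ.2.2 s]
  rfl

theorem isFoot_comp {m : ℕ} {A : ℍ ≃ᵢ ℍ} {g : FreeGroup ℕ} (hg : g ∈ pantsGroup m)
    (hA : Intertwines X Y m A) {γ : ℝ → ℍ} {t : ℝ} (hγ : X.IsFoot g γ t) (s : ℝ) :
    dist ((A ∘ γ) t) (Y.hol g • (A ∘ γ) t) ≤ dist ((A ∘ γ) s) (Y.hol g • (A ∘ γ) s) := by
  simp only [Function.comp_apply, ← hA g hg, A.dist_eq]
  exact hγ s

theorem bdry_notMem_zpowers (n : ℕ) : bdry n ∉ Subgroup.zpowers (bdry (n + 1)) := by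
  simpa using conj_bdry_notMem 1 n

theorem bdry_succ_notMem_zpowers (n : ℕ) : bdry (n + 1) ∉ Subgroup.zpowers (bdry n) := by
  simpa using conj_bdry_succ_notMem 1 n

/-- The two intertwiners at a cuff differ by the difference of the twists. -/
theorem dist_intertwiners (hXY : ∀ n, halfLen X n = halfLen Y n)
    (hX : ∀ n, halfLen X n < halfLen X (n + 1)) {n : ℕ} {t t' : ℝ} (ht : X.HasTwist (n + 1) t)
    (ht' : Y.HasTwist (n + 1) t') {A A' : ℍ ≃ᵢ ℍ} (hA : Intertwines X Y n A)
    (hA' : Intertwines X Y (n + 1) A') {p : ℍ} (hp : cuffFun X (n + 1) p = 0) :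
    dist (A p) (A' p) = |t - t'| := by
  have hY : ∀ n, halfLen Y n < halfLen Y (n + 1) := fun n => by
    rw [← hXY, ← hXY]; exact hX n
  obtain ⟨γ, hγ, hf, hf'⟩ := ht
  obtain ⟨η, hη, hg, hg'⟩ := ht'
  rw [Nat.add_sub_cancel] at hf hg
  obtain ⟨i1, l1⟩ := lift_comp hXY (bdry_succ_mem n) ⟨_, rfl⟩ hA hγ
  obtain ⟨i2, l2⟩ := lift_comp hXY (bdry_mem (n + 1)) ⟨_, rfl⟩ hA' hγ
  -- A matches the feet of the perpendiculars that come from below, at parameters 0 and 0; A'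
  -- matches those from above, at t and t'. So A sends γ s to η s, and A' sends it to η (s + t' -
  -- t).
  have e1 := lift_unique hη.1 (fun z hz => cuffFun_smul_ne Y (Or.inr rfl) (Nat.succ_pos n) (hY n)
    (bdry_mem n) (bdry_notMem_zpowers n) hz) i1 hη.2.1 l1 hη.2.2 (isFoot_comp (bdry_mem n) hA hf) hg
  have e2 := lift_unique hη.1 (fun z hz => cuffFun_smul_ne Y (Or.inl rfl) (Nat.succ_pos n)
    (hY (n + 1)) (bdry_succ_mem (n + 1)) (bdry_succ_notMem_zpowers (n + 1)) hz) i2 hη.2.1 l2 hη.2.2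
    (isFoot_comp (bdry_succ_mem (n + 1)) hA' hf') hg'
  obtain ⟨s, rfl⟩ := exists_lift_eq hγ.1 hγ.2.1 hγ.2.2 hp
  have h1 := e1 s
  have h2 := e2 (s - t)
  simp only [Function.comp_apply, zero_add, add_sub_cancel] at h1 h2
  rw [← h1, ← h2, hη.2.1.dist_eq, Real.dist_eq]
  congr 1
  ring

end Surface

/-! ### Reduced paths in the dual tree. -/

/-- The oriented edges at the ends of the reduced paths that start at the base vertex of the dual tree.
The edge `w, j` is the lift of the cuff `j + 1` between the `w`-translates of the regions `j` and
`j + 1`; it is crossed upwards, from `j` to `j + 1`, if the last entry is `true`. -/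
inductive Reduced : FreeGroup ℕ → ℕ → Bool → Prop
  | start {p : FreeGroup ℕ} (hp : p ∈ pantsGroup 0) : Reduced p 0 true
  | up_up {w p : FreeGroup ℕ} {j : ℕ} (h : Reduced w j true) (hp : p ∈ pantsGroup (j + 1)) :
      Reduced (w * p) (j + 1) true
  | up_down {w p : FreeGroup ℕ} {j : ℕ} (h : Reduced w j true) (hp : p ∈ pantsGroup (j + 1))
      (hp' : p ∉ Subgroup.zpowers (bdry (j + 1))) : Reduced (w * p) j false
  | down_down {w p : FreeGroup ℕ} {j : ℕ} (h : Reduced w (j + 1) false)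
      (hp : p ∈ pantsGroup (j + 1)) : Reduced (w * p) j false
  | down_up {w p : FreeGroup ℕ} {j : ℕ} (h : Reduced w j false) (hp : p ∈ pantsGroup j)
      (hp' : p ∉ Subgroup.zpowers (bdry (j + 1))) : Reduced (w * p) j true

/-- The `u`-translate of the region `n` is reached by a reduced path. -/
def Reached (u : FreeGroup ℕ) (n : ℕ) : Prop :=
  (n = 0 ∧ u ∈ pantsGroup 0) ∨
    (∃ w j p, Reduced w j true ∧ n = j + 1 ∧ p ∈ pantsGroup n ∧ u = w * p) ∨
      ∃ w p, Reduced w n false ∧ p ∈ pantsGroup n ∧ u = w * p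

theorem Reached.mul {u p : FreeGroup ℕ} {n : ℕ} (h : Reached u n) (hp : p ∈ pantsGroup n) :
    Reached (u * p) n := by
  rcases h with ⟨rfl, hu⟩ | ⟨w, j, q, hw, rfl, hq, rfl⟩ | ⟨w, q, hw, hq, rfl⟩
  · exact Or.inl ⟨rfl, mul_mem hu hp⟩
  · exact Or.inr (Or.inl ⟨w, j, q * p, hw, rfl, mul_mem hq hp, mul_assoc _ _ _⟩)
  · exact Or.inr (Or.inr ⟨w, q * p, hw, mul_mem hq hp, mul_assoc _ _ _⟩)

/-- Leaving through the edge just crossed would be a backtrack. In that case q is a power of the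
common cuff, belongs to both adjacent pants groups, and is absorbed into the preceding step of the
path. -/
theorem Reached.succ {u : FreeGroup ℕ} {n : ℕ} (h : Reached u n) : Reached u (n + 1) := by
  rcases h with ⟨rfl, hu⟩ | ⟨w, j, q, hw, rfl, hq, rfl⟩ | ⟨w, q, hw, hq, rfl⟩
  · exact Or.inr (Or.inl ⟨u, 0, 1, .start hu, rfl, one_mem _, (mul_one _).symm⟩)
  · exact Or.inr (Or.inl ⟨_, _, 1, .up_up hw hq, rfl, one_mem _, (mul_one _).symm⟩)
  · by_cases hq' : q ∈ Subgroup.zpowers (bdry (n + 1))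
    · have hq1 : q ∈ pantsGroup (n + 1) := (Subgroup.zpowers_le.2 (bdry_mem _)) hq'
      cases hw with
      | up_down h hp _ =>
        exact Or.inr (Or.inl ⟨_, _, _, h, rfl, mul_mem hp hq1, mul_assoc _ _ _⟩)
      | down_down h hp => exact Or.inr (Or.inr ⟨_, _, h, mul_mem hp hq1, mul_assoc _ _ _⟩)
    · exact Or.inr (Or.inl ⟨_, _, 1, .down_up hw hq hq', rfl, one_mem _, (mul_one _).symm⟩)

theorem Reached.pred {u : FreeGroup ℕ} {n : ℕ} (h : Reached u (n + 1)) : Reached u n := by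
  rcases h with ⟨h, -⟩ | ⟨w, j, q, hw, hj, hq, rfl⟩ | ⟨w, q, hw, hq, rfl⟩
  · omega
  · obtain rfl : n = j := by omega
    by_cases hq' : q ∈ Subgroup.zpowers (bdry (n + 1))
    · have hq1 : q ∈ pantsGroup n := (Subgroup.zpowers_le.2 (bdry_succ_mem _)) hq'
      cases hw with
      | start hp => exact Or.inl ⟨rfl, mul_mem hp hq1⟩
      | up_up h hp => exact Or.inr (Or.inl ⟨_, _, _, h, rfl, mul_mem hp hq1, mul_assoc _ _ _⟩)
      | down_up h hp _ => exact Or.inr (Or.inr ⟨_, _, h, mul_mem hp hq1, mul_assoc _ _ _⟩)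
    · exact Or.inr (Or.inr ⟨_, 1, .up_down hw hq hq', one_mem _, (mul_one _).symm⟩)
  · exact Or.inr (Or.inr ⟨_, 1, .down_down hw hq, one_mem _, (mul_one _).symm⟩)

theorem reached_iff_zero (u : FreeGroup ℕ) (n : ℕ) : Reached u n ↔ Reached u 0 := by
  induction n with
  | zero => rfl
  | succ n ih => exact ⟨fun h => ih.1 h.pred, fun h => (ih.2 h).succ⟩

/-- The generator n + 1 stabilizes the region n, so the path climbs from level 0 to level n,
multiplies there and comes back. -/
theorem Reached.mul_generator {u : FreeGroup ℕ} (h : Reached u 0) (i : ℕ) :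
    Reached (u * FreeGroup.of i) 0 ∧ Reached (u * (FreeGroup.of i)⁻¹) 0 := by
  cases i with
  | zero => exact ⟨h.mul (bdry_mem 0), h.mul (inv_mem (bdry_mem 0))⟩
  | succ n =>
    rw [← reached_iff_zero _ n] at h
    rw [← reached_iff_zero _ n, ← reached_iff_zero _ n]
    exact ⟨h.mul (of_mem n), h.mul (inv_mem (of_mem n))⟩

theorem reached_zero (g : FreeGroup ℕ) : Reached g 0 := by
  suffices ∀ u, Reached u 0 → Reached (u * g) 0 by
    simpa using this 1 (Or.inl ⟨rfl, one_mem _⟩)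
  induction g using FreeGroup.induction_on with
  | C1 => intro u hu; rwa [mul_one]
  | of i => exact fun u hu => (hu.mul_generator i).1
  | inv_of i _ => exact fun u hu => (hu.mul_generator i).2
  | mul x y hx hy =>
    intro u hu
    rw [← mul_assoc]
    exact hy _ (hx _ hu)

/-! ### Comparison of displacements and lengths. -/

section Comparison

variable {X Y : TightFlute}

theorem isLinearFun_cuffFun (X : TightFlute) (s : ℝ) (m : ℕ) (p : FreeGroup ℕ) :
    IsLinearFun fun z => s * cuffFun X m (X.hol p • z) :=
  isLinearFun_axisFun s (X.hol (bdry m)) (X.hol p)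

/-- Crossing the `w`-translate of the cuff `m` in order to enter the region `n`, in a comparison of
distances from `x₀` in `X` with distances from `y₀` in `Y`. -/
structure Enters (X Y : TightFlute) (x₀ y₀ : ℍ) (ε : ℝ) (w : FreeGroup ℕ) (m n : ℕ) (s : ℝ)
    (A : ℍ ≃ᵢ ℍ) (K : ℝ) : Prop where
  mem : m = n ∨ m = n + 1
  pos : 1 ≤ m
  ne : s ≠ 0
  base : s * cuffFun X m (X.hol w⁻¹ • x₀) ≤ 0
  side : ∀ z ∈ X.region n, 0 ≤ s * cuffFun X m z
  dist_le : ∀ q, cuffFun X m q = 0 →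
    dist y₀ (Y.hol w • A q) ≤ (1 + ε) * dist x₀ (X.hol w • q) + K

/-- The segment from x₀ crosses the line at some q, where distances add up. The part beyond q is
copied isometrically by A, so a gain of ε times its length is left over. -/
theorem Enters.exists_dist_le {x₀ y₀ : ℍ} {ε : ℝ} {w : FreeGroup ℕ} {m n : ℕ} {s K : ℝ}
    {A : ℍ ≃ᵢ ℍ} (h : Enters X Y x₀ y₀ ε w m n s A K) (hA : Intertwines X Y n A) {p : FreeGroup ℕ}
    (hp : p ∈ pantsGroup n) {r : ℍ} (hr : r ∈ X.region n) :
    ∃ q, cuffFun X m q = 0 ∧ dist y₀ (Y.hol (w * p) • A r) ≤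
      (1 + ε) * dist x₀ (X.hol (w * p) • r) + K - ε * dist q (X.hol p • r) := by
  have hlin := isLinearFun_cuffFun X s m 1
  obtain ⟨q, -, -, -, -, -, -, -, hq, hd⟩ := exists_crossing hlin (x := X.hol w⁻¹ • x₀)
    (y := X.hol p • r) (by simpa using h.base)
    (by simpa using h.side _ (smul_mem_region X hp hr))
  have hq' : cuffFun X m q = 0 := by
    simpa [h.ne] using hq
  refine ⟨q, hq', ?_⟩
  have e1 : dist (X.hol w⁻¹ • x₀) q = dist x₀ (X.hol w • q) := by
    rw [← dist_smul (X.hol w), smul_inv_smul']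
  have e2 : dist (X.hol w⁻¹ • x₀) (X.hol p • r) = dist x₀ (X.hol (w * p) • r) := by
    rw [← dist_smul (X.hol w), smul_inv_smul', mul_smul']
  have e3 : dist (Y.hol w • A q) (Y.hol (w * p) • A r) = dist q (X.hol p • r) := by
    rw [mul_smul', dist_smul, ← hA p hp, A.dist_eq]
  have h1 := h.dist_le q hq'
  have h2 := dist_triangle y₀ (Y.hol w • A q) (Y.hol (w * p) • A r)
  rw [e1, e2] at hd
  rw [e3] at h2
  rw [← hd]
  linarith

/-- One step of the path: x₀ stays beyond the new line by `nonpos_of_nonpos`. The constant K changes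
by the jump δ from A to A', less ε times a lower bound d for the length of the piece between the two
lines. -/
theorem Enters.next (hX : ∀ n, halfLen X n < halfLen X (n + 1)) {x₀ y₀ : ℍ} {ε : ℝ} (hε : 0 ≤ ε)
    {w : FreeGroup ℕ} {m n : ℕ} {s K : ℝ}
    {A : ℍ ≃ᵢ ℍ} (h : Enters X Y x₀ y₀ ε w m n s A K) (hA : Intertwines X Y n A) {p : FreeGroup ℕ}
    (hp : p ∈ pantsGroup n) {m' n' : ℕ} {s' : ℝ} {A' : ℍ ≃ᵢ ℍ} {K' δ d : ℝ}
    (hp' : m = m' → p ∉ Subgroup.zpowers (bdry m))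
    (hmn : m' = n ∨ m' = n + 1) (hmn' : m' = n' ∨ m' = n' + 1) (hm' : 1 ≤ m') (hs' : s' ≠ 0)
    (hside : ∀ z ∈ X.region n', 0 ≤ s' * cuffFun X m' z)
    (hside' : ∀ z ∈ X.region n, s' * cuffFun X m' z ≤ 0)
    (hδ : ∀ r, cuffFun X m' r = 0 → dist (A r) (A' r) = δ)
    (hd : ∀ q r, cuffFun X m q = 0 → cuffFun X m' r = 0 → d ≤ dist q (X.hol p • r))
    (hK : K - ε * d + δ ≤ K') : Enters X Y x₀ y₀ ε (w * p) m' n' s' A' K' := by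
  refine ⟨hmn', hm', hs', ?_, hside, fun r hr => ?_⟩
  · have l1 := isLinearFun_cuffFun X s m 1
    have l2 := isLinearFun_cuffFun X s' m' p⁻¹
    have := nonpos_of_nonpos (R := X.region n) l1 l2 (fun z hz => by simpa using h.side z hz)
      (fun z hz => hside' _ (smul_mem_region X (inv_mem hp) hz))
      (fun z hz => frontier_subset_region X n (mem_frontier X h.mem (by simpa [h.ne] using hz)))
      (fun z hz => ?_) ?_ (w := X.hol w⁻¹ • x₀) (by simpa using h.base)
    · rw [mul_inv_rev, mul_smul']
      exact this
    · have hz' : cuffFun X m' (X.hol p⁻¹ • z) = 0 := by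
        simpa only [mul_eq_zero, hs', false_or] using hz
      have := smul_mem_region_of_cuff X hmn hp hz'
      rwa [smul_inv_smul'] at this
    · obtain ⟨x, hx, hx'⟩ := exists_cuffFun_ne X h.mem h.pos hmn hm' (hX n) hp hp'
      refine ⟨X.hol p • x, ?_, ?_⟩
      · rw [inv_smul_smul']
        exact mul_eq_zero_of_right _ hx
      · simpa using ⟨h.ne, hx'⟩
  · obtain ⟨q, hq, h1⟩ := h.exists_dist_le hA hp
      (frontier_subset_region X n (mem_frontier X hmn hr))
    have h2 := mul_le_mul_of_nonneg_left (hd q r hq hr) hε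
    have h3 := dist_triangle y₀ (Y.hol (w * p) • A r) (Y.hol (w * p) • A' r)
    rw [dist_smul, hδ r hr] at h3
    linarith

theorem displacement_le (hXY : ∀ n, halfLen X n = halfLen Y n)
    (hX : ∀ n, halfLen X n < halfLen X (n + 1)) {t t' : ℕ → ℝ}
    (ht : ∀ n, 1 ≤ n → X.HasTwist n (t n)) (ht' : ∀ n, 1 ≤ n → Y.HasTwist n (t' n)) {ε : ℝ}
    (hε : 0 ≤ ε)
    (hδ : ∀ n, 1 ≤ n → 2 * ∑ i ∈ Finset.Icc 1 n, |t i - t' i| ≤ ε * pantsHeight X n) :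
    ∃ x₀ y₀ : ℍ, ∀ g : FreeGroup ℕ,
      dist y₀ (Y.hol g • y₀) ≤ (1 + ε) * dist x₀ (X.hol g • x₀) := by
  choose A hA using fun n => exists_intertwines hXY (hX n)
  choose σ hσ hσ₁ hσ₂ using exists_side X
  obtain ⟨x₀, hx₀⟩ := X.region_interior 0
  replace hx₀ := interior_subset hx₀
  set Δ : ℕ → ℝ := fun n => ∑ i ∈ Finset.Icc 1 n, |t i - t' i| with hΔ
  have hΔs : ∀ n, Δ (n + 1) = Δ n + |t (n + 1) - t' (n + 1)| := fun n =>
    Finset.sum_Icc_succ_top (Nat.succ_pos n) _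
  have hΔ0 : Δ 0 = 0 := by simp [hΔ]
  have hcross : ∀ n r, cuffFun X (n + 1) r = 0 →
      dist (A n r) (A (n + 1) r) = |t (n + 1) - t' (n + 1)| := fun n r hr =>
    dist_intertwiners hXY hX (ht _ n.succ_pos) (ht' _ n.succ_pos) (hA n) (hA (n + 1)) hr
  have hcross' : ∀ n r, cuffFun X (n + 1) r = 0 →
      dist (A (n + 1) r) (A n r) = |t (n + 1) - t' (n + 1)| := fun n r hr => by
    rw [dist_comm]
    exact hcross n r hr
  have hneg₁ : ∀ n, ∀ z ∈ X.region n, 0 ≤ -σ n * cuffFun X (n + 1) z := fun n z hz => by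
    linarith [hσ₂ n z hz]
  have hneg₂ : ∀ n, ∀ z ∈ X.region (n + 1), -σ n * cuffFun X (n + 1) z ≤ 0 := fun n z hz => by
    linarith [hσ₁ n z hz]
  -- The constant is a debt of Δ (j + 1) after going up through the cuff j + 1, and a credit of Δ j,
  -- enough for the rest of the descent, after going down through it.
  have key : ∀ w j b, Reduced w j b →
      (b = true → Enters X Y x₀ (A 0 x₀) ε w (j + 1) (j + 1) (σ j) (A (j + 1)) (Δ (j + 1))) ∧
      (b = false → Enters X Y x₀ (A 0 x₀) ε w (j + 1) j (-σ j) (A j) (-Δ j)) := by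
    intro w j b h
    induction h with
    | @start p hp =>
      refine ⟨fun _ => ⟨Or.inl rfl, le_rfl, hσ 0, ?_, hσ₁ 0, fun q hq => ?_⟩, by simp⟩
      · exact hσ₂ 0 _ (smul_mem_region X (inv_mem hp) hx₀)
      · have h1 := dist_triangle (A 0 x₀) (Y.hol p • A 0 q) (Y.hol p • A 1 q)
        rw [dist_smul, hcross 0 q hq, ← hA 0 p hp, (A 0).dist_eq] at h1
        have h2 := mul_nonneg hε (dist_nonneg (x := x₀) (y := X.hol p • q))
        rw [hΔs, hΔ0]
        linarith
    | @up_up w p j h hp ih =>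
      refine ⟨fun _ => ?_, by simp⟩
      refine (ih.1 rfl).next hX hε (hA _) hp (fun e => by omega) (Or.inr rfl) (Or.inl rfl)
        (Nat.succ_pos _) (hσ _) (hσ₁ _) (hσ₂ _) (hcross (j + 1)) (d := 0)
        (fun _ _ _ _ => dist_nonneg) ?_
      rw [hΔs (j + 1)]
      linarith
    | @up_down w p j h hp hp' ih =>
      refine ⟨by simp, fun _ => ?_⟩
      refine (ih.1 rfl).next hX hε (hA _) hp (fun _ => hp') (Or.inl rfl) (Or.inr rfl)
        (Nat.succ_pos _) (neg_ne_zero.2 (hσ j)) (hneg₁ j) (hneg₂ j) (hcross' j)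
        (fun q r hq hr => pantsHeight_le_dist X (Nat.succ_pos j) (hX _) hp hp' hq hr) ?_
      -- The turn from up to down is the only place where length is spent: Δ (j + 1) + δ (j + 1) + Δ
      -- j = 2 Δ (j + 1), where δ is the jump at the cuff, must be at most ε times the height.
      have := hδ (j + 1) (Nat.succ_pos j)
      have := hΔs j
      have : Δ (j + 1) = ∑ i ∈ Finset.Icc 1 (j + 1), |t i - t' i| := rfl
      linarith
    | @down_down w p j h hp ih =>
      refine ⟨by simp, fun _ => ?_⟩
      refine (ih.2 rfl).next hX hε (hA _) hp (fun e => by omega) (Or.inl rfl) (Or.inr rfl)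
        (Nat.succ_pos _) (neg_ne_zero.2 (hσ j)) (hneg₁ j) (hneg₂ j) (hcross' j) (d := 0)
        (fun _ _ _ _ => dist_nonneg) ?_
      rw [hΔs j]
      linarith
    | @down_up w p j h hp hp' ih =>
      refine ⟨fun _ => ?_, by simp⟩
      refine (ih.2 rfl).next hX hε (hA _) hp (fun _ => hp') (Or.inr rfl) (Or.inl rfl)
        (Nat.succ_pos _) (hσ _) (hσ₁ _) (hσ₂ _) (hcross j) (d := 0)
        (fun _ _ _ _ => dist_nonneg) ?_
      have : 0 ≤ Δ j := Finset.sum_nonneg fun _ _ => abs_nonneg _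
      rw [hΔs j]
      linarith
  refine ⟨x₀, A 0 x₀, fun g => ?_⟩
  rcases reached_zero g with ⟨-, hg⟩ | ⟨w, j, q, -, h, -⟩ | ⟨w, p, hw, hp, rfl⟩
  · rw [← hA 0 g hg, (A 0).dist_eq]
    have h2 := mul_nonneg hε (dist_nonneg (x := x₀) (y := X.hol g • x₀))
    linarith
  · omega
  · obtain ⟨q, -, h⟩ := ((key _ _ _ hw).2 rfl).exists_dist_le (hA 0) hp hx₀
    have h2 := mul_nonneg hε (dist_nonneg (x := q) (y := X.hol p • x₀))
    rw [hΔ0] at h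
    linarith

theorem length_le (hXY : ∀ n, halfLen X n = halfLen Y n)
    (hX : ∀ n, halfLen X n < halfLen X (n + 1)) {t t' : ℕ → ℝ}
    (ht : ∀ n, 1 ≤ n → X.HasTwist n (t n)) (ht' : ∀ n, 1 ≤ n → Y.HasTwist n (t' n)) {ε : ℝ}
    (hε : 0 ≤ ε)
    (hδ : ∀ n, 1 ≤ n → 2 * ∑ i ∈ Finset.Icc 1 n, |t i - t' i| ≤ ε * pantsHeight X n)
    (g : FreeGroup ℕ) : Y.length g ≤ (1 + ε) * X.length g := by
  obtain ⟨x₀, y₀, h⟩ := displacement_le hXY hX ht ht' hε hδ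
  by_cases hg : g = 1
  · subst hg
    have h1 := transLength_nonneg (X.hol 1)
    have h2 := transLength_le (Y.hol 1) y₀
    simp only [map_one, one_smul, dist_self] at h1 h2
    have := mul_nonneg hε h1
    unfold TightFlute.length
    rw [map_one, map_one]
    linarith
  -- The base points do not depend on the group element, so the bound applies to all powers of g.
  · refine transLength_le_mul (two_le_abs_tr Y hg) (by linarith) x₀ y₀ fun k => ?_
    have := h (g ^ k)
    rwa [map_pow, map_pow] at this

end Comparison

/-! ### Estimates for rapidly increasing lengths. -/

theorem half_sub_le_pantsHeight (X : TightFlute) {n : ℕ} (hn : 1 ≤ n) :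
    halfLen X (n + 1) - halfLen X n ≤ pantsHeight X n := by
  have hA := halfLen_pos X hn
  have hs := Real.sinh_pos_iff.2 hA
  rw [pantsHeight, Real.le_log_iff_exp_le (div_pos (by positivity) hs), le_div_iff₀ hs]
  generalize halfLen X n = A at *
  generalize halfLen X (n + 1) = B
  -- The estimate rests on exp (B - A) sinh A < exp B / 2 < cosh B.
  have h1 : Real.exp (B - A) * Real.sinh A = (Real.exp B - Real.exp (B - A) * Real.exp (-A)) / 2 := by
    rw [Real.sinh_eq, Real.exp_sub, Real.exp_neg]
    field_simp
  have h2 : 0 < Real.exp (B - A) * Real.exp (-A) := by positivity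
  have h3 := Real.cosh_pos A
  have h4 := Real.exp_pos (-B)
  rw [h1, Real.cosh_eq B]
  linarith

theorem abs_log_div_le {a b ε : ℝ} (ha : 0 < a) (hb : 0 < b) (hε : 0 ≤ ε) (h1 : a ≤ (1 + ε) * b)
    (h2 : b ≤ (1 + ε) * a) : |Real.log (a / b)| ≤ ε := by
  have h0 : (0 : ℝ) < 1 + ε := by linarith
  have h3 := Real.log_le_log ha h1
  have h4 := Real.log_le_log hb h2
  rw [Real.log_mul h0.ne' hb.ne'] at h3
  rw [Real.log_mul h0.ne' ha.ne'] at h4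
  have h5 := Real.log_le_sub_one_of_pos h0
  rw [Real.log_div ha.ne' hb.ne', abs_le]
  constructor <;> linarith

theorem lsDist_le {X₀ X : TightFlute} {ε : ℝ} (hε : 0 ≤ ε)
    (h1 : ∀ g, X.length g ≤ (1 + ε) * X₀.length g) (h2 : ∀ g, X₀.length g ≤ (1 + ε) * X.length g) :
    (∀ g, X₀.IsSimpleClosedGeodesic g → 0 < X.length g) ∧
      TightFlute.lsDist X₀ X X₀ ≤ ENNReal.ofReal (1 / 2 * ε) := by
  have hpos : ∀ g, X₀.IsSimpleClosedGeodesic g → 0 < X₀.length g := by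
    rintro g ⟨γ, hγ, -⟩
    exact hγ.1
  have hpos' : ∀ g, X₀.IsSimpleClosedGeodesic g → 0 < X.length g := fun g hg =>
    (pos_iff_pos_of_mul_pos ((hpos g hg).trans_le (h2 g))).1 (by linarith)
  refine ⟨hpos', iSup₂_le fun g hg => ENNReal.ofReal_le_ofReal ?_⟩
  have := abs_log_div_le (hpos' g hg) (hpos g hg) hε (h1 g) (h2 g)
  linarith

/-- Twist deviations of the order of rapidly increasing lengths are eventually small compared with
the heights of the pairs of pants. -/
theorem exists_sum_le {l : ℕ → ℝ} (hl : RapidlyIncreasing l) (hpos : ∀ n, 1 ≤ n → 0 < l n)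
    {C ε : ℝ} (hε : 0 < ε) : ∃ N, ∀ δ : ℕ → ℝ, (∀ n, 1 ≤ n → δ n ≤ C * l n) → ∀ n, N ≤ n → 1 ≤ n →
      2 * ∑ i ∈ Finset.Icc 1 n, δ i ≤ ε * ((l (n + 1) - l n) / 2) := by
  -- The bound 1/2 gives l n ≤ l (n + 1) / 2, hence (l (n + 1) - l n) / 2 ≥ l (n + 1) / 4. The other
  -- bound makes 2 (|C| + 1) c at most ε / 4.
  set c := min (1 / 2) (ε / (8 * (|C| + 1))) with hc
  have hC : 0 < |C| + 1 := by positivity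
  have hc0 : 0 < c := lt_min (by norm_num) (by positivity)
  obtain ⟨N, hN⟩ := Filter.eventually_atTop.1 (hl.2.2.def hc0)
  refine ⟨N, fun δ hδ n hn hn1 => ?_⟩
  have h1 := hN n hn
  have hl1 := hpos (n + 1) n.succ_pos
  have hsum : 0 ≤ ∑ i ∈ Finset.Icc 1 n, l i :=
    Finset.sum_nonneg fun i hi => (hpos i (Finset.mem_Icc.1 hi).1).le
  rw [Real.norm_of_nonneg hsum, Real.norm_of_nonneg hl1.le] at h1
  have h2 : l n ≤ ∑ i ∈ Finset.Icc 1 n, l i :=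
    Finset.single_le_sum (fun i hi => (hpos i (Finset.mem_Icc.1 hi).1).le)
      (Finset.mem_Icc.2 ⟨hn1, le_rfl⟩)
  have h3 : ∑ i ∈ Finset.Icc 1 n, δ i ≤ (|C| + 1) * ∑ i ∈ Finset.Icc 1 n, l i := by
    rw [Finset.mul_sum]
    refine Finset.sum_le_sum fun i hi => (hδ i (Finset.mem_Icc.1 hi).1).trans ?_
    exact mul_le_mul_of_nonneg_right ((le_abs_self C).trans (by linarith))
      (hpos i (Finset.mem_Icc.1 hi).1).le
  have h4 : c * l (n + 1) ≤ 1 / 2 * l (n + 1) := mul_le_mul_of_nonneg_right (min_le_left _ _) hl1.le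
  have h5 : (|C| + 1) * c ≤ ε / 8 := by
    refine (mul_le_mul_of_nonneg_left (min_le_right _ _) hC.le).trans (le_of_eq ?_)
    field_simp
  have h6 := mul_le_mul_of_nonneg_left h1 hC.le
  have h7 := mul_le_mul_of_nonneg_right h5 hl1.le
  have h8 : ε * (l (n + 1) / 4) ≤ ε * ((l (n + 1) - l n) / 2) :=
    mul_le_mul_of_nonneg_left (by linarith) hε.le
  linarith

end Hyp

end

open Hyp

theorem theorem8p5 (l t : ℕ → ℝ) (X₀ : TightFlute)
    (hcomplete : X₀.GeodesicallyComplete)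
    (hl : RapidlyIncreasing l)
    (hl₀ : ∀ n : ℕ, 1 ≤ n → X₀.cuffLength n = l n)
    (ht₀ : ∀ n : ℕ, 1 ≤ n → X₀.HasTwist n (t n))
    (X : ℕ → TightFlute) (tw : ℕ → ℕ → ℝ)
    (hlX : ∀ k n : ℕ, 1 ≤ n → (X k).cuffLength n = l n)
    (htX : ∀ k n : ℕ, 1 ≤ n → (X k).HasTwist n (tw k n))
    (hO : ∃ C : ℝ, ∀ k n : ℕ, 1 ≤ n → |tw k n - t n| ≤ C * l n)
    (hlim : ∀ n : ℕ, 1 ≤ n →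
      Filter.Tendsto (fun k : ℕ => tw k n) Filter.atTop (nhds (t n))) :
    (∀ k : ℕ, TightFlute.InLengthSpectrumTeich X₀ (X k)) ∧
      Filter.Tendsto (fun k : ℕ => TightFlute.lsDist X₀ (X k) X₀) Filter.atTop (nhds 0) := by
  obtain ⟨C, hC⟩ := hO
  have hpos : ∀ n, 1 ≤ n → 0 < l n := fun n hn => by
    rw [← hl₀ n hn]
    exact X₀.cuff n hn
  have hhalf : ∀ n, 1 ≤ n → halfLen X₀ n = l n / 2 := fun n hn => by rw [halfLen, hl₀ n hn]
  have hmono : ∀ n, halfLen X₀ n < halfLen X₀ (n + 1) := by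
    rintro (_ | n)
    · rw [halfLen_zero]
      exact halfLen_pos X₀ le_rfl
    · rw [hhalf _ n.succ_pos, hhalf _ n.succ.succ_pos]
      linarith [hl.1 (n + 1) n.succ_pos]
  have heq : ∀ k n, halfLen X₀ n = halfLen (X k) n := by
    rintro k (_ | n)
    · rw [halfLen_zero, halfLen_zero]
    · rw [hhalf _ n.succ_pos, halfLen, hlX k _ n.succ_pos]
  have hheight : ∀ k n, pantsHeight (X k) n = pantsHeight X₀ n := fun k n => by
    rw [pantsHeight, pantsHeight, heq k, heq k]
  have hdist : ∀ k ε, 0 ≤ ε →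
      (∀ n, 1 ≤ n → 2 * ∑ i ∈ Finset.Icc 1 n, |tw k i - t i| ≤ ε * pantsHeight X₀ n) →
      (∀ g, X₀.IsSimpleClosedGeodesic g → 0 < (X k).length g) ∧
        TightFlute.lsDist X₀ (X k) X₀ ≤ ENNReal.ofReal (1 / 2 * ε) := by
    intro k ε hε h
    refine lsDist_le hε ?_ ?_
    · refine length_le (heq k) hmono ht₀ (htX k) hε fun n hn => ?_
      simpa only [abs_sub_comm] using h n hn
    · refine length_le (fun n => (heq k n).symm) (fun n => ?_) (htX k) ht₀ hε fun n hn => ?_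
      · rw [← heq k, ← heq k]
        exact hmono n
      · rw [hheight]
        exact h n hn
  -- N does not depend on k because C does not.
  have hlarge : ∀ ε, 0 < ε → ∃ N, ∀ k n, N ≤ n → 1 ≤ n →
      2 * ∑ i ∈ Finset.Icc 1 n, |tw k i - t i| ≤ ε * pantsHeight X₀ n := by
    intro ε hε
    obtain ⟨N, hN⟩ := exists_sum_le hl hpos (C := C) hε
    refine ⟨N, fun k n hn hn1 => (hN _ (fun i hi => hC k i hi) n hn hn1).trans ?_⟩
    refine mul_le_mul_of_nonneg_left ?_ hε.le
    have := half_sub_le_pantsHeight X₀ hn1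
    rw [hhalf _ hn1, hhalf _ n.succ_pos] at this
    linarith
  constructor
  · intro k
    obtain ⟨N, hN⟩ := hlarge 1 one_pos
    -- For membership any finite factor will do: 1 serves for n ≥ N, and the sum of the finitely
    -- many remaining ratios is added.
    set S : ℕ → ℝ := fun n => |2 * (∑ i ∈ Finset.Icc 1 n, |tw k i - t i|) / pantsHeight X₀ n| with hS
    have hM : 0 ≤ ∑ n ∈ Finset.range N, S n := Finset.sum_nonneg fun _ _ => abs_nonneg _
    have := hdist k (1 + ∑ n ∈ Finset.range N, S n) (by linarith) fun n hn => ?_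
    · exact ⟨this.1, this.2.trans_lt ENNReal.ofReal_lt_top⟩
    have hh := pantsHeight_pos X₀ hn
    rcases le_or_gt N n with h | h
    · refine (hN k n h hn).trans (mul_le_mul_of_nonneg_right ?_ hh.le)
      linarith
    · rw [← div_le_iff₀ hh]
      have h1 : S n ≤ ∑ n ∈ Finset.range N, S n :=
        Finset.single_le_sum (fun _ _ => abs_nonneg _) (Finset.mem_range.2 h)
      have h2 := le_abs_self (2 * (∑ i ∈ Finset.Icc 1 n, |tw k i - t i|) / pantsHeight X₀ n)
      linarith
  · rw [ENNReal.tendsto_nhds_zero]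
    intro ε hε
    obtain ⟨e, he, heε⟩ : ∃ e : ℝ, 0 < e ∧ ENNReal.ofReal (1 / 2 * e) ≤ ε := by
      obtain ⟨r, hr, hrε⟩ := ENNReal.lt_iff_exists_nnreal_btwn.1 hε
      refine ⟨2 * r, by simpa using hr, ?_⟩
      rw [← mul_assoc, one_div, inv_mul_cancel₀ two_ne_zero, one_mul, ENNReal.ofReal_coe_nnreal]
      exact hrε.le
    obtain ⟨N, hN⟩ := hlarge e he
    have hsmall : ∀ n, 1 ≤ n → ∀ᶠ k in Filter.atTop,
        2 * ∑ i ∈ Finset.Icc 1 n, |tw k i - t i| ≤ e * pantsHeight X₀ n := by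
      intro n hn
      have h1 : Filter.Tendsto (fun k => 2 * ∑ i ∈ Finset.Icc 1 n, |tw k i - t i|) Filter.atTop
          (nhds (2 * ∑ i ∈ Finset.Icc 1 n, |t i - t i|)) :=
        (tendsto_finsetSum _ fun i hi =>
          ((hlim i (Finset.mem_Icc.1 hi).1).sub_const (t i)).abs).const_mul 2
      simp only [sub_self, abs_zero, Finset.sum_const_zero, mul_zero] at h1
      exact h1.eventually_le_const (mul_pos he (pantsHeight_pos X₀ hn))
    -- Below N, convergence of each single twist is enough, since finitely many conditions hold
    -- eventually at the same time.
    have hall : ∀ᶠ k in Filter.atTop, ∀ n ∈ Finset.range N, 1 ≤ n →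
        2 * ∑ i ∈ Finset.Icc 1 n, |tw k i - t i| ≤ e * pantsHeight X₀ n := by
      rw [Filter.eventually_all_finset]
      intro n _
      by_cases hn : 1 ≤ n
      · exact (hsmall n hn).mono fun k hk _ => hk
      · exact Filter.Eventually.of_forall fun k hk => absurd hk hn
    filter_upwards [hall] with k hk
    refine (hdist k e he.le fun n hn => ?_).2.trans heε
    rcases le_or_gt N n with h | h
    · exact hN k n h hn
    · exact hk n (Finset.mem_range.2 h) hn
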